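/- Let $\mu>1/2$. There exists an integer $m_*\ge 0$, depending only on $\mu$, such that for every integer $m>m_*$ the following holds. Put $\xi_m=e^{2\pi i/m}$, $\mathbb R_+=(0,\infty)$, and let $Z^*$ denote the complex conjugate of $Z$. There is a function $Z_m:[0,\infty)\times(-\infty,0)\to\mathbb C$, continuous on $[0,\infty)\times(-\infty,0)$, that solves the $m$-fold Birkhoff–Rott equation $$\partial_t Z_m^*(t,\Gamma)=\frac{1}{2m\pi i}\;\mathrm{p.v.}\!\int_{-\infty}^0\sum_{k=0}^{m-1}\frac{d\Gamma'}{Z_m(t,\Gamma)-\xi_m^kZ_m(t,\Gamma')}\qquad(t>0,\ \Gamma<0)$$ with initial data $$Z_m(0,\Gamma)=\Big(-\frac{2\mu-1}{\mu}\Gamma\Big)^{\frac{\mu}{2\mu-1}}\qquad(\Gamma<0).$$ Here the principal value is the limit as $\varepsilon\to0+$ of the integral over $\{\Gamma'<0:|\Gamma'-\Gamma|\ge\varepsilon\}$, on which the summed integrand is absolutely integrable. If $\mu<1$, then moreover each of the $m$ principal value integrals of the single summands converges in this sense, so that the right-hand side equals $\frac{1}{2m\pi i}\sum_{k=0}^{m-1}\mathrm{p.v.}\int_{-\infty}^0\frac{d\Gamma'}{Z_m(t,\Gamma)-\xi_m^kZ_m(t,\Gamma')}$.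 The solution has the following properties. (i) It is self-similar: there is $z_m:(-\infty,0)\to\mathbb C$ with $Z_m(t,\Gamma)=t^\mu z_m(t^{1-2\mu}\Gamma)$ for all $t>0$, $\Gamma<0$. (ii) One can write $z_m(\gamma)=r_m(\gamma)e^{i\theta_m(\gamma)}$ for $\gamma<0$, where $r_m,\theta_m:(-\infty,0)\to\mathbb R_+$ are $C^1$ bijections, $r_m$ strictly decreasing and $\theta_m$ strictly increasing. (iii) The function $\rho_m:=r_m\circ\theta_m^{-1}:\mathbb R_+\to\mathbb R_+$ is $C^1$, the functions $\theta\mapsto\theta^\mu\rho_m(\theta)$ and $\theta\mapsto\theta^{\mu+1}\rho_m'(\theta)$ are bounded on $\mathbb R_+$, and there is $\tilde\beta_m>0$ with $$\lim_{\theta\to+\infty}\theta^\mu\rho_m(\theta)=\tilde\beta_m,\qquad \lim_{\theta\to+\infty}\theta^{\mu+1}\rho_m'(\theta)=-\mu\tilde\beta_m .$$ -/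

import Mathlib

open Set Filter Topology MeasureTheory

noncomputable section

/-- `HasPV f a v`: the principal value integral of `f` over the half-line `(-∞, 0)`, with the
singularity at `a`, exists and equals `v`. Outside each symmetric interval around `a` the function
is (absolutely) integrable on `(-∞, 0)`, and the truncated integrals converge to `v`. -/
def HasPV (f : ℝ → ℂ) (a : ℝ) (v : ℂ) : Prop :=
  (∀ ε : ℝ, 0 < ε → IntegrableOn f (Iio 0 \ Ioo (a - ε) (a + ε))) ∧
    Tendsto (fun ε : ℝ => ∫ x in Iio 0 \ Ioo (a - ε) (a + ε), f x) (𝓝[>] 0) (𝓝 v)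

/-- The root of unity `ξ_m = exp (2πi/m)`. -/
def xiRoot (m : ℕ) : ℂ := Complex.exp (2 * Real.pi * Complex.I / m)

/-- The kernel `1 / (w Γ - ξ_m ^ k * w Γ')` of the `k`-th branch of the sheet `w`. -/
def branchKernel (m k : ℕ) (w : ℝ → ℂ) (Γ Γ' : ℝ) : ℂ :=
  1 / (w Γ - xiRoot m ^ k * w Γ')

/-- The `m`-fold Birkhoff–Rott equation for `t > 0`, `Γ < 0`. The principal value is that of the
sum over the `m` branches, which decays like `|w Γ'| ^ (-m)` at infinity; the integral of a single
branch need not converge at `Γ' = -∞`. -/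
def SolvesBirkhoffRott (m : ℕ) (Z : ℝ → ℝ → ℂ) : Prop :=
  ∀ t : ℝ, 0 < t → ∀ Γ : ℝ, Γ < 0 → ∃ v : ℂ,
    HasPV (fun Γ' => ∑ k ∈ Finset.range m, branchKernel m k (Z t) Γ Γ') Γ v ∧
    HasDerivAt (fun s => (starRingEnd ℂ) (Z s Γ)) (1 / (2 * m * Real.pi * Complex.I) * v) t

/-- The `m`-fold Birkhoff–Rott equation for `t > 0`, `Γ < 0`, where moreover each of the `m`
principal value integrals converges separately. -/
def SolvesBirkhoffRottBranchwise (m : ℕ) (Z : ℝ → ℝ → ℂ) : Prop :=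
  ∀ t : ℝ, 0 < t → ∀ Γ : ℝ, Γ < 0 → ∃ v : ℕ → ℂ,
    (∀ k ∈ Finset.range m, HasPV (branchKernel m k (Z t) Γ) Γ (v k)) ∧
    HasDerivAt (fun s => (starRingEnd ℂ) (Z s Γ))
      (1 / (2 * m * Real.pi * Complex.I) * ∑ k ∈ Finset.range m, v k) t

/-- The radius as a function of the angle, `r ∘ θ⁻¹` with `θ⁻¹` the inverse of `θ` on `(-∞, 0)`. -/
def radiusOfAngle (r θ : ℝ → ℝ) : ℝ → ℝ := r ∘ Function.invFunOn θ (Iio 0)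

end

/-! Put a = 2μ - 1 and label the sheet by T > 0 with -Γ = b² t^a T^{-a}. At fixed Γ the label T is
proportional to t, and the unperturbed spiral is T^{-μ} e^{iT}. The work takes place on the whole
line in x = T + log T, with weight σ = 1/(1+T), the derivative of log T; x → -∞ is the outer end and
x → +∞ the centre.

Partial fractions turn the sum over the m branches into (m/Z)/(1 - (Z'/Z)^m). If the profile has
logarithmic derivative -p and Ψ is a primitive of p, then (Z'/Z)^m = E = exp(m(Ψ(x) - Ψ(y))), with
|E| < 1 towards the centre (y > x) and |E| > 1 outwards. Expanding 1/(1-E) geometrically on either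
side gives the principal value (m/Z)(-Γ)(1+g): the 1 is the enclosed circulation, and g is a times
the sum over the frequencies κ = m, 2m, 3m, ... of an inner term minus an outer term. Conversely the
equation of motion determines p from g. Here Im g drives |Z|² through a factor Q with Q → 1 at the
centre, and p = μσ - i(1-σ)(1+ḡ)/Q. So the theorem reduces to a fixed-point problem for g, which is
small when m is large.

The core is an estimate of one frequency. The inner term is the bounded solution of u' = Pu - σ with
P = κp + aσ, and the outer term is its mirror image with -a in place of a; both are close to σ/P.
The function p contains g, which is only Hölder continuous of exponent 1/2, and the error is O(σ²
κ^{-3/2}) (`SpiralData.exists_norm_fwdInt_sub_le`). In the difference of the two terms the leading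
parts almost cancel, which leaves O(σ² κ^{-3/2}), with derivative O(σ² κ^{-1/2})
(`exists_norm_diffTerm_le`). Summing over κ gives back a function of Hölder exponent 1/2 with weight
σ² and norm O(m^{-1/2}) (`inBall_tsum`), so the class reproduces itself. For the contraction ḡ is
replaced by an independent function k. The dependence on (g, k) is then holomorphic, and the Schwarz
lemma turns sup bounds into Lipschitz bounds (`exists_norm_diffTerm_sub_le`). This yields
`exists_profile`.

The expansions hold only off the diagonal. On each side the truncated integral diverges like log δ,
with coefficients that cancel (`tendsto_integral_resummed`, `tendsto_integral_spiralKernel`).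
Cutoffs symmetric in Γ become cutoffs in x whose ratio tends to 1, so the cancellation survives the
change of variable (`hasPV_of_comp_circ`).

The initial data come from the limit of Q at the outer end, with b chosen to match the amplitude.
For μ < 1 every branch other than the sheet's own is absolutely integrable, and the own branch
follows by subtraction. The behaviour of the radius as a function of the angle follows from g =
O(σ²), Q → 1 and θ/T → 1. -/

/-! ### Slow weights and bounded solutions of u' = P u - F. -/

/-- A slowly varying weight `s` with values in `(0, 1]` and divergent integral `ℓ` at `+∞`. -/
structure SlowWeight (s ds ℓ : ℝ → ℝ) : Prop where
  pos : ∀ x, 0 < s x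
  le_one : ∀ x, s x ≤ 1
  hasDerivAt : ∀ x, HasDerivAt s (ds x) x
  abs_deriv_le : ∀ x, |ds x| ≤ s x ^ 2
  hasDerivAt_primitive : ∀ x, HasDerivAt ℓ (s x) x
  tendsto_primitive : Tendsto ℓ atTop atTop

/-- A continuous complex decay rate `P` with primitive `Φ`, dominating `k * s`. -/
structure DecayRate (s : ℝ → ℝ) (k : ℝ) (P Φ : ℝ → ℂ) : Prop where
  continuous : Continuous P
  hasDerivAt : ∀ x, HasDerivAt Φ (P x) x
  le_re : ∀ x, k * s x ≤ (P x).re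

/-- The bounded solution `∫_x^∞ F(y) exp(Φ(x) - Φ(y)) dy` of `u' = Φ' u - F`. -/
noncomputable def fwdInt (F Φ : ℝ → ℂ) (x : ℝ) : ℂ :=
  ∫ y in Ioi x, F y * Complex.exp (Φ x - Φ y)

namespace SlowWeight

variable {s ds ℓ : ℝ → ℝ}

theorem continuous (hs : SlowWeight s ds ℓ) : Continuous s :=
  continuous_iff_continuousAt.2 fun x => (hs.hasDerivAt x).continuousAt

theorem continuous_primitive (hs : SlowWeight s ds ℓ) : Continuous ℓ :=
  continuous_iff_continuousAt.2 fun x => (hs.hasDerivAt_primitive x).continuousAt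

/-- The bounds |s'| ≤ s² and s ≤ 1 make log s 1-Lipschitz, and e < 3. -/
theorem le_three_mul (hs : SlowWeight s ds ℓ) {x y : ℝ} (hxy : |x - y| ≤ 1) : s y ≤ 3 * s x := by
  have hl : ∀ z, HasDerivAt (fun z => Real.log (s z)) (ds z / s z) z := fun z =>
    (hs.hasDerivAt z).log (hs.pos z).ne'
  have hb : ∀ z ∈ (univ : Set ℝ), ‖ds z / s z‖ ≤ 1 := by
    intro z _
    have h0 := hs.pos z
    have h1 := hs.le_one z
    have h2 := hs.abs_deriv_le z
    rw [Real.norm_eq_abs, abs_div, abs_of_pos h0, div_le_one h0]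
    nlinarith
  have key := Convex.norm_image_sub_le_of_norm_hasDerivWithin_le
    (fun z _ => (hl z).hasDerivWithinAt) hb convex_univ (mem_univ x) (mem_univ y)
  rw [Real.norm_eq_abs, Real.norm_eq_abs, one_mul, abs_sub_comm y x] at key
  have h1 : Real.log (s y) ≤ Real.log (s x) + 1 := by
    have := (abs_le.1 key).2
    linarith
  have h2 := Real.exp_le_exp.2 h1
  rw [Real.exp_log (hs.pos y), Real.exp_add, Real.exp_log (hs.pos x)] at h2
  have h3 : Real.exp 1 < 3 := Real.exp_one_lt_three
  nlinarith [hs.pos x]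

theorem hasDerivAt_pow_mul_exp (hs : SlowWeight s ds ℓ) (b : ℕ) (k x y : ℝ) :
    HasDerivAt (fun y => s y ^ b * Real.exp (k * (ℓ x - ℓ y)))
      ((b * s y ^ (b - 1) * ds y - k * s y ^ (b + 1)) * Real.exp (k * (ℓ x - ℓ y))) y := by
  have h1 := (hs.hasDerivAt y).pow b
  have h2 := (((hs.hasDerivAt_primitive y).const_sub (ℓ x)).const_mul k).exp
  refine (h1.mul h2).congr_deriv ?_
  simp only [Pi.pow_apply]
  ring

theorem tendsto_exp (hs : SlowWeight s ds ℓ) {k : ℝ} (hk : 0 < k) (x : ℝ) :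
    Tendsto (fun y => Real.exp (k * (ℓ x - ℓ y))) atTop (𝓝 0) := by
  refine Real.tendsto_exp_atBot.comp (Tendsto.const_mul_atBot hk ?_)
  exact tendsto_atBot_add_const_left _ (ℓ x) (tendsto_neg_atTop_atBot.comp hs.tendsto_primitive)

theorem tendsto_pow_mul_exp (hs : SlowWeight s ds ℓ) (b : ℕ) {k : ℝ} (hk : 0 < k) (x : ℝ) :
    Tendsto (fun y => s y ^ b * Real.exp (k * (ℓ x - ℓ y))) atTop (𝓝 0) := by
  refine squeeze_zero (fun y => by have := hs.pos y; positivity) (fun y => ?_)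
    (hs.tendsto_exp hk x)
  exact mul_le_of_le_one_left (Real.exp_pos _).le (pow_le_one₀ (hs.pos y).le (hs.le_one y))

/-- Integration gains 1/k and costs one power of `s`. Since `ℓ' = s`, the integrand is, up to a
factor 2, at most the derivative of `-s ^ b * exp (k * (ℓ x - ℓ y)) / k`. Differentiating `s ^ b`
contributes at most `b * s ^ (b + 1)`, which `k > 2 b` absorbs. -/
theorem integrableOn_and_integral_le (hs : SlowWeight s ds ℓ) (b : ℕ) {k : ℝ} (hk : 2 * b < k) (x : ℝ) :
    IntegrableOn (fun y => s y ^ (b + 1) * Real.exp (k * (ℓ x - ℓ y))) (Ioi x) ∧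
      ∫ y in Ioi x, s y ^ (b + 1) * Real.exp (k * (ℓ x - ℓ y)) ≤ 2 / k * s x ^ b := by
  have hk0 : 0 < k := lt_of_le_of_lt (by positivity) hk
  set u : ℝ → ℝ := fun y => -(2 / k) * (s y ^ b * Real.exp (k * (ℓ x - ℓ y))) with hu
  set u' : ℝ → ℝ := fun y => -(2 / k) *
    ((b * s y ^ (b - 1) * ds y - k * s y ^ (b + 1)) * Real.exp (k * (ℓ x - ℓ y))) with hu'
  have hd : ∀ y, HasDerivAt u (u' y) y := fun y =>
    (hs.hasDerivAt_pow_mul_exp b k x y).const_mul _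
  have hle : ∀ y, s y ^ (b + 1) * Real.exp (k * (ℓ x - ℓ y)) ≤ u' y := by
    intro y
    have h0 := hs.pos y
    have hb : (b : ℝ) * s y ^ (b - 1) * ds y ≤ b * s y ^ (b + 1) := by
      rcases Nat.eq_zero_or_pos b with rfl | hb
      · simp
      · have : s y ^ (b + 1) = s y ^ (b - 1) * s y ^ 2 := by
          rw [← pow_add]; congr 1; omega
        rw [this, ← mul_assoc]
        exact mul_le_mul_of_nonneg_left ((le_abs_self _).trans (hs.abs_deriv_le y)) (by positivity)
    have he := Real.exp_pos (k * (ℓ x - ℓ y))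
    have hp : 0 < s y ^ (b + 1) := by positivity
    have : u' y = (2 / k * (k * s y ^ (b + 1) - b * s y ^ (b - 1) * ds y)) *
        Real.exp (k * (ℓ x - ℓ y)) := by simp only [hu']; ring
    rw [this]
    refine mul_le_mul_of_nonneg_right ?_ he.le
    rw [div_mul_eq_mul_div, le_div_iff₀ hk0]
    nlinarith
  have hpos : ∀ y, 0 ≤ s y ^ (b + 1) * Real.exp (k * (ℓ x - ℓ y)) := fun y => by
    have := hs.pos y; positivity
  have hlim : Tendsto u atTop (𝓝 0) := by
    simpa only [mul_zero] using (hs.tendsto_pow_mul_exp b hk0 x).const_mul (-(2 / k))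
  have hintg : IntegrableOn u' (Ioi x) :=
    integrableOn_Ioi_deriv_of_nonneg' (fun y _ => hd y) (fun y _ => (hpos y).trans (hle y)) hlim
  have hval : ∫ y in Ioi x, u' y = 0 - u x :=
    integral_Ioi_of_hasDerivAt_of_nonneg' (fun y _ => hd y)
      (fun y _ => (hpos y).trans (hle y)) hlim
  have hc : Continuous fun y => s y ^ (b + 1) * Real.exp (k * (ℓ x - ℓ y)) := by
    have h1 := hs.continuous
    have h2 := hs.continuous_primitive
    fun_prop
  have hintg' : IntegrableOn (fun y => s y ^ (b + 1) * Real.exp (k * (ℓ x - ℓ y))) (Ioi x) := by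
    refine Integrable.mono' hintg hc.aestronglyMeasurable (ae_of_all _ fun y => ?_)
    rw [Real.norm_eq_abs, abs_of_nonneg (hpos y)]
    exact hle y
  refine ⟨hintg', (integral_mono hintg' hintg hle).trans_eq ?_⟩
  rw [hval]
  simp [hu]

end SlowWeight

namespace DecayRate

variable {s ds ℓ : ℝ → ℝ} {k : ℝ} {P Φ : ℝ → ℂ}

theorem continuous_primitive (hP : DecayRate s k P Φ) : Continuous Φ :=
  continuous_iff_continuousAt.2 fun x => (hP.hasDerivAt x).continuousAt

/-- The function `Re Φ - k ℓ` has nonnegative derivative. -/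
theorem norm_exp_le (hs : SlowWeight s ds ℓ) (hP : DecayRate s k P Φ) {x y : ℝ} (hxy : x ≤ y) :
    ‖Complex.exp (Φ x - Φ y)‖ ≤ Real.exp (k * (ℓ x - ℓ y)) := by
  rw [Complex.norm_exp, Real.exp_le_exp]
  have hd : ∀ z, HasDerivAt (fun z => (Φ z).re - k * ℓ z) ((P z).re - k * s z) z := fun z =>
    (Complex.reCLM.hasFDerivAt.comp_hasDerivAt z (hP.hasDerivAt z)).sub
      ((hs.hasDerivAt_primitive z).const_mul k)
  have hm : Monotone fun z => (Φ z).re - k * ℓ z :=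
    monotone_of_deriv_nonneg (fun z => (hd z).differentiableAt) fun z => by
      rw [(hd z).deriv]; linarith [hP.le_re z]
  have := hm hxy
  simp only [Complex.sub_re] at *
  linarith

theorem norm_mul_exp_le (hs : SlowWeight s ds ℓ) (hP : DecayRate s k P Φ) {F : ℝ → ℂ} {M : ℝ}
    {b : ℕ} (hF : ∀ y, ‖F y‖ ≤ M * s y ^ b) {x y : ℝ} (hxy : x ≤ y) :
    ‖F y * Complex.exp (Φ x - Φ y)‖ ≤ M * (s y ^ b * Real.exp (k * (ℓ x - ℓ y))) := by
  rw [norm_mul, ← mul_assoc]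
  exact mul_le_mul (hF y) (norm_exp_le hs hP hxy) (norm_nonneg _) ((norm_nonneg _).trans (hF y))

theorem integrableOn (hs : SlowWeight s ds ℓ) (hP : DecayRate s k P Φ) {F : ℝ → ℂ} {M : ℝ}
    {b : ℕ} (hk : 2 * b < k) (hFc : Continuous F) (hF : ∀ y, ‖F y‖ ≤ M * s y ^ (b + 1)) (x : ℝ) :
    IntegrableOn (fun y => F y * Complex.exp (Φ x - Φ y)) (Ioi x) := by
  have hc := hP.continuous_primitive
  refine Integrable.mono' ((hs.integrableOn_and_integral_le b hk x).1.const_mul M)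
    (by fun_prop : Continuous fun y => F y * Complex.exp (Φ x - Φ y)).aestronglyMeasurable ?_
  filter_upwards [ae_restrict_mem measurableSet_Ioi] with y hy
  exact norm_mul_exp_le hs hP hF (le_of_lt hy)

/-- A crude bound, losing one power of `s` against the forcing. The sharper estimates below first
subtract an explicit approximate solution and apply it only to the defect, which is smaller in `s`
or in the frequency. -/
theorem norm_fwdInt_le (hs : SlowWeight s ds ℓ) (hP : DecayRate s k P Φ) {F : ℝ → ℂ} {M : ℝ}
    {b : ℕ} (hk : 2 * b < k) (hF : ∀ y, ‖F y‖ ≤ M * s y ^ (b + 1)) (x : ℝ) :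
    ‖fwdInt F Φ x‖ ≤ M * (2 / k) * s x ^ b := by
  have hM : 0 ≤ M := by
    have h1 := (norm_nonneg _).trans (hF 0)
    exact nonneg_of_mul_nonneg_left h1 (pow_pos (hs.pos 0) _)
  have h := hs.integrableOn_and_integral_le b hk x
  calc ‖fwdInt F Φ x‖
      ≤ ∫ y in Ioi x, M * (s y ^ (b + 1) * Real.exp (k * (ℓ x - ℓ y))) := by
        refine norm_integral_le_of_norm_le (h.1.const_mul M) ?_
        filter_upwards [ae_restrict_mem measurableSet_Ioi] with y hy
        exact norm_mul_exp_le hs hP hF (le_of_lt hy)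
    _ = M * ∫ y in Ioi x, s y ^ (b + 1) * Real.exp (k * (ℓ x - ℓ y)) := integral_const_mul _ _
    _ ≤ M * (2 / k * s x ^ b) := mul_le_mul_of_nonneg_left h.2 hM
    _ = _ := by ring

theorem tendsto_mul_exp (hs : SlowWeight s ds ℓ) (hP : DecayRate s k P Φ) (hk : 0 < k)
    {F : ℝ → ℂ} {M : ℝ} (hF : ∀ y, ‖F y‖ ≤ M) (x : ℝ) :
    Tendsto (fun y => F y * Complex.exp (Φ x - Φ y)) atTop (𝓝 0) := by
  have h0 : Tendsto (fun y => M * Real.exp (k * (ℓ x - ℓ y))) atTop (𝓝 0) := by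
    simpa using (hs.tendsto_exp hk x).const_mul M
  refine squeeze_zero_norm' ?_ h0
  filter_upwards [eventually_ge_atTop x] with y hy
  have := norm_mul_exp_le hs hP (b := 0) (F := F) (M := M) (by simpa using hF) hy
  simpa using this

/-- An approximate solution `u` of `u' = P u - F` differs from the exact one by the solution with
the defect as forcing. -/
theorem fwdInt_eq_add (hs : SlowWeight s ds ℓ) (hP : DecayRate s k P Φ) (hk : 0 < k)
    {F u u' : ℝ → ℂ} {M : ℝ} (hu : ∀ y, HasDerivAt u (u' y) y) (huM : ∀ y, ‖u y‖ ≤ M) {x : ℝ}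
    (hF : IntegrableOn (fun y => F y * Complex.exp (Φ x - Φ y)) (Ioi x))
    (hG : IntegrableOn (fun y => (F y - P y * u y + u' y) * Complex.exp (Φ x - Φ y)) (Ioi x)) :
    fwdInt F Φ x = u x + fwdInt (fun y => F y - P y * u y + u' y) Φ x := by
  have hd : ∀ y ∈ Ici x, HasDerivAt (fun y => u y * Complex.exp (Φ x - Φ y))
      ((F y - P y * u y + u' y) * Complex.exp (Φ x - Φ y) - F y * Complex.exp (Φ x - Φ y)) y := by
    intro y _
    refine ((hu y).mul ((hP.hasDerivAt y).const_sub (Φ x)).cexp).congr_deriv ?_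
    ring
  have h := integral_Ioi_of_hasDerivAt_of_tendsto' hd (hG.sub hF) (tendsto_mul_exp hs hP hk huM x)
  rw [integral_sub hG hF] at h
  simp only [sub_self, Complex.exp_zero, mul_one] at h
  unfold fwdInt
  linear_combination -h

/-- With `exp (Φ x)` pulled out, the remaining integral depends on `x` only through its lower limit.
-/
theorem hasDerivAt_fwdInt (hP : DecayRate s k P Φ)
    {F : ℝ → ℂ} (hFc : Continuous F)
    (hF : ∀ x, IntegrableOn (fun y => F y * Complex.exp (Φ x - Φ y)) (Ioi x)) (x : ℝ) :
    HasDerivAt (fwdInt F Φ) (P x * fwdInt F Φ x - F x) x := by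
  have hc := hP.continuous_primitive
  set H : ℝ → ℂ := fun y => F y * Complex.exp (-Φ y) with hH
  have hHc : Continuous H := by fun_prop
  have hHi : ∀ x, IntegrableOn H (Ioi x) := by
    intro x
    refine ((hF x).const_mul (Complex.exp (-Φ x))).congr (ae_of_all _ fun y => ?_)
    simp only [hH]
    rw [sub_eq_add_neg, Complex.exp_add, Complex.exp_neg (Φ x)]
    field_simp [Complex.exp_ne_zero]
  have heq : fwdInt F Φ = fun x => Complex.exp (Φ x) * ((∫ y in Ioi 0, H y) - ∫ y in (0:ℝ)..x, H y) := by
    funext x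
    have h1 : (∫ y in Ioi 0, H y) - ∫ y in (0:ℝ)..x, H y = ∫ y in Ioi x, H y := by
      rw [← intervalIntegral.integral_Ioi_sub_Ioi' (hHi 0) (hHi x)]
      ring
    rw [h1, ← integral_const_mul]
    refine integral_congr_ae (ae_of_all _ fun y => ?_)
    simp only [hH]
    rw [sub_eq_add_neg, Complex.exp_add]
    ring
  have hI : HasDerivAt (fun x => ∫ y in (0:ℝ)..x, H y) (H x) x :=
    intervalIntegral.integral_hasDerivAt_right (hHc.intervalIntegrable _ _)
      hHc.aestronglyMeasurable.stronglyMeasurableAtFilter hHc.continuousAt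
  have h2 := (hP.hasDerivAt x).cexp.mul (hI.const_sub (∫ y in Ioi 0, H y))
  rw [heq]
  refine h2.congr_deriv ?_
  simp only [hH]
  have : Complex.exp (Φ x) * Complex.exp (-Φ x) = 1 := by
    rw [← Complex.exp_add]; simp
  linear_combination -F x * this

end DecayRate


theorem fwdInt_add {F G Φ : ℝ → ℂ} {x : ℝ}
    (hF : IntegrableOn (fun y => F y * Complex.exp (Φ x - Φ y)) (Ioi x))
    (hG : IntegrableOn (fun y => G y * Complex.exp (Φ x - Φ y)) (Ioi x)) :
    fwdInt (fun y => F y + G y) Φ x = fwdInt F Φ x + fwdInt G Φ x := by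
  unfold fwdInt
  rw [← integral_add hF hG]
  simp only [add_mul]

theorem fwdInt_const_mul (c : ℂ) (F Φ : ℝ → ℂ) (x : ℝ) :
    fwdInt (fun y => c * F y) Φ x = c * fwdInt F Φ x := by
  unfold fwdInt
  rw [← integral_const_mul]
  simp only [mul_assoc]

/-! ### Calculus of slowly varying functions. -/

/-- `f` is differentiable with `f = O(s ^ b)` and `f' = O(s ^ (b + 1))`. -/
structure SlowOrder (s : ℝ → ℝ) (b : ℕ) (M : ℝ) (f df : ℝ → ℂ) : Prop where
  hasDerivAt : ∀ x, HasDerivAt f (df x) x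
  norm_le : ∀ x, ‖f x‖ ≤ M * s x ^ b
  norm_deriv_le : ∀ x, ‖df x‖ ≤ M * s x ^ (b + 1)

namespace SlowOrder

variable {s : ℝ → ℝ} {b b' : ℕ} {M M' : ℝ} {f df g dg : ℝ → ℂ}

theorem continuous (hf : SlowOrder s b M f df) : Continuous f :=
  continuous_iff_continuousAt.2 fun x => (hf.hasDerivAt x).continuousAt

theorem mul (hs : ∀ x, 0 < s x) (hf : SlowOrder s b M f df) (hg : SlowOrder s b' M' g dg) :
    SlowOrder s (b + b') (2 * (M * M')) (fun x => f x * g x)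
      (fun x => df x * g x + f x * dg x) := by
  have hM : 0 ≤ M := nonneg_of_mul_nonneg_left ((norm_nonneg _).trans (hf.norm_le 0))
    (pow_pos (hs 0) _)
  have hM' : 0 ≤ M' := nonneg_of_mul_nonneg_left ((norm_nonneg _).trans (hg.norm_le 0))
    (pow_pos (hs 0) _)
  refine ⟨fun x => (hf.hasDerivAt x).mul (hg.hasDerivAt x), fun x => ?_, fun x => ?_⟩
  · have h0 := (hs x).le
    rw [norm_mul]
    calc ‖f x‖ * ‖g x‖ ≤ (M * s x ^ b) * (M' * s x ^ b') :=
          mul_le_mul (hf.norm_le x) (hg.norm_le x) (norm_nonneg _) (by positivity)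
      _ = (M * M') * s x ^ (b + b') := by ring
      _ ≤ _ := mul_le_mul_of_nonneg_right (by nlinarith [mul_nonneg hM hM']) (by positivity)
  · have h0 := (hs x).le
    refine (norm_add_le _ _).trans ?_
    rw [norm_mul, norm_mul]
    calc ‖df x‖ * ‖g x‖ + ‖f x‖ * ‖dg x‖
        ≤ (M * s x ^ (b + 1)) * (M' * s x ^ b') + (M * s x ^ b) * (M' * s x ^ (b' + 1)) :=
          add_le_add
            (mul_le_mul (hf.norm_deriv_le x) (hg.norm_le x) (norm_nonneg _) (by positivity))
            (mul_le_mul (hf.norm_le x) (hg.norm_deriv_le x) (norm_nonneg _) (by positivity))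
      _ = _ := by ring

theorem add (hf : SlowOrder s b M f df) (hg : SlowOrder s b M' g dg) :
    SlowOrder s b (M + M') (fun x => f x + g x) (fun x => df x + dg x) := by
  refine ⟨fun x => (hf.hasDerivAt x).add (hg.hasDerivAt x), fun x => ?_, fun x => ?_⟩
  · rw [add_mul]
    exact (norm_add_le _ _).trans (add_le_add (hf.norm_le x) (hg.norm_le x))
  · rw [add_mul]
    exact (norm_add_le _ _).trans (add_le_add (hf.norm_deriv_le x) (hg.norm_deriv_le x))

/-- The variation of `f` over an interval of length at most one. -/
theorem norm_sub_le {ds ℓ : ℝ → ℝ} (hw : SlowWeight s ds ℓ) (hf : SlowOrder s b M f df)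
    {x y : ℝ} (hxy : |x - y| ≤ 1) :
    ‖f x - f y‖ ≤ M * 3 ^ (b + 1) * s x ^ (b + 1) * |x - y| := by
  have hM : 0 ≤ M := nonneg_of_mul_nonneg_left ((norm_nonneg _).trans (hf.norm_le 0))
    (pow_pos (hw.pos 0) _)
  have key := Convex.norm_image_sub_le_of_norm_hasDerivWithin_le (f := f) (f' := df)
    (C := M * 3 ^ (b + 1) * s x ^ (b + 1)) (s := uIcc x y)
    (fun z _ => (hf.hasDerivAt z).hasDerivWithinAt) (fun z hz => ?_) (convex_uIcc x y)
    right_mem_uIcc left_mem_uIcc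
  · rwa [Real.norm_eq_abs] at key
  · have h1 : |x - z| ≤ 1 := by
      rw [abs_sub_comm]
      exact (abs_sub_left_of_mem_uIcc hz).trans (by rwa [abs_sub_comm])
    calc ‖df z‖ ≤ M * s z ^ (b + 1) := hf.norm_deriv_le z
      _ ≤ M * (3 * s x) ^ (b + 1) := by
        have := hw.le_three_mul h1
        have := (hw.pos z).le
        gcongr
      _ = _ := by ring

end SlowOrder

/-! ### Decay rates of a spiral: smooth part, rough part, large frequency. -/

/-- The smooth part `μ s - i (1 - s) c` of the decay rate of a spiral. -/
noncomputable def smoothRate (μ : ℝ) (s : ℝ → ℝ) (c : ℝ → ℂ) (x : ℝ) : ℂ :=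
  μ * s x - Complex.I * (1 - s x) * c x

/-- Bounds on a spiral with smooth coefficient `c` and rough perturbation `r` of the rate. -/
structure SpiralData (μ χ : ℝ) (s ℓ : ℝ → ℝ) (c dc r : ℝ → ℂ) : Prop where
  pos : 0 < μ
  abs_sign_le : |χ| ≤ 1
  weight : SlowWeight s (fun x => χ * s x ^ 2 * (1 - s x)) ℓ
  hasDerivAt : ∀ x, HasDerivAt c (dc x) x
  norm_coeff_le : ∀ x, ‖c x‖ ≤ 2
  continuous_deriv : Continuous dc
  norm_deriv_le : ∀ x, ‖dc x‖ ≤ s x ^ 2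
  norm_rough_le : ∀ x, ‖r x‖ ≤ s x ^ 2
  norm_rough_sub_le : ∀ x y, |x - y| ≤ 1 → ‖r x - r y‖ ≤ s x ^ 2 * √|x - y|
  le_norm_smooth : ∀ x, 1 / 8 ≤ ‖smoothRate μ s c x‖
  le_norm_rate : ∀ x, 1 / 8 ≤ ‖smoothRate μ s c x + r x‖
  le_re_rate : ∀ x, μ / 2 * s x ≤ (smoothRate μ s c x + r x).re

/-- A function that is Hölder continuous of exponent `1/2` at unit scale is continuous. -/
theorem continuous_of_norm_sub_le_sqrt {f : ℝ → ℂ} {C : ℝ → ℝ}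
    (h : ∀ x y, |x - y| ≤ 1 → ‖f x - f y‖ ≤ C x * √|x - y|) : Continuous f := by
  refine continuous_iff_continuousAt.2 fun x => ?_
  have h0 : Tendsto (fun y => C x * √|x - y|) (𝓝 x) (𝓝 0) := by
    have : Continuous fun y => C x * √|x - y| := by fun_prop
    simpa using this.tendsto x
  refine tendsto_iff_norm_sub_tendsto_zero.2 (squeeze_zero' (Eventually.of_forall fun y =>
    norm_nonneg _) ?_ h0)
  filter_upwards [Metric.ball_mem_nhds x one_pos] with y hy
  rw [norm_sub_rev]
  refine h x y ?_
  rw [Metric.mem_ball, dist_comm, Real.dist_eq] at hy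
  exact hy.le

namespace SpiralData

variable {μ χ α κ : ℝ} {s ℓ : ℝ → ℝ} {c dc r P Φ : ℝ → ℂ}

theorem continuous_rough (h : SpiralData μ χ s ℓ c dc r) : Continuous r :=
  continuous_of_norm_sub_le_sqrt h.norm_rough_sub_le

theorem continuous_smooth (h : SpiralData μ χ s ℓ c dc r) : Continuous (smoothRate μ s c) := by
  have h1 := h.weight.continuous
  have h2 : Continuous c := continuous_iff_continuousAt.2 fun x => (h.hasDerivAt x).continuousAt
  unfold smoothRate
  fun_prop

theorem slow_weight (h : SpiralData μ χ s ℓ c dc r) :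
    SlowOrder s 1 1 (fun x => (s x : ℂ)) (fun x => ((χ * s x ^ 2 * (1 - s x) : ℝ) : ℂ)) := by
  refine ⟨fun x => (h.weight.hasDerivAt x).ofReal_comp, fun x => ?_, fun x => ?_⟩
  · rw [Complex.norm_real, Real.norm_eq_abs, abs_of_pos (h.weight.pos x)]; simp
  · rw [Complex.norm_real, Real.norm_eq_abs, one_mul]
    exact h.weight.abs_deriv_le x

theorem slow_coeff (h : SpiralData μ χ s ℓ c dc r) : SlowOrder s 0 2 c dc := by
  refine ⟨h.hasDerivAt, fun x => by simpa using h.norm_coeff_le x, fun x => ?_⟩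
  have h0 := (h.weight.pos x).le
  have h1 := h.weight.le_one x
  refine (h.norm_deriv_le x).trans ?_
  rw [zero_add, pow_one]
  nlinarith

theorem slow_const (h : SpiralData μ χ s ℓ c dc r) (w : ℂ) :
    SlowOrder s 0 ‖w‖ (fun _ => w) (fun _ => 0) := by
  refine ⟨fun x => hasDerivAt_const x w, fun x => by simp, fun x => ?_⟩
  have h0 := (h.weight.pos x).le
  rw [norm_zero]; positivity

theorem slow_one_sub (h : SpiralData μ χ s ℓ c dc r) :
    SlowOrder s 0 1 (fun x => 1 - (s x : ℂ))
      (fun x => -((χ * s x ^ 2 * (1 - s x) : ℝ) : ℂ)) := by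
  refine ⟨fun x => (h.slow_weight.hasDerivAt x).const_sub 1, fun x => ?_, fun x => ?_⟩
  · have h0 := (h.weight.pos x).le
    have h1 := h.weight.le_one x
    have : (1 - (s x : ℂ)) = ((1 - s x : ℝ) : ℂ) := by push_cast; ring
    rw [this, Complex.norm_real, Real.norm_eq_abs, abs_of_nonneg (by linarith)]
    simpa using h0
  · have h0 := (h.weight.pos x).le
    have h1 := h.weight.le_one x
    rw [norm_neg]
    refine (h.slow_weight.norm_deriv_le x).trans ?_
    calc 1 * s x ^ (1 + 1) = s x * s x := by ring
      _ ≤ s x * 1 := mul_le_mul_of_nonneg_left h1 h0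
      _ = 1 * s x ^ (0 + 1) := by ring

/-- The derivative of the smooth part of the rate. -/
noncomputable def derivSmooth (μ χ : ℝ) (s : ℝ → ℝ) (c dc : ℝ → ℂ) (x : ℝ) : ℂ :=
  χ * s x ^ 2 * (1 - s x) * (μ + Complex.I * c x) - Complex.I * (1 - s x) * dc x

theorem slow_smooth (h : SpiralData μ χ s ℓ c dc r) :
    SlowOrder s 0 (μ + 3) (smoothRate μ s c) (derivSmooth μ χ s c dc) := by
  have hn : ∀ x, ‖(1 : ℂ) - s x‖ ≤ 1 := fun x => by simpa using h.slow_one_sub.norm_le x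
  refine ⟨fun x => ?_, fun x => ?_, fun x => ?_⟩
  · have h1 := h.slow_weight.hasDerivAt x
    have h2 := h.hasDerivAt x
    refine ((h1.const_mul (μ : ℂ)).sub
      (((h1.const_sub 1).const_mul Complex.I).mul h2)).congr_deriv ?_
    unfold derivSmooth
    push_cast
    ring
  · have h0 := (h.weight.pos x).le
    have h1 := h.weight.le_one x
    unfold smoothRate
    refine (norm_sub_le _ _).trans ?_
    simp only [norm_mul, Complex.norm_real, Real.norm_eq_abs, Complex.norm_I, pow_zero, mul_one,
      one_mul, abs_of_pos h.pos, abs_of_nonneg h0]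
    have := mul_le_mul (hn x) (h.norm_coeff_le x) (norm_nonneg _) zero_le_one
    nlinarith [h.pos]
  · have h0 := (h.weight.pos x).le
    have h1 := h.weight.le_one x
    unfold derivSmooth
    refine (norm_sub_le _ _).trans ?_
    have e1 : ‖(χ : ℂ) * s x ^ 2 * (1 - s x)‖ ≤ s x ^ 2 := by
      have := h.slow_weight.norm_deriv_le x
      push_cast at this
      simpa using this
    have e2 : ‖(μ : ℂ) + Complex.I * c x‖ ≤ μ + 2 := by
      refine (norm_add_le _ _).trans ?_
      simp only [norm_mul, Complex.norm_real, Real.norm_eq_abs, Complex.norm_I, one_mul,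
        abs_of_pos h.pos]
      linarith [h.norm_coeff_le x]
    have e3 : ‖Complex.I * (1 - s x) * dc x‖ ≤ s x ^ 2 := by
      rw [norm_mul, norm_mul, Complex.norm_I, one_mul]
      calc _ ≤ 1 * s x ^ 2 := mul_le_mul (hn x) (h.norm_deriv_le x) (norm_nonneg _) zero_le_one
        _ = _ := one_mul _
    rw [norm_mul]
    have e4 := mul_le_mul e1 e2 (norm_nonneg _) (by positivity)
    rw [zero_add, pow_one]
    have : s x ^ 2 ≤ s x := by nlinarith
    nlinarith [h.pos]

/-- The derivative of the inverse of the smooth part of the rate. -/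
noncomputable def derivInvSmooth (μ χ : ℝ) (s : ℝ → ℝ) (c dc : ℝ → ℂ) (x : ℝ) : ℂ :=
  -derivSmooth μ χ s c dc x / smoothRate μ s c x ^ 2

theorem smooth_ne_zero (h : SpiralData μ χ s ℓ c dc r) (x : ℝ) : smoothRate μ s c x ≠ 0 :=
  norm_pos_iff.1 (lt_of_lt_of_le (by norm_num) (h.le_norm_smooth x))

theorem slow_inv_smooth (h : SpiralData μ χ s ℓ c dc r) :
    SlowOrder s 0 (64 * (μ + 3)) (fun x => (smoothRate μ s c x)⁻¹)
      (derivInvSmooth μ χ s c dc) := by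
  have hi : ∀ x, ‖(smoothRate μ s c x)⁻¹‖ ≤ 8 := fun x => by
    rw [norm_inv]
    exact inv_le_of_inv_le₀ (by norm_num) (by simpa using h.le_norm_smooth x)
  refine ⟨fun x => (h.slow_smooth.hasDerivAt x).inv (h.smooth_ne_zero x), fun x => ?_,
    fun x => ?_⟩
  · have := hi x
    have := h.pos
    simp only [pow_zero, mul_one]
    linarith
  · have h1 := h.slow_smooth.norm_deriv_le x
    have h2 : derivInvSmooth μ χ s c dc x =
        -derivSmooth μ χ s c dc x * (smoothRate μ s c x)⁻¹ ^ 2 := by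
      unfold derivInvSmooth; rw [inv_pow]; rfl
    rw [h2, norm_mul, norm_neg, norm_pow]
    have h3 : ‖(smoothRate μ s c x)⁻¹‖ ^ 2 ≤ 64 := by
      calc _ ≤ (8 : ℝ) ^ 2 := pow_le_pow_left₀ (norm_nonneg _) (hi x) 2
        _ = 64 := by norm_num
    calc _ ≤ ((μ + 3) * s x ^ (0 + 1)) * 64 :=
          mul_le_mul h1 h3 (by positivity) ((norm_nonneg _).trans h1)
      _ = _ := by ring

end SpiralData


/-- The decay rate at frequency `κ`. -/
noncomputable def fullRate (μ α κ : ℝ) (s : ℝ → ℝ) (c r : ℝ → ℂ) (x : ℝ) : ℂ :=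
  κ * (smoothRate μ s c x + r x) + α * s x

/-- The frequency `κ` is large enough for the rate to dominate `κ μ / 4 * s`. -/
structure LargeFreq (μ α κ : ℝ) : Prop where
  one_le : 1 ≤ κ
  lt_mul : 24 < κ * μ
  abs_le : 16 * |α| ≤ κ
  abs_le_mul : 4 * |α| ≤ κ * μ

theorem mul_le_mul_sqrt {a C : ℝ} (ha0 : 0 ≤ a) (ha : a ≤ 1) (hC : 0 ≤ C) :
    C * a ≤ C * √a := by
  refine mul_le_mul_of_nonneg_left ?_ hC
  calc a = √a * √a := (Real.mul_self_sqrt ha0).symm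
    _ ≤ √a * 1 := mul_le_mul_of_nonneg_left (Real.sqrt_le_one.2 ha) (Real.sqrt_nonneg _)
    _ = √a := mul_one _

namespace SpiralData

variable {μ χ α κ : ℝ} {s ℓ : ℝ → ℝ} {c dc r Φ : ℝ → ℂ}

theorem continuous_fullRate (h : SpiralData μ χ s ℓ c dc r) :
    Continuous (fullRate μ α κ s c r) := by
  have h1 := h.continuous_smooth
  have h2 := h.continuous_rough
  have h3 := h.weight.continuous
  unfold fullRate
  fun_prop

/-- Before the correction `α s` the real part is at least `κ μ / 2 * s`; the condition `4 |α| ≤ κ μ`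
lets half of this absorb the correction. -/
theorem decayRate (h : SpiralData μ χ s ℓ c dc r) (hκ : LargeFreq μ α κ)
    (hΦ : ∀ x, HasDerivAt Φ (fullRate μ α κ s c r x) x) :
    DecayRate s (κ * μ / 4) (fullRate μ α κ s c r) Φ := by
  refine ⟨h.continuous_fullRate, hΦ, fun x => ?_⟩
  have h1 : (fullRate μ α κ s c r x).re =
      κ * (smoothRate μ s c x + r x).re + α * s x := by
    unfold fullRate
    rw [Complex.add_re, Complex.re_ofReal_mul, Complex.re_ofReal_mul, Complex.ofReal_re]
  rw [h1]
  have h2 := mul_le_mul_of_nonneg_left (h.le_re_rate x) (zero_le_one.trans hκ.one_le)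
  have h3 := h.weight.pos x
  have h4 := mul_le_mul_of_nonneg_right hκ.abs_le_mul h3.le
  have h5 := mul_le_mul_of_nonneg_right (neg_abs_le α) h3.le
  nlinarith

theorem le_norm_fullRate (h : SpiralData μ χ s ℓ c dc r) (hκ : LargeFreq μ α κ) (x : ℝ) :
    κ / 16 ≤ ‖fullRate μ α κ s c r x‖ := by
  have h0 := h.weight.pos x
  have h1 := h.weight.le_one x
  have hk := hκ.one_le
  have h2 : ‖(κ : ℂ) * (smoothRate μ s c x + r x)‖ ≥ κ / 8 := by
    rw [norm_mul, Complex.norm_real, Real.norm_eq_abs, abs_of_pos (by linarith)]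
    nlinarith [h.le_norm_rate x]
  have h3 : ‖(α : ℂ) * s x‖ ≤ κ / 16 := by
    rw [norm_mul, Complex.norm_real, Complex.norm_real, Real.norm_eq_abs, Real.norm_eq_abs,
      abs_of_pos h0]
    nlinarith [hκ.abs_le, abs_nonneg α]
  have h4 := norm_sub_le (fullRate μ α κ s c r x) ((α : ℂ) * s x)
  unfold fullRate at *
  rw [add_sub_cancel_right] at h4
  linarith

theorem fullRate_ne_zero (h : SpiralData μ χ s ℓ c dc r) (hκ : LargeFreq μ α κ) (x : ℝ) :
    fullRate μ α κ s c r x ≠ 0 :=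
  norm_pos_iff.1 (lt_of_lt_of_le (by linarith [hκ.one_le]) (h.le_norm_fullRate hκ x))

theorem norm_fullRate_le (h : SpiralData μ χ s ℓ c dc r) (hκ : LargeFreq μ α κ) (x : ℝ) :
    ‖fullRate μ α κ s c r x‖ ≤ κ * (μ + 5) := by
  have h0 := h.weight.pos x
  have h1 := h.weight.le_one x
  have hk := hκ.one_le
  have h2 : ‖smoothRate μ s c x‖ ≤ μ + 3 := by simpa using h.slow_smooth.norm_le x
  have h3 : ‖r x‖ ≤ 1 := (h.norm_rough_le x).trans (pow_le_one₀ h0.le h1)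
  unfold fullRate
  refine (norm_add_le _ _).trans ?_
  rw [norm_mul, norm_mul, Complex.norm_real, Complex.norm_real, Complex.norm_real,
    Real.norm_eq_abs, Real.norm_eq_abs, Real.norm_eq_abs, abs_of_pos h0, abs_of_pos (by linarith)]
  have h4 := norm_add_le (smoothRate μ s c x) (r x)
  have h5 : |α| * s x ≤ κ := by nlinarith [hκ.abs_le, abs_nonneg α]
  nlinarith

theorem norm_fullRate_sub_le (h : SpiralData μ χ s ℓ c dc r) (hκ : LargeFreq μ α κ) {x y : ℝ}
    (hxy : |x - y| ≤ 1) :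
    ‖fullRate μ α κ s c r x - fullRate μ α κ s c r y‖ ≤ κ * (3 * μ + 19) * √|x - y| := by
  have h0 := h.weight.pos x
  have h1 := h.weight.le_one x
  have hk := hκ.one_le
  have hμ := h.pos
  set d := |x - y|
  have hd0 : 0 ≤ d := abs_nonneg _
  have hsq : d ≤ √d := by simpa using mul_le_mul_sqrt hd0 hxy zero_le_one
  have e1 : ‖smoothRate μ s c x - smoothRate μ s c y‖ ≤ (3 * μ + 9) * √d := by
    refine (h.slow_smooth.norm_sub_le h.weight hxy).trans ?_
    rw [zero_add, pow_one, pow_one]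
    calc (μ + 3) * 3 * s x * d ≤ (μ + 3) * 3 * 1 * √d := by gcongr
      _ = _ := by ring
  have e2 : ‖r x - r y‖ ≤ 1 * √d := by
    refine (h.norm_rough_sub_le x y hxy).trans ?_
    gcongr
    exact pow_le_one₀ h0.le h1
  have e3 : ‖(s x : ℂ) - s y‖ ≤ 9 * √d := by
    refine (h.slow_weight.norm_sub_le h.weight hxy).trans ?_
    calc 1 * 3 ^ (1 + 1) * s x ^ (1 + 1) * d ≤ 1 * 3 ^ (1 + 1) * 1 ^ (1 + 1) * √d := by gcongr
      _ = _ := by ring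
  have e : fullRate μ α κ s c r x - fullRate μ α κ s c r y =
      κ * ((smoothRate μ s c x - smoothRate μ s c y) + (r x - r y)) + α * ((s x : ℂ) - s y) := by
    unfold fullRate; ring
  rw [e]
  refine (norm_add_le _ _).trans ?_
  rw [norm_mul, norm_mul, Complex.norm_real, Complex.norm_real, Real.norm_eq_abs,
    Real.norm_eq_abs, abs_of_pos (by linarith : 0 < κ)]
  have e4 := norm_add_le (smoothRate μ s c x - smoothRate μ s c y) (r x - r y)
  have e5 : |α| * ‖(s x : ℂ) - s y‖ ≤ (κ / 16) * (9 * √d) :=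
    mul_le_mul (by linarith [hκ.abs_le]) e3 (norm_nonneg _) (by linarith)
  have hq : 0 ≤ κ * √d := by positivity
  have e6 := mul_le_mul_of_nonneg_left (e4.trans (add_le_add e1 e2)) (by linarith : 0 ≤ κ)
  nlinarith

/-! ### High-frequency asymptotics of the bounded solution. -/

/-- The constant in the bound for slowly varying forcing. -/
noncomputable def slowConst (μ α : ℝ) : ℝ := 8 + (16 + 8 * |α| + 64 * (μ + 3)) * (8 / μ)

/-- The approximate solution is F/(κ · smooth rate). Each part of its defect gains a power of `s`:
differentiation does, and so do the rough rate and the term `α s`. The crude bound on an O(s³)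
defect then costs only O(s²/κ), so the order of the forcing is kept. -/
theorem norm_fwdInt_slow_le (h : SpiralData μ χ s ℓ c dc r) (hκ : LargeFreq μ α κ)
    (hΦ : ∀ x, HasDerivAt Φ (fullRate μ α κ s c r x) x) {M : ℝ} {F dF : ℝ → ℂ}
    (hF : SlowOrder s 2 M F dF) (hdF : Continuous dF) (x : ℝ) :
    ‖fwdInt F Φ x‖ ≤ slowConst μ α * M * s x ^ 2 / κ := by
  have hP := h.decayRate hκ hΦ
  have hκ1 := hκ.one_le
  have hκ0 : 0 < κ := by linarith
  have hμ := h.pos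
  -- The decay constant must exceed 2b, with b = 2 because the defect is O(s³).
  have hk : 2 * ((2 : ℕ) : ℝ) < κ * μ / 4 := by have := hκ.lt_mul; push_cast; linarith
  have hk0 : 0 < κ * μ / 4 := by positivity
  have hM : 0 ≤ M := nonneg_of_mul_nonneg_left ((norm_nonneg _).trans (hF.norm_le 0))
    (pow_pos (h.weight.pos 0) _)
  set j : ℝ → ℂ := fun x => (smoothRate μ s c x)⁻¹ with hj
  have hjn : ∀ x, ‖j x‖ ≤ 8 := fun x => by
    simp only [hj]
    rw [norm_inv]
    exact inv_le_of_inv_le₀ (by norm_num) (by simpa using h.le_norm_smooth x)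
  set dj := derivInvSmooth μ χ s c dc with hdj
  have hdjn : ∀ x, ‖dj x‖ ≤ 64 * (μ + 3) * s x := fun x => by
    simpa using h.slow_inv_smooth.norm_deriv_le x
  have hjd : ∀ x, HasDerivAt j (dj x) x := h.slow_inv_smooth.hasDerivAt
  set u : ℝ → ℂ := fun x => (κ : ℂ)⁻¹ * (F x * j x) with hu
  set u' : ℝ → ℂ := fun x => (κ : ℂ)⁻¹ * (dF x * j x + F x * dj x) with hu'
  have hud : ∀ x, HasDerivAt u (u' x) x := fun x =>
    ((hF.hasDerivAt x).mul (hjd x)).const_mul _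
  have hκn : ‖(κ : ℂ)⁻¹‖ = κ⁻¹ := by
    rw [norm_inv, Complex.norm_real, Real.norm_eq_abs, abs_of_pos hκ0]
  have hub : ∀ x, ‖u x‖ ≤ κ⁻¹ * (8 * M * s x ^ 2) := fun x => by
    simp only [hu]
    rw [norm_mul, norm_mul, hκn]
    have := mul_le_mul (hF.norm_le x) (hjn x) (norm_nonneg _)
      (by have := (h.weight.pos x).le; positivity)
    refine mul_le_mul_of_nonneg_left ?_ (by positivity)
    linarith
  have hκi : κ⁻¹ ≤ 1 := inv_le_one_of_one_le₀ hκ1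
  have huM : ∀ x, ‖u x‖ ≤ 8 * M := fun x => by
    refine (hub x).trans ?_
    have h1 := pow_le_one₀ (n := 2) (h.weight.pos x).le (h.weight.le_one x)
    have h2 : 0 ≤ s x ^ 2 := by positivity
    calc κ⁻¹ * (8 * M * s x ^ 2) ≤ 1 * (8 * M * 1) := by gcongr
      _ = _ := by ring
  have hdef : ∀ x, F x - fullRate μ α κ s c r x * u x + u' x =
      -(r x * (F x * j x)) + (κ : ℂ)⁻¹ * (-(α * s x * (F x * j x)) + dF x * j x + F x * dj x) := by
    intro x
    have hne := h.smooth_ne_zero x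
    have hκne : (κ : ℂ) ≠ 0 := by exact_mod_cast hκ0.ne'
    have hbj : smoothRate μ s c x * j x = 1 := mul_inv_cancel₀ hne
    have hkk : (κ : ℂ) * (κ : ℂ)⁻¹ = 1 := mul_inv_cancel₀ hκne
    simp only [hu, hu', fullRate]
    linear_combination (-F x * (κ * (κ : ℂ)⁻¹)) * hbj +
      (-F x - r x * F x * j x) * hkk
  have hdefb : ∀ x, ‖F x - fullRate μ α κ s c r x * u x + u' x‖ ≤
      (M * (16 + 8 * |α| + 64 * (μ + 3))) * s x ^ (2 + 1) := by
    intro x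
    have h0 := (h.weight.pos x).le
    have h1 := h.weight.le_one x
    rw [hdef]
    have e0 : ‖F x * j x‖ ≤ 8 * M * s x ^ 2 := by
      rw [norm_mul]
      have := mul_le_mul (hF.norm_le x) (hjn x) (norm_nonneg _) (by positivity)
      linarith
    have e1 : ‖r x * (F x * j x)‖ ≤ 8 * M * s x ^ 3 := by
      rw [norm_mul]
      calc _ ≤ s x ^ 2 * (8 * M * s x ^ 2) :=
            mul_le_mul (h.norm_rough_le x) e0 (norm_nonneg _) (by positivity)
        _ = 8 * M * (s x ^ 3 * s x) := by ring
        _ ≤ 8 * M * (s x ^ 3 * 1) := by gcongr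
        _ = _ := by ring
    have e2 : ‖(α : ℂ) * s x * (F x * j x)‖ ≤ 8 * |α| * M * s x ^ 3 := by
      rw [norm_mul, norm_mul, Complex.norm_real, Complex.norm_real, Real.norm_eq_abs,
        Real.norm_eq_abs, abs_of_nonneg h0]
      calc _ ≤ |α| * s x * (8 * M * s x ^ 2) := by gcongr
        _ = _ := by ring
    have e3 : ‖dF x * j x‖ ≤ 8 * M * s x ^ 3 := by
      have hd : ‖dF x‖ ≤ M * s x ^ 3 := hF.norm_deriv_le x
      rw [norm_mul]
      have := mul_le_mul hd (hjn x) (norm_nonneg _) (by positivity)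
      linarith
    have e4 : ‖F x * dj x‖ ≤ 64 * (μ + 3) * M * s x ^ 3 := by
      rw [norm_mul]
      calc _ ≤ (M * s x ^ 2) * (64 * (μ + 3) * s x) :=
            mul_le_mul (hF.norm_le x) (hdjn x) (norm_nonneg _) (by positivity)
        _ = _ := by ring
    have e5 : ‖-((α : ℂ) * s x * (F x * j x)) + dF x * j x + F x * dj x‖ ≤
        8 * |α| * M * s x ^ 3 + 8 * M * s x ^ 3 + 64 * (μ + 3) * M * s x ^ 3 := by
      refine (norm_add_le _ _).trans (add_le_add ((norm_add_le _ _).trans (add_le_add ?_ e3)) e4)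
      rwa [norm_neg]
    have e6 : ‖(κ : ℂ)⁻¹ * (-((α : ℂ) * s x * (F x * j x)) + dF x * j x + F x * dj x)‖ ≤
        1 * (8 * |α| * M * s x ^ 3 + 8 * M * s x ^ 3 + 64 * (μ + 3) * M * s x ^ 3) := by
      rw [norm_mul, hκn]
      exact mul_le_mul hκi e5 (norm_nonneg _) zero_le_one
    refine (norm_add_le _ _).trans ?_
    rw [norm_neg]
    exact (add_le_add e1 e6).trans_eq (by ring)
  have hw := h.weight
  have hdjc : Continuous dj := by
    have h1 := h.continuous_smooth
    have h2 := h.continuous_deriv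
    have h3 := h.slow_coeff.continuous
    have h4 := hw.continuous
    have h5 : Continuous (derivSmooth μ χ s c dc) := by unfold derivSmooth; fun_prop
    exact (h5.neg).div (h1.pow 2) fun x => pow_ne_zero _ (h.smooth_ne_zero x)
  have hjc : Continuous j := h.slow_inv_smooth.continuous
  have hFc := hF.continuous
  have hcont : Continuous fun x => F x - fullRate μ α κ s c r x * u x + u' x := by
    have := h.continuous_fullRate (α := α) (κ := κ)
    simp only [hu, hu']
    fun_prop
  have hk1 : 2 * ((1 : ℕ) : ℝ) < κ * μ / 4 := by have := hκ.lt_mul; push_cast; linarith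
  rw [DecayRate.fwdInt_eq_add hw hP hk0 hud huM
    (DecayRate.integrableOn hw hP (b := 1) hk1 hFc hF.norm_le x)
    (DecayRate.integrableOn hw hP hk hcont hdefb x)]
  refine (norm_add_le _ _).trans ((add_le_add (hub x)
    (DecayRate.norm_fwdInt_le hw hP hk hdefb x)).trans_eq ?_)
  unfold slowConst
  field_simp
  ring

end SpiralData


namespace SpiralData

variable {μ χ α κ : ℝ} {s ℓ : ℝ → ℝ} {c dc r Φ : ℝ → ℂ}

/-- The relative Hölder constant of a quotient by the rate. -/
noncomputable def quotConst (μ : ℝ) : ℝ := 16 + 256 * (3 * μ + 19)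

/-- The constant in the bound for Hölder continuous forcing. -/
noncomputable def roughConst (μ : ℝ) : ℝ := quotConst μ * (1 + (μ + 6) * (8 / μ))

/-- The natural approximation q = F/P is only Hölder continuous, so it is replaced by its average
`u` over a window of length τ. Then P(q - u) and u' are O(κ √τ) and O(τ^{-1/2}) relative to the size
of q. The choice τ = 1/κ balances them and yields the factor κ^{-3/2}. -/
theorem norm_fwdInt_rough_sub_le (h : SpiralData μ χ s ℓ c dc r) (hκ : LargeFreq μ α κ)
    (hΦ : ∀ x, HasDerivAt Φ (fullRate μ α κ s c r x) x) {M : ℝ} {F : ℝ → ℂ}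
    (hF : ∀ x, ‖F x‖ ≤ M * s x ^ 3)
    (hF' : ∀ x y, |x - y| ≤ 1 → ‖F x - F y‖ ≤ M * s x ^ 3 * √|x - y|) (x : ℝ) :
    ‖fwdInt F Φ x - F x / fullRate μ α κ s c r x‖ ≤
      roughConst μ * M * s x ^ 2 / (κ * √κ) := by
  have hP := h.decayRate hκ hΦ
  have hκ1 := hκ.one_le
  have hκ0 : 0 < κ := by linarith
  have hμ := h.pos
  have hw := h.weight
  have hk : 2 * ((2 : ℕ) : ℝ) < κ * μ / 4 := by have := hκ.lt_mul; push_cast; linarith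
  have hk0 : 0 < κ * μ / 4 := by positivity
  have hM : 0 ≤ M := nonneg_of_mul_nonneg_left ((norm_nonneg _).trans (hF 0))
    (pow_pos (h.weight.pos 0) _)
  have hN : 0 < quotConst μ := by unfold quotConst; positivity
  set P := fullRate μ α κ s c r with hPdef
  have hPc : Continuous P := h.continuous_fullRate
  have hFc : Continuous F := continuous_of_norm_sub_le_sqrt hF'
  have hPne : ∀ x, P x ≠ 0 := h.fullRate_ne_zero hκ
  have hPl : ∀ x, κ / 16 ≤ ‖P x‖ := h.le_norm_fullRate hκ
  have hPi : ∀ x, ‖P x‖⁻¹ ≤ 16 / κ := fun x => by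
    rw [← inv_div]
    exact inv_anti₀ (by positivity) (hPl x)
  have hPu : ∀ x, ‖P x‖ ≤ κ * (μ + 5) := h.norm_fullRate_le hκ
  set q : ℝ → ℂ := fun x => F x / P x with hq
  have hqc : Continuous q := hFc.div hPc hPne
  have hqn : ∀ x, ‖q x‖ ≤ 16 * M * s x ^ 3 / κ := fun x => by
    simp only [hq]
    rw [norm_div, div_eq_mul_inv]
    have h0 := (hw.pos x).le
    calc _ ≤ (M * s x ^ 3) * (16 / κ) :=
          mul_le_mul (hF x) (hPi x) (by positivity) (by positivity)
      _ = _ := by ring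
  have hqd : ∀ x y, |x - y| ≤ 1 → ‖q x - q y‖ ≤
      quotConst μ * M * s x ^ 3 / κ * √|x - y| := by
    intro x y hxy
    have h0 := (hw.pos x).le
    have e : q x - q y = (F x - F y) * (P y)⁻¹ + F x * (P x)⁻¹ * (P y - P x) * (P y)⁻¹ := by
      simp only [hq]
      field_simp [hPne x, hPne y]
      ring
    have e1 : ‖(F x - F y) * (P y)⁻¹‖ ≤ (M * s x ^ 3 * √|x - y|) * (16 / κ) := by
      rw [norm_mul, norm_inv]
      exact mul_le_mul (hF' x y hxy) (hPi y) (by positivity) (by positivity)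
    have e2 : ‖F x * (P x)⁻¹ * (P y - P x) * (P y)⁻¹‖ ≤
        (M * s x ^ 3) * (16 / κ) * (κ * (3 * μ + 19) * √|x - y|) * (16 / κ) := by
      rw [norm_mul, norm_mul, norm_mul, norm_inv, norm_inv, norm_sub_rev (P y)]
      refine mul_le_mul (mul_le_mul (mul_le_mul (hF x) (hPi x) (by positivity) (by positivity))
        (h.norm_fullRate_sub_le hκ hxy) (norm_nonneg _) (by positivity)) (hPi y) (by positivity)
        (by positivity)
    rw [e]
    refine (norm_add_le _ _).trans ((add_le_add e1 e2).trans_eq ?_)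
    unfold quotConst
    field_simp
    ring
  set τ : ℝ := κ⁻¹ with hτ
  have hτ0 : 0 < τ := by positivity
  have hτ1 : τ ≤ 1 := inv_le_one_of_one_le₀ hκ1
  have hsτ : √τ = (√κ)⁻¹ := Real.sqrt_inv κ
  set u : ℝ → ℂ := fun x => (κ : ℂ) * ∫ y in x..(x + τ), q y with hu
  set u' : ℝ → ℂ := fun x => (κ : ℂ) * (q (x + τ) - q x) with hu'
  have hud : ∀ x, HasDerivAt u (u' x) x := by
    intro x
    have hI : ∀ z, HasDerivAt (fun z => ∫ y in (0:ℝ)..z, q y) (q z) z := fun z =>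
      intervalIntegral.integral_hasDerivAt_right (hqc.intervalIntegrable _ _)
        hqc.aestronglyMeasurable.stronglyMeasurableAtFilter hqc.continuousAt
    have h1 : HasDerivAt (fun z => ∫ y in (0:ℝ)..(z + τ), q y) (q (x + τ)) x :=
      (hI (x + τ)).comp_add_const x τ
    have h2 := ((h1.sub (hI x)).const_mul (κ : ℂ))
    refine h2.congr_of_eventuallyEq (Eventually.of_forall fun z => ?_)
    simp only [hu, Pi.sub_apply]
    rw [intervalIntegral.integral_interval_sub_left (hqc.intervalIntegrable _ _)
      (hqc.intervalIntegrable _ _)]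
  have hclose : ∀ x, ‖q x - u x‖ ≤ quotConst μ * M * s x ^ 3 / κ * √τ := by
    intro x
    have h0 := (hw.pos x).le
    have hκne : (κ : ℂ) ≠ 0 := by exact_mod_cast hκ0.ne'
    have e : q x - u x = (κ : ℂ) * ∫ y in x..(x + τ), (q x - q y) := by
      rw [intervalIntegral.integral_sub (intervalIntegrable_const)
        (hqc.intervalIntegrable _ _), intervalIntegral.integral_const]
      simp only [hu, hτ, add_sub_cancel_left, Complex.real_smul, Complex.ofReal_inv]
      rw [mul_sub, ← mul_assoc, mul_inv_cancel₀ hκne, one_mul]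
    rw [e, norm_mul, Complex.norm_real, Real.norm_eq_abs, abs_of_pos hκ0]
    have h1 := intervalIntegral.norm_integral_le_of_norm_le_const (a := x) (b := x + τ)
      (f := fun y => q x - q y) (C := quotConst μ * M * s x ^ 3 / κ * √τ) (fun y hy => by
        rw [uIoc_of_le (by linarith)] at hy
        have h2 : |x - y| ≤ τ := by
          rw [abs_sub_comm, abs_of_pos (by linarith [hy.1])]; linarith [hy.2]
        refine (hqd x y (h2.trans hτ1)).trans ?_
        gcongr)
    rw [add_sub_cancel_left, abs_of_pos hτ0] at h1
    calc _ ≤ κ * (quotConst μ * M * s x ^ 3 / κ * √τ * τ) := by gcongr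
      _ = quotConst μ * M * s x ^ 3 / κ * √τ * (κ * τ) := by ring
      _ = _ := by rw [hτ, mul_inv_cancel₀ hκ0.ne', mul_one]
  have huM : ∀ x, ‖u x‖ ≤ 16 * M + quotConst μ * M := by
    intro x
    have h0 := (hw.pos x).le
    have h1 : s x ^ 3 ≤ 1 := pow_le_one₀ h0 (hw.le_one x)
    have e1 : ‖q x‖ ≤ 16 * M := (hqn x).trans (by
      rw [div_le_iff₀ hκ0]
      calc 16 * M * s x ^ 3 ≤ 16 * M * 1 := by gcongr
        _ ≤ 16 * M * κ := by gcongr)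
    have e2 : ‖q x - u x‖ ≤ quotConst μ * M := (hclose x).trans (by
      rw [div_mul_eq_mul_div, div_le_iff₀ hκ0]
      have : √τ ≤ 1 := Real.sqrt_le_one.2 hτ1
      calc quotConst μ * M * s x ^ 3 * √τ ≤ quotConst μ * M * 1 * 1 := by gcongr
        _ ≤ quotConst μ * M * κ := by nlinarith [mul_nonneg hN.le hM])
    calc ‖u x‖ = ‖q x - (q x - u x)‖ := by rw [sub_sub_cancel]
      _ ≤ ‖q x‖ + ‖q x - u x‖ := norm_sub_le _ _
      _ ≤ _ := add_le_add e1 e2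
  have hdefb : ∀ x, ‖F x - P x * u x + u' x‖ ≤
      (quotConst μ * M * (μ + 6) * √τ) * s x ^ (2 + 1) := by
    intro x
    have h0 := (hw.pos x).le
    have e : F x - P x * u x + u' x = P x * (q x - u x) + (κ : ℂ) * (q (x + τ) - q x) := by
      have : P x * q x = F x := mul_div_cancel₀ _ (hPne x)
      simp only [hu']
      linear_combination -this
    have e1 : ‖P x * (q x - u x)‖ ≤ κ * (μ + 5) * (quotConst μ * M * s x ^ 3 / κ * √τ) := by
      rw [norm_mul]
      exact mul_le_mul (hPu x) (hclose x) (norm_nonneg _) (by positivity)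
    have e2 : ‖(κ : ℂ) * (q (x + τ) - q x)‖ ≤ κ * (quotConst μ * M * s x ^ 3 / κ * √τ) := by
      rw [norm_mul, Complex.norm_real, Real.norm_eq_abs, abs_of_pos hκ0, norm_sub_rev]
      have hx : |x - (x + τ)| = τ := by
        rw [sub_add_cancel_left, abs_neg, abs_of_pos hτ0]
      have := hqd x (x + τ) (by rw [hx]; exact hτ1)
      rw [hx] at this
      gcongr
    rw [e]
    refine (norm_add_le _ _).trans ((add_le_add e1 e2).trans_eq ?_)
    field_simp
    ring
  have huc : Continuous u := continuous_iff_continuousAt.2 fun x => (hud x).continuousAt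
  have hcont : Continuous fun x => F x - P x * u x + u' x := by
    simp only [hu']
    fun_prop
  rw [DecayRate.fwdInt_eq_add hw hP hk0 hud huM
    (DecayRate.integrableOn hw hP (b := 2) hk hFc hF x)
    (DecayRate.integrableOn hw hP hk hcont hdefb x)]
  have h0 := (hw.pos x).le
  have e1 : ‖u x - q x‖ ≤ quotConst μ * M * s x ^ 2 / κ * √τ := by
    rw [norm_sub_rev]
    refine (hclose x).trans ?_
    have : s x ^ 3 ≤ s x ^ 2 := pow_le_pow_of_le_one h0 (hw.le_one x) (by norm_num)
    gcongr
  have e2 := DecayRate.norm_fwdInt_le hw hP hk hdefb x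
  rw [add_sub_right_comm]
  refine (norm_add_le _ _).trans ((add_le_add e1 e2).trans_eq ?_)
  rw [hsτ]
  have : 0 < √κ := Real.sqrt_pos.2 hκ0
  unfold roughConst
  field_simp
  ring

end SpiralData


namespace SlowOrder

variable {s : ℝ → ℝ} {b : ℕ} {M M' : ℝ} {f df : ℝ → ℂ}

theorem mono (hs : ∀ x, 0 < s x) (hf : SlowOrder s b M f df) (h : M ≤ M') :
    SlowOrder s b M' f df := by
  refine ⟨hf.hasDerivAt, fun x => (hf.norm_le x).trans ?_, fun x =>
    (hf.norm_deriv_le x).trans ?_⟩ <;>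
  · have := (hs x).le
    gcongr

theorem of_succ (hs : ∀ x, 0 < s x) (hs1 : ∀ x, s x ≤ 1) (hf : SlowOrder s (b + 1) M f df) :
    SlowOrder s b M f df := by
  have hM : 0 ≤ M := nonneg_of_mul_nonneg_left ((norm_nonneg _).trans (hf.norm_le 0))
    (pow_pos (hs 0) _)
  refine ⟨hf.hasDerivAt, fun x => (hf.norm_le x).trans ?_, fun x =>
    (hf.norm_deriv_le x).trans ?_⟩ <;>
  · refine mul_le_mul_of_nonneg_left ?_ hM
    exact pow_le_pow_of_le_one (hs x).le (hs1 x) (by omega)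

end SlowOrder

namespace SpiralData

variable {μ χ α κ : ℝ} {s ℓ : ℝ → ℝ} {c dc r Φ : ℝ → ℂ}

/-- The slowly varying part of the defect of the leading order solution. -/
theorem exists_slow_defect (μ α : ℝ) : ∃ M : ℝ, 0 ≤ M ∧
    ∀ (χ : ℝ) (s ℓ : ℝ → ℝ) (c dc r : ℝ → ℂ), SpiralData μ χ s ℓ c dc r → ∃ F dF : ℝ → ℂ,
      SlowOrder s 2 M F dF ∧ Continuous dF ∧ ∀ x, F x =
        -α * s x ^ 2 * (smoothRate μ s c x)⁻¹ + χ * s x ^ 2 * (1 - s x) * (smoothRate μ s c x)⁻¹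
        - s x * (χ * s x ^ 2 * (1 - s x)) * (μ + Complex.I * c x) * (smoothRate μ s c x)⁻¹ ^ 2 := by
  by_cases hμ : 0 < μ
  swap
  · exact ⟨0, le_rfl, fun χ s ℓ c dc r h => absurd h.pos hμ⟩
  -- The constant is the one that the product and sum rules for `SlowOrder` assemble in `hA.add hB`
  -- below.
  refine ⟨2 * (2 * (1 * 1) * (2 * ((|α| + 2 * (1 * 1)) * (64 * (μ + 3))))) +
      2 * (2 * (2 * (1 * 1) * 1) * (2 * (2 * (1 * (2 * (1 * (2 * (1 * (|μ| + 2 * (1 * 2))))))) *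
        (2 * (64 * (μ + 3) * (64 * (μ + 3))))))), by positivity, fun χ s ℓ c dc r h => ?_⟩
  · have hp := h.weight.pos
    have h1 := h.weight.le_one
    have hχ : SlowOrder s 0 1 (fun _ => (χ : ℂ)) (fun _ => 0) :=
      (h.slow_const χ).mono hp (by simpa using h.abs_sign_le)
    have hα : SlowOrder s 0 |α| (fun _ => (-α : ℂ)) (fun _ => 0) :=
      (h.slow_const (-α)).mono hp (by simp)
    have hI : SlowOrder s 0 1 (fun _ => Complex.I) (fun _ => 0) :=
      (h.slow_const Complex.I).mono hp (by simp)
    have hn1 : SlowOrder s 0 1 (fun _ => (-1 : ℂ)) (fun _ => 0) :=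
      (h.slow_const (-1)).mono hp (by simp)
    have hm : SlowOrder s 0 |μ| (fun _ => (μ : ℂ)) (fun _ => 0) :=
      (h.slow_const μ).mono hp (by simp)
    have hs2 := h.slow_weight.mul hp h.slow_weight
    have hA := hs2.mul hp ((hα.add (hχ.mul hp h.slow_one_sub)).mul hp h.slow_inv_smooth)
    -- This term has order 3; `of_succ` gives up one power of `s` so that it can be added to `hA`.
    have hB := (((hs2.mul hp h.slow_weight).mul hp
      ((hn1.mul hp (hχ.mul hp (h.slow_one_sub.mul hp (hm.add (hI.mul hp h.slow_coeff))))).mul hp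
        (h.slow_inv_smooth.mul hp h.slow_inv_smooth)))).of_succ hp h1
    refine ⟨_, _, hA.add hB, ?_, fun x => ?_⟩
    · have c1 := h.weight.continuous
      have c2 := h.slow_coeff.continuous
      have c3 := h.continuous_deriv
      have c4 := h.slow_inv_smooth.continuous
      have c5 : Continuous (derivInvSmooth μ χ s c dc) := by
        have h5 : Continuous (derivSmooth μ χ s c dc) := by unfold derivSmooth; fun_prop
        exact (h5.neg).div (h.continuous_smooth.pow 2) fun x =>
          pow_ne_zero _ (h.smooth_ne_zero x)
      fun_prop
    · ring

/-- The key estimate: the solution with forcing `s` is `s / P` up to `O(s² κ^{-3/2})`. -/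
theorem exists_norm_fwdInt_sub_le (μ α : ℝ) : ∃ C : ℝ, 0 ≤ C ∧
    ∀ (χ κ : ℝ) (s ℓ : ℝ → ℝ) (c dc r Φ : ℝ → ℂ), SpiralData μ χ s ℓ c dc r →
      LargeFreq μ α κ → (∀ x, HasDerivAt Φ (fullRate μ α κ s c r x) x) → ∀ x,
        ‖fwdInt (fun x => (s x : ℂ)) Φ x - s x / fullRate μ α κ s c r x‖ ≤
          C * s x ^ 2 / (κ * √κ) := by
  by_cases hμ : 0 < μ
  swap
  · exact ⟨0, le_rfl, fun χ κ s ℓ c dc r Φ h => absurd h.pos hμ⟩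
  obtain ⟨M₁, hM₁, hslow⟩ := exists_slow_defect μ α
  -- The number 24 is 3 · 8: the weight comparison at unit distance times the bound on the inverse
  -- smooth rate. The second summand bounds the variation of `s * j`.
  set M₃ : ℝ := 24 + 2 * (1 * (64 * (μ + 3))) * 3 ^ 2 with hM₃
  refine ⟨128 * |α| + roughConst μ * M₃ + slowConst μ α * M₁ + 512 / μ, ?_,
    fun χ κ s ℓ c dc r Φ h hκ hΦ x => ?_⟩
  · have : 0 ≤ roughConst μ := by unfold roughConst quotConst; positivity
    have : 0 ≤ slowConst μ α := by unfold slowConst; positivity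
    positivity
  obtain ⟨F₁, dF₁, hF₁, hdF₁, hF₁eq⟩ := hslow χ s ℓ c dc r h
  have hP := h.decayRate hκ hΦ
  have hκ1 := hκ.one_le
  have hκ0 : 0 < κ := by linarith
  have hw := h.weight
  have hp := hw.pos
  have hk : 2 * ((2 : ℕ) : ℝ) < κ * μ / 4 := by have := hκ.lt_mul; push_cast; linarith
  have hk1 : 2 * ((1 : ℕ) : ℝ) < κ * μ / 4 := by have := hκ.lt_mul; push_cast; linarith
  have hk00 : 2 * ((0 : ℕ) : ℝ) < κ * μ / 4 := by have := hκ.lt_mul; push_cast; linarith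
  have hk0 : 0 < κ * μ / 4 := by positivity
  have hκne : (κ : ℂ) ≠ 0 := by exact_mod_cast hκ0.ne'
  have hκn : ‖(κ : ℂ)⁻¹‖ = κ⁻¹ := by
    rw [norm_inv, Complex.norm_real, Real.norm_eq_abs, abs_of_pos hκ0]
  set j : ℝ → ℂ := fun x => (smoothRate μ s c x)⁻¹ with hj
  set dj := derivInvSmooth μ χ s c dc with hdj
  have hjn : ∀ x, ‖j x‖ ≤ 8 := fun x => by
    simp only [hj]
    rw [norm_inv]
    exact inv_le_of_inv_le₀ (by norm_num) (by simpa using h.le_norm_smooth x)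
  have hsn : ∀ x, ‖(s x : ℂ)‖ = s x := fun x => by
    rw [Complex.norm_real, Real.norm_eq_abs, abs_of_pos (hp x)]
  have hsj := h.slow_weight.mul hp h.slow_inv_smooth
  -- The defect of `u = s * j / κ` splits by regularity: `F₃` carries the Hölder function `r`; `F₂`
  -- carries `dc`, which is only continuous but makes the term O(s³); the slowly differentiable
  -- remainder is `F₁`.
  set F₃ : ℝ → ℂ := fun x => -(r x * (s x * j x)) with hF₃
  set F₂ : ℝ → ℂ := fun x => Complex.I * s x * (1 - s x) * dc x * j x ^ 2 with hF₂
  have hF₃n : ∀ x, ‖F₃ x‖ ≤ M₃ * s x ^ 3 := fun x => by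
    have h0 := (hp x).le
    simp only [hF₃]
    rw [norm_neg, norm_mul, norm_mul, hsn]
    calc _ ≤ s x ^ 2 * (s x * 8) := by
          have := h.norm_rough_le x
          have := hjn x
          gcongr
      _ = 8 * s x ^ 3 := by ring
      _ ≤ _ := by
        refine mul_le_mul_of_nonneg_right ?_ (by positivity)
        rw [hM₃]
        nlinarith
  have hF₃d : ∀ x y, |x - y| ≤ 1 → ‖F₃ x - F₃ y‖ ≤ M₃ * s x ^ 3 * √|x - y| := by
    intro x y hxy
    have h0 := (hp x).le
    have e : F₃ x - F₃ y = -(r x * (s x * j x - s y * j y) + (r x - r y) * (s y * j y)) := by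
      simp only [hF₃]; ring
    have hsq : |x - y| ≤ √|x - y| := by simpa using mul_le_mul_sqrt (abs_nonneg _) hxy zero_le_one
    have e1 : ‖r x * (s x * j x - s y * j y)‖ ≤
        s x ^ 2 * (2 * (1 * (64 * (μ + 3))) * 3 ^ 2 * s x * √|x - y|) := by
      rw [norm_mul]
      refine mul_le_mul (h.norm_rough_le x) ((hsj.norm_sub_le hw hxy).trans ?_) (norm_nonneg _)
        (by positivity)
      have h2 : s x ^ (1 + 0 + 1) ≤ s x := by
        calc s x ^ (1 + 0 + 1) = s x * s x := by ring
          _ ≤ s x * 1 := mul_le_mul_of_nonneg_left (hw.le_one x) h0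
          _ = s x := mul_one _
      calc _ ≤ 2 * (1 * (64 * (μ + 3))) * 3 ^ (1 + 0 + 1) * s x * √|x - y| := by gcongr
        _ = _ := by ring
    have e2 : ‖(r x - r y) * (s y * j y)‖ ≤ (s x ^ 2 * √|x - y|) * (3 * s x * 8) := by
      rw [norm_mul, norm_mul, hsn]
      refine mul_le_mul (h.norm_rough_sub_le x y hxy)
        (mul_le_mul (hw.le_three_mul hxy) (hjn y) (norm_nonneg _) (by positivity))
        (mul_nonneg (hp y).le (norm_nonneg _)) (by positivity)
    rw [e, norm_neg]
    refine (norm_add_le _ _).trans ((add_le_add e1 e2).trans_eq ?_)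
    rw [hM₃]
    ring
  have hF₂n : ∀ x, ‖F₂ x‖ ≤ 64 * s x ^ (2 + 1) := fun x => by
    have h0 := (hp x).le
    simp only [hF₂]
    rw [norm_mul, norm_mul, norm_mul, norm_mul, norm_pow, hsn, Complex.norm_I, one_mul]
    have h1 : ‖(1 : ℂ) - s x‖ ≤ 1 := by simpa using h.slow_one_sub.norm_le x
    have h2 : ‖j x‖ ^ 2 ≤ 64 := by
      calc _ ≤ (8 : ℝ) ^ 2 := pow_le_pow_left₀ (norm_nonneg _) (hjn x) 2
        _ = 64 := by norm_num
    calc _ ≤ s x * 1 * s x ^ 2 * 64 := by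
          have := h.norm_deriv_le x
          gcongr
      _ = _ := by ring
  set u : ℝ → ℂ := fun x => (κ : ℂ)⁻¹ * (s x * j x) with hu
  set u' : ℝ → ℂ := fun x =>
    (κ : ℂ)⁻¹ * (((χ * s x ^ 2 * (1 - s x) : ℝ) : ℂ) * j x + s x * dj x) with hu'
  have hud : ∀ x, HasDerivAt u (u' x) x := fun x => (hsj.hasDerivAt x).const_mul _
  have hκi : κ⁻¹ ≤ 1 := inv_le_one_of_one_le₀ hκ1
  have huM : ∀ x, ‖u x‖ ≤ 8 := fun x => by
    simp only [hu]
    rw [norm_mul, norm_mul, hκn, hsn]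
    have h1 := mul_le_mul (hw.le_one x) (hjn x) (norm_nonneg _) zero_le_one
    have h2 := mul_le_mul hκi h1 (mul_nonneg (hp x).le (norm_nonneg _)) zero_le_one
    linarith
  have hdef : ∀ x, s x - fullRate μ α κ s c r x * u x + u' x =
      F₃ x + (κ : ℂ)⁻¹ * (F₁ x + F₂ x) := by
    intro x
    have hbj : smoothRate μ s c x * j x = 1 := mul_inv_cancel₀ (h.smooth_ne_zero x)
    have hkk : (κ : ℂ) * (κ : ℂ)⁻¹ = 1 := mul_inv_cancel₀ hκne
    have hdjx : dj x = -derivSmooth μ χ s c dc x * j x ^ 2 := by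
      simp only [hdj, hj, derivInvSmooth, div_eq_mul_inv, inv_pow]
    simp only [hu, hu', hF₃, hF₂, hF₁eq, fullRate, hdjx, derivSmooth]
    push_cast
    linear_combination (-(s x : ℂ) * (κ * (κ : ℂ)⁻¹)) * hbj +
      (-(s x : ℂ) - r x * s x * j x) * hkk
  have cs := hw.continuous
  have cj : Continuous j := h.slow_inv_smooth.continuous
  have cr := h.continuous_rough
  have cdc := h.continuous_deriv
  have cF₁ := hF₁.continuous
  have cF₂ : Continuous F₂ := by simp only [hF₂]; fun_prop
  have cF₃ : Continuous F₃ := by simp only [hF₃]; fun_prop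
  have I₁ : IntegrableOn (fun y => F₁ y * Complex.exp (Φ x - Φ y)) (Ioi x) :=
    DecayRate.integrableOn hw hP (b := 1) hk1 cF₁ hF₁.norm_le x
  have I₂ : IntegrableOn (fun y => F₂ y * Complex.exp (Φ x - Φ y)) (Ioi x) :=
    DecayRate.integrableOn hw hP (b := 2) hk cF₂ hF₂n x
  have I₃ : IntegrableOn (fun y => F₃ y * Complex.exp (Φ x - Φ y)) (Ioi x) :=
    DecayRate.integrableOn hw hP (b := 2) hk cF₃ hF₃n x
  have I₀ : IntegrableOn (fun y => (s y : ℂ) * Complex.exp (Φ x - Φ y)) (Ioi x) :=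
    DecayRate.integrableOn hw hP (b := 0) (M := 1) hk00 (by fun_prop)
      (fun y => by rw [hsn]; simp) x
  have I₁₂ : IntegrableOn (fun y => (F₁ y + F₂ y) * Complex.exp (Φ x - Φ y)) (Ioi x) := by
    simp only [add_mul]
    exact Integrable.add I₁ I₂
  have I₄ : IntegrableOn
      (fun y => ((κ : ℂ)⁻¹ * (F₁ y + F₂ y)) * Complex.exp (Φ x - Φ y)) (Ioi x) := by
    simp only [mul_assoc]
    exact Integrable.const_mul I₁₂ ((κ : ℂ)⁻¹)
  have hsplit : fwdInt (fun x => (s x : ℂ)) Φ x =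
      u x + (fwdInt F₃ Φ x + (κ : ℂ)⁻¹ * (fwdInt F₁ Φ x + fwdInt F₂ Φ x)) := by
    rw [DecayRate.fwdInt_eq_add hw hP hk0 hud huM I₀]
    · simp only [hdef]
      rw [fwdInt_add I₃ I₄, fwdInt_const_mul, fwdInt_add I₁ I₂]
    · simp only [hdef]
      refine (Integrable.add I₃ I₄).congr (ae_of_all _ fun y => ?_)
      simp only [Pi.add_apply]
      ring
  have B₃ := h.norm_fwdInt_rough_sub_le hκ hΦ hF₃n hF₃d x
  have B₁ := h.norm_fwdInt_slow_le hκ hΦ hF₁ hdF₁ x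
  have B₂ := DecayRate.norm_fwdInt_le hw hP hk hF₂n x
  have hPne := h.fullRate_ne_zero hκ x
  -- The first-order response `F₃ / P` to the rough forcing turns the smooth rate in `u` into the
  -- full one. What is left is of second order in 1/κ.
  have hlead : u x + F₃ x / fullRate μ α κ s c r x - s x / fullRate μ α κ s c r x =
      (κ : ℂ)⁻¹ * (α * s x ^ 2 * j x) * (fullRate μ α κ s c r x)⁻¹ := by
    have hbj : smoothRate μ s c x * j x = 1 := mul_inv_cancel₀ (h.smooth_ne_zero x)
    have hkk : (κ : ℂ) * (κ : ℂ)⁻¹ = 1 := mul_inv_cancel₀ hκne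
    have hPP : fullRate μ α κ s c r x * (fullRate μ α κ s c r x)⁻¹ = 1 := mul_inv_cancel₀ hPne
    have hexp : fullRate μ α κ s c r x = κ * (smoothRate μ s c x + r x) + α * s x := rfl
    simp only [hu, hF₃, div_eq_mul_inv]
    generalize (fullRate μ α κ s c r x)⁻¹ = Pi at *
    generalize fullRate μ α κ s c r x = P at *
    subst hexp
    linear_combination ((κ : ℂ)⁻¹ * (s x * j x)) * (-hPP) +
      (s x * Pi * (κ * (κ : ℂ)⁻¹)) * hbj + (s x * Pi + r x * s x * j x * Pi) * hkk
  have h0 := (hp x).le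
  have hPi : ‖(fullRate μ α κ s c r x)⁻¹‖ ≤ 16 / κ := by
    rw [norm_inv, ← inv_div]
    exact inv_anti₀ (by positivity) (h.le_norm_fullRate hκ x)
  have Bl : ‖(κ : ℂ)⁻¹ * (α * s x ^ 2 * j x) * (fullRate μ α κ s c r x)⁻¹‖ ≤
      128 * |α| * s x ^ 2 / (κ * κ) := by
    rw [norm_mul, norm_mul, norm_mul, norm_mul, norm_pow, hsn, hκn, Complex.norm_real,
      Real.norm_eq_abs]
    calc _ ≤ κ⁻¹ * (|α| * s x ^ 2 * 8) * (16 / κ) := by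
          have := hjn x
          gcongr
      _ = _ := by field_simp; ring
  have heq : fwdInt (fun x => (s x : ℂ)) Φ x - s x / fullRate μ α κ s c r x =
      (κ : ℂ)⁻¹ * (α * s x ^ 2 * j x) * (fullRate μ α κ s c r x)⁻¹ +
      (fwdInt F₃ Φ x - F₃ x / fullRate μ α κ s c r x) +
      ((κ : ℂ)⁻¹ * fwdInt F₁ Φ x + (κ : ℂ)⁻¹ * fwdInt F₂ Φ x) := by
    rw [hsplit, ← hlead]; ring
  have hsqκ : √κ ≤ κ := by
    rw [Real.sqrt_le_left hκ0.le]; nlinarith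
  have hsq0 : 0 < √κ := Real.sqrt_pos.2 hκ0
  have hinv : 1 / (κ * κ) ≤ 1 / (κ * √κ) := by
    apply one_div_le_one_div_of_le (by positivity)
    gcongr
  have B₁' : ‖(κ : ℂ)⁻¹ * fwdInt F₁ Φ x‖ ≤ slowConst μ α * M₁ * s x ^ 2 * (1 / (κ * κ)) := by
    rw [norm_mul, hκn]
    calc _ ≤ κ⁻¹ * (slowConst μ α * M₁ * s x ^ 2 / κ) := by gcongr
      _ = _ := by field_simp
  have B₂' : ‖(κ : ℂ)⁻¹ * fwdInt F₂ Φ x‖ ≤ 512 / μ * s x ^ 2 * (1 / (κ * κ)) := by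
    rw [norm_mul, hκn]
    calc _ ≤ κ⁻¹ * (64 * (2 / (κ * μ / 4)) * s x ^ 2) := by gcongr
      _ = _ := by field_simp; ring
  have hsc : 0 ≤ slowConst μ α := by unfold slowConst; positivity
  rw [heq]
  refine (norm_add_le _ _).trans ((add_le_add ((norm_add_le _ _).trans (add_le_add Bl B₃))
    ((norm_add_le _ _).trans (add_le_add B₁' B₂'))).trans ?_)
  have k1 := mul_le_mul_of_nonneg_left hinv (by positivity : 0 ≤ 128 * |α| * s x ^ 2)
  have k2 := mul_le_mul_of_nonneg_left hinv (by positivity : 0 ≤ slowConst μ α * M₁ * s x ^ 2)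
  have k3 := mul_le_mul_of_nonneg_left hinv (by positivity : 0 ≤ 512 / μ * s x ^ 2)
  have k0 : 128 * |α| * s x ^ 2 / (κ * κ) = 128 * |α| * s x ^ 2 * (1 / (κ * κ)) := by ring
  have k4 : (128 * |α| + roughConst μ * M₃ + slowConst μ α * M₁ + 512 / μ) * s x ^ 2 / (κ * √κ) =
      128 * |α| * s x ^ 2 * (1 / (κ * √κ)) + roughConst μ * M₃ * s x ^ 2 / (κ * √κ) +
      (slowConst μ α * M₁ * s x ^ 2 * (1 / (κ * √κ)) + 512 / μ * s x ^ 2 * (1 / (κ * √κ))) := by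
    ring
  rw [k4, k0]
  linarith

end SpiralData


/-! ### The coordinate x = T + log T and the weight 1/(1+T). -/

theorem strictMono_add_exp : StrictMono fun y : ℝ => y + Real.exp y :=
  strictMono_id.add Real.exp_strictMono

theorem surjective_add_exp : Function.Surjective fun y : ℝ => y + Real.exp y := by
  refine (by fun_prop : Continuous fun y : ℝ => y + Real.exp y).surjective ?_ ?_
  · exact tendsto_atTop_mono (fun y => by have := Real.exp_pos y; simp only [id]; linarith) tendsto_id
  · exact Tendsto.atBot_add tendsto_id Real.tendsto_exp_atBot

/-- The order isomorphism `y ↦ y + exp y` of the line. -/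
noncomputable def addExpIso : ℝ ≃o ℝ :=
  strictMono_add_exp.orderIsoOfSurjective _ surjective_add_exp

/-- The logarithm of the solution `T` of `T + log T = x`. -/
noncomputable def spiralLog (x : ℝ) : ℝ := addExpIso.symm x

/-- The weight `1 / (1 + T)`, where `T + log T = x`. -/
noncomputable def spiralWeight (x : ℝ) : ℝ := (1 + Real.exp (spiralLog x))⁻¹

theorem spiralLog_add_exp (x : ℝ) : spiralLog x + Real.exp (spiralLog x) = x :=
  addExpIso.apply_symm_apply x

theorem spiralLog_of_add_exp (y : ℝ) : spiralLog (y + Real.exp y) = y :=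
  addExpIso.symm_apply_apply y

theorem continuous_spiralLog : Continuous spiralLog := addExpIso.symm.continuous

theorem strictMono_spiralLog : StrictMono spiralLog := addExpIso.symm.strictMono

theorem tendsto_spiralLog_atTop : Tendsto spiralLog atTop atTop := addExpIso.symm.tendsto_atTop

theorem tendsto_spiralLog_atBot : Tendsto spiralLog atBot atBot := addExpIso.symm.tendsto_atBot

theorem hasDerivAt_spiralLog (x : ℝ) : HasDerivAt spiralLog (spiralWeight x) x := by
  refine HasDerivAt.of_local_left_inverse (f := fun y : ℝ => y + Real.exp y)
    continuous_spiralLog.continuousAt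
    ((hasDerivAt_id _).add (Real.hasDerivAt_exp _)) ?_ (Eventually.of_forall spiralLog_add_exp)
  positivity

theorem spiralWeight_pos (x : ℝ) : 0 < spiralWeight x := by unfold spiralWeight; positivity

theorem spiralWeight_le_one (x : ℝ) : spiralWeight x ≤ 1 :=
  inv_le_one_of_one_le₀ (by have := Real.exp_pos (spiralLog x); linarith)

theorem one_sub_spiralWeight (x : ℝ) :
    1 - spiralWeight x = Real.exp (spiralLog x) * spiralWeight x := by
  unfold spiralWeight
  have := Real.exp_pos (spiralLog x)
  field_simp
  ring

theorem hasDerivAt_spiralWeight (x : ℝ) :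
    HasDerivAt spiralWeight (-1 * spiralWeight x ^ 2 * (1 - spiralWeight x)) x := by
  have h := (((hasDerivAt_spiralLog x).exp).const_add 1).inv
    (by have := Real.exp_pos (spiralLog x); positivity)
  refine h.congr_deriv ?_
  rw [one_sub_spiralWeight]
  unfold spiralWeight
  have := Real.exp_pos (spiralLog x)
  field_simp

theorem slowWeight_spiralWeight :
    SlowWeight spiralWeight (fun x => -1 * spiralWeight x ^ 2 * (1 - spiralWeight x))
      spiralLog := by
  refine ⟨spiralWeight_pos, spiralWeight_le_one, hasDerivAt_spiralWeight, fun x => ?_,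
    hasDerivAt_spiralLog, tendsto_spiralLog_atTop⟩
  have h0 := spiralWeight_pos x
  have h1 := spiralWeight_le_one x
  rw [abs_mul, abs_mul, abs_neg, abs_one, one_mul, abs_of_nonneg (sq_nonneg _),
    abs_of_nonneg (by linarith)]
  nlinarith [sq_nonneg (spiralWeight x)]

theorem continuous_spiralWeight : Continuous spiralWeight := slowWeight_spiralWeight.continuous

theorem tendsto_spiralWeight : Tendsto spiralWeight atTop (𝓝 0) := by
  refine tendsto_inv_atTop_zero.comp ?_
  exact tendsto_atTop_add_const_left _ _ (Real.tendsto_exp_atTop.comp tendsto_spiralLog_atTop)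

/-- A primitive is `-spiralWeight`, which vanishes at +∞. -/
theorem integrableOn_sq_mul_one_sub (x : ℝ) :
    IntegrableOn (fun y => spiralWeight y ^ 2 * (1 - spiralWeight y)) (Ioi x) ∧
      ∫ y in Ioi x, spiralWeight y ^ 2 * (1 - spiralWeight y) = spiralWeight x := by
  have hd : ∀ y ∈ Ici x, HasDerivAt (fun y => -spiralWeight y)
      (spiralWeight y ^ 2 * (1 - spiralWeight y)) y := fun y _ =>
    (hasDerivAt_spiralWeight y).neg.congr_deriv (by ring)
  have hpos : ∀ y ∈ Ioi x, 0 ≤ spiralWeight y ^ 2 * (1 - spiralWeight y) := fun y _ =>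
    mul_nonneg (sq_nonneg _) (by linarith [spiralWeight_le_one y])
  have hl : Tendsto (fun y => -spiralWeight y) atTop (𝓝 0) := by
    simpa using tendsto_spiralWeight.neg
  refine ⟨integrableOn_Ioi_deriv_of_nonneg' hd hpos hl, ?_⟩
  rw [integral_Ioi_of_hasDerivAt_of_nonneg' hd hpos hl]
  ring

namespace SpiralData

/-- Integrals towards the outer end become integrals towards +∞ under x ↦ -x. The derivative of the
weight changes sign, which is why the sign `χ` is a parameter of `SpiralData`. -/
theorem mirror {μ χ : ℝ} {s ℓ : ℝ → ℝ} {c dc r : ℝ → ℂ} (h : SpiralData μ χ s ℓ c dc r)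
    (hℓ : Tendsto ℓ atBot atBot) :
    SpiralData μ (-χ) (fun x => s (-x)) (fun x => -ℓ (-x)) (fun x => c (-x))
      (fun x => -dc (-x)) (fun x => r (-x)) := by
  have hneg : ∀ x : ℝ, HasDerivAt (fun x : ℝ => -x) (-1) x := fun x => (hasDerivAt_id x).neg
  refine ⟨h.pos, by simpa using h.abs_sign_le, ⟨fun x => h.weight.pos _, fun x =>
    h.weight.le_one _, fun x => ?_, fun x => ?_, fun x => ?_, ?_⟩, fun x => ?_,
    fun x => h.norm_coeff_le _, ?_, fun x => ?_, fun x => h.norm_rough_le _, fun x y hxy => ?_,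
    fun x => h.le_norm_smooth _, fun x => h.le_norm_rate _, fun x => h.le_re_rate _⟩
  · exact ((h.weight.hasDerivAt (-x)).comp x (hneg x)).congr_deriv (by ring)
  · have := h.weight.abs_deriv_le (-x)
    rwa [← abs_neg, neg_mul, neg_mul, neg_neg]
  · exact ((h.weight.hasDerivAt_primitive (-x)).comp x (hneg x)).neg.congr_deriv (by ring)
  · exact tendsto_neg_atBot_atTop.comp (hℓ.comp tendsto_neg_atTop_atBot)
  · exact ((h.hasDerivAt (-x)).scomp x (hneg x)).congr_deriv (by simp)
  · exact (h.continuous_deriv.comp continuous_neg).neg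
  · rw [norm_neg]; exact h.norm_deriv_le _
  · have e : |x - y| = |-x - -y| := by rw [← abs_neg]; ring_nf
    rw [e] at hxy ⊢
    exact h.norm_rough_sub_le _ _ hxy

end SpiralData

/-! ### The Hölder ball and the rate attached to a pair of profiles. -/

/-- The weighted Hölder ball of radius `e`. -/
structure InBall (e : ℝ) (f : ℝ → ℂ) : Prop where
  norm_le : ∀ x, ‖f x‖ ≤ e * spiralWeight x ^ 2
  norm_sub_le : ∀ x y, |x - y| ≤ 1 → ‖f x - f y‖ ≤ e * spiralWeight x ^ 2 * √|x - y|

namespace InBall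

variable {e e' : ℝ} {f g : ℝ → ℂ}

theorem continuous (hf : InBall e f) : Continuous f :=
  continuous_of_norm_sub_le_sqrt hf.norm_sub_le

theorem nonneg (hf : InBall e f) : 0 ≤ e :=
  nonneg_of_mul_nonneg_left ((norm_nonneg _).trans (hf.norm_le 0))
    (pow_pos (spiralWeight_pos 0) _)

theorem mono (hf : InBall e f) (h : e ≤ e') : InBall e' f := by
  refine ⟨fun x => (hf.norm_le x).trans ?_, fun x y hxy => (hf.norm_sub_le x y hxy).trans ?_⟩ <;>
    gcongr

theorem add (hf : InBall e f) (hg : InBall e' g) : InBall (e + e') (fun x => f x + g x) := by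
  refine ⟨fun x => ?_, fun x y hxy => ?_⟩
  · rw [add_mul]
    exact (norm_add_le _ _).trans (add_le_add (hf.norm_le x) (hg.norm_le x))
  · rw [add_mul, add_mul, add_sub_add_comm]
    exact (norm_add_le _ _).trans (add_le_add (hf.norm_sub_le x y hxy) (hg.norm_sub_le x y hxy))

theorem const_mul (hf : InBall e f) (w : ℂ) : InBall (‖w‖ * e) (fun x => w * f x) := by
  refine ⟨fun x => ?_, fun x y hxy => ?_⟩
  · rw [norm_mul, mul_assoc]
    exact mul_le_mul_of_nonneg_left (hf.norm_le x) (norm_nonneg _)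
  · rw [← mul_sub, norm_mul, mul_assoc, mul_assoc, ← mul_assoc e]
    exact mul_le_mul_of_nonneg_left (hf.norm_sub_le x y hxy) (norm_nonneg _)

theorem conj (hf : InBall e f) : InBall e (fun x => (starRingEnd ℂ) (f x)) := by
  refine ⟨fun x => ?_, fun x y hxy => ?_⟩
  · rw [Complex.norm_conj]; exact hf.norm_le x
  · rw [← map_sub, Complex.norm_conj]; exact hf.norm_sub_le x y hxy

end InBall

/-- The coefficient `Q = 1 + i ∫_x^∞ (g - k) (1 - σ)`. -/
noncomputable def coeffQ (g k : ℝ → ℂ) (x : ℝ) : ℂ :=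
  1 + Complex.I * ∫ y in Ioi x, (g y - k y) * (1 - spiralWeight y)

/-- The derivative of `1 / Q`. -/
noncomputable def derivInvQ (g k : ℝ → ℂ) (x : ℝ) : ℂ :=
  Complex.I * ((g x - k x) * (1 - spiralWeight x)) / coeffQ g k x ^ 2

/-- The rough part of the rate. -/
noncomputable def roughRate (g k : ℝ → ℂ) (x : ℝ) : ℂ :=
  -Complex.I * (1 - spiralWeight x) * k x * (coeffQ g k x)⁻¹

section Coeff

variable {e : ℝ} {g k : ℝ → ℂ}

theorem norm_one_sub_spiralWeight (x : ℝ) :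
    ‖(1 : ℂ) - spiralWeight x‖ = 1 - spiralWeight x := by
  have : (1 - (spiralWeight x : ℂ)) = ((1 - spiralWeight x : ℝ) : ℂ) := by push_cast; ring
  rw [this, Complex.norm_real, Real.norm_eq_abs,
    abs_of_nonneg (by linarith [spiralWeight_le_one x])]

theorem norm_coeff_integrand_le (hg : InBall e g) (hk : InBall e k) (x : ℝ) :
    ‖(g x - k x) * (1 - spiralWeight x)‖ ≤
      2 * e * (spiralWeight x ^ 2 * (1 - spiralWeight x)) := by
  rw [norm_mul, norm_one_sub_spiralWeight]
  have h1 := (norm_sub_le (g x) (k x)).trans (add_le_add (hg.norm_le x) (hk.norm_le x))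
  calc _ ≤ (e * spiralWeight x ^ 2 + e * spiralWeight x ^ 2) * (1 - spiralWeight x) :=
        mul_le_mul_of_nonneg_right h1 (by linarith [spiralWeight_le_one x])
    _ = _ := by ring

theorem continuous_coeff_integrand (hg : InBall e g) (hk : InBall e k) :
    Continuous fun y => (g y - k y) * (1 - (spiralWeight y : ℂ)) := by
  have := hg.continuous
  have := hk.continuous
  have := continuous_spiralWeight
  fun_prop

theorem integrableOn_coeff (hg : InBall e g) (hk : InBall e k) (x : ℝ) :
    IntegrableOn (fun y => (g y - k y) * (1 - (spiralWeight y : ℂ))) (Ioi x) :=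
  Integrable.mono' ((integrableOn_sq_mul_one_sub x).1.const_mul (2 * e))
    (continuous_coeff_integrand hg hk).aestronglyMeasurable
    (ae_of_all _ (norm_coeff_integrand_le hg hk))

/-- The integrand is at most 2e σ²(1-σ), whose integral is 2e σ. The decay in σ is needed, since the
real part of the unperturbed rate is itself only μσ. -/
theorem norm_coeffQ_sub_one_le (hg : InBall e g) (hk : InBall e k) (x : ℝ) :
    ‖coeffQ g k x - 1‖ ≤ 2 * e * spiralWeight x := by
  unfold coeffQ
  rw [add_sub_cancel_left, norm_mul, Complex.norm_I, one_mul]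
  refine (norm_integral_le_of_norm_le ((integrableOn_sq_mul_one_sub x).1.const_mul (2 * e))
    (ae_of_all _ (norm_coeff_integrand_le hg hk))).trans_eq ?_
  rw [integral_const_mul, (integrableOn_sq_mul_one_sub x).2]

theorem hasDerivAt_coeffQ (hg : InBall e g) (hk : InBall e k) (x : ℝ) :
    HasDerivAt (coeffQ g k) (-Complex.I * ((g x - k x) * (1 - spiralWeight x))) x := by
  set H : ℝ → ℂ := fun y => (g y - k y) * (1 - (spiralWeight y : ℂ)) with hH
  have hHc : Continuous H := continuous_coeff_integrand hg hk
  have hI : HasDerivAt (fun x => ∫ y in (0:ℝ)..x, H y) (H x) x :=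
    intervalIntegral.integral_hasDerivAt_right (hHc.intervalIntegrable _ _)
      hHc.aestronglyMeasurable.stronglyMeasurableAtFilter hHc.continuousAt
  have heq : coeffQ g k = fun x =>
      1 + Complex.I * ((∫ y in Ioi 0, H y) - ∫ y in (0:ℝ)..x, H y) := by
    funext x
    unfold coeffQ
    rw [← intervalIntegral.integral_Ioi_sub_Ioi' (integrableOn_coeff hg hk 0)
      (integrableOn_coeff hg hk x)]
    simp only [hH]
    ring
  rw [heq]
  exact (((hI.const_sub _).const_mul Complex.I).const_add 1).congr_deriv (by simp only [hH]; ring)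


theorem half_le_norm_coeffQ (hg : InBall e g) (hk : InBall e k) (he : e ≤ 1 / 1000) (x : ℝ) :
    1 / 2 ≤ ‖coeffQ g k x‖ := by
  have h1 := norm_coeffQ_sub_one_le hg hk x
  have h2 := spiralWeight_le_one x
  have h3 := hg.nonneg
  have h4 : (1 : ℝ) ≤ ‖coeffQ g k x‖ + ‖coeffQ g k x - 1‖ := by
    calc (1 : ℝ) = ‖coeffQ g k x - (coeffQ g k x - 1)‖ := by simp
      _ ≤ _ := norm_sub_le _ _
  nlinarith [spiralWeight_pos x]

theorem coeffQ_ne_zero (hg : InBall e g) (hk : InBall e k) (he : e ≤ 1 / 1000) (x : ℝ) :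
    coeffQ g k x ≠ 0 :=
  norm_pos_iff.1 (lt_of_lt_of_le (by norm_num) (half_le_norm_coeffQ hg hk he x))

theorem norm_inv_coeffQ_le (hg : InBall e g) (hk : InBall e k) (he : e ≤ 1 / 1000) (x : ℝ) :
    ‖(coeffQ g k x)⁻¹‖ ≤ 2 := by
  rw [norm_inv]
  exact inv_le_of_inv_le₀ (by norm_num) (by simpa using half_le_norm_coeffQ hg hk he x)

theorem norm_inv_coeffQ_sub_one_le (hg : InBall e g) (hk : InBall e k) (he : e ≤ 1 / 1000)
    (x : ℝ) : ‖(coeffQ g k x)⁻¹ - 1‖ ≤ 4 * e * spiralWeight x := by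
  have hne := coeffQ_ne_zero hg hk he x
  have : (coeffQ g k x)⁻¹ - 1 = -(coeffQ g k x)⁻¹ * (coeffQ g k x - 1) := by
    field_simp
    ring
  rw [this, norm_mul, norm_neg]
  calc _ ≤ 2 * (2 * e * spiralWeight x) :=
        mul_le_mul (norm_inv_coeffQ_le hg hk he x) (norm_coeffQ_sub_one_le hg hk x)
          (norm_nonneg _) (by norm_num)
    _ = _ := by ring

theorem norm_roughRate_le (hg : InBall e g) (hk : InBall e k) (he : e ≤ 1 / 1000) (x : ℝ) :
    ‖roughRate g k x‖ ≤ 2 * e * spiralWeight x ^ 2 := by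
  unfold roughRate
  rw [norm_mul, norm_mul, norm_mul, norm_neg, Complex.norm_I, one_mul, norm_one_sub_spiralWeight]
  have h0 := spiralWeight_pos x
  have h1 := spiralWeight_le_one x
  have he0 := hg.nonneg
  calc _ ≤ 1 * (e * spiralWeight x ^ 2) * 2 := by
        refine mul_le_mul (mul_le_mul (by linarith) (hk.norm_le x) (norm_nonneg _) zero_le_one)
          (norm_inv_coeffQ_le hg hk he x) (norm_nonneg _) (by positivity)
    _ = _ := by ring

/-- For σ ≥ 1/2 the real part suffices, for σ ≤ 1/2 the imaginary part. -/
theorem quarter_le_norm {μ : ℝ} (hμ : 1 / 2 < μ) (x : ℝ) :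
    1 / 4 ≤ ‖(μ * spiralWeight x - Complex.I * (1 - spiralWeight x) : ℂ)‖ := by
  have h0 := spiralWeight_pos x
  have hre : (μ * spiralWeight x - Complex.I * (1 - spiralWeight x) : ℂ).re =
      μ * spiralWeight x := by simp
  have him : (μ * spiralWeight x - Complex.I * (1 - spiralWeight x) : ℂ).im =
      -(1 - spiralWeight x) := by simp
  rcases le_total (1 / 2) (spiralWeight x) with h | h
  · refine le_trans ?_ (Complex.abs_re_le_norm _)
    rw [hre]
    exact le_trans (by nlinarith) (le_abs_self _)
  · refine le_trans ?_ (Complex.abs_im_le_norm _)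
    rw [him, abs_neg]
    exact le_trans (by linarith) (le_abs_self _)

/-- The rate differs from μσ - i(1-σ), the rate of T^{-μ} e^{iT}, by at most 6eσ. All lower bounds
are inherited from that explicit function. -/
theorem spiralData_of_inBall {μ : ℝ} (hμ : 1 / 2 < μ) (hg : InBall e g) (hk : InBall e k)
    (he : e ≤ 1 / 1000) :
    SpiralData μ (-1) spiralWeight spiralLog (fun x => (coeffQ g k x)⁻¹) (derivInvQ g k)
      (roughRate g k) := by
  have hw := slowWeight_spiralWeight
  have he0 := hg.nonneg
  have hcQ : Continuous (coeffQ g k) :=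
    continuous_iff_continuousAt.2 fun x => (hasDerivAt_coeffQ hg hk x).continuousAt
  have hne := coeffQ_ne_zero hg hk he
  have hcd : ∀ x, HasDerivAt (fun x => (coeffQ g k x)⁻¹) (derivInvQ g k x) x := fun x =>
    ((hasDerivAt_coeffQ hg hk x).inv (hne x)).congr_deriv (by unfold derivInvQ; ring)
  have hdn : ∀ x, ‖derivInvQ g k x‖ ≤ 8 * e * spiralWeight x ^ 2 := by
    intro x
    have h0 := spiralWeight_pos x
    have h1 := spiralWeight_le_one x
    have : derivInvQ g k x = Complex.I * ((g x - k x) * (1 - spiralWeight x)) *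
        (coeffQ g k x)⁻¹ ^ 2 := by unfold derivInvQ; rw [inv_pow]; rfl
    rw [this, norm_mul, norm_mul, Complex.norm_I, one_mul, norm_pow]
    have h2 : ‖(coeffQ g k x)⁻¹‖ ^ 2 ≤ 4 := by
      calc _ ≤ (2 : ℝ) ^ 2 := pow_le_pow_left₀ (norm_nonneg _) (norm_inv_coeffQ_le hg hk he x) 2
        _ = 4 := by norm_num
    have h3 : spiralWeight x ^ 2 * (1 - spiralWeight x) ≤ spiralWeight x ^ 2 := by
      nlinarith [sq_nonneg (spiralWeight x)]
    calc _ ≤ (2 * e * (spiralWeight x ^ 2 * (1 - spiralWeight x))) * 4 :=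
          mul_le_mul (norm_coeff_integrand_le hg hk x) h2 (by positivity)
            ((norm_nonneg _).trans (norm_coeff_integrand_le hg hk x))
      _ ≤ (2 * e * spiralWeight x ^ 2) * 4 := by gcongr
      _ = _ := by ring
  have hdiff : ∀ x, ‖smoothRate μ spiralWeight (fun x => (coeffQ g k x)⁻¹) x -
      (μ * spiralWeight x - Complex.I * (1 - spiralWeight x))‖ ≤ 4 * e * spiralWeight x := by
    intro x
    have h0 := spiralWeight_pos x
    have : smoothRate μ spiralWeight (fun x => (coeffQ g k x)⁻¹) x -
        (μ * spiralWeight x - Complex.I * (1 - spiralWeight x)) =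
        -Complex.I * (1 - spiralWeight x) * ((coeffQ g k x)⁻¹ - 1) := by
      unfold smoothRate; ring
    rw [this, norm_mul, norm_mul, norm_neg, Complex.norm_I, one_mul, norm_one_sub_spiralWeight]
    calc _ ≤ 1 * (4 * e * spiralWeight x) :=
          mul_le_mul (by linarith) (norm_inv_coeffQ_sub_one_le hg hk he x) (norm_nonneg _)
            zero_le_one
      _ = _ := one_mul _
  have hdiff' : ∀ x, ‖smoothRate μ spiralWeight (fun x => (coeffQ g k x)⁻¹) x + roughRate g k x -
      (μ * spiralWeight x - Complex.I * (1 - spiralWeight x))‖ ≤ 6 * e * spiralWeight x := by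
    intro x
    have h0 := spiralWeight_pos x
    have h1 := spiralWeight_le_one x
    have e1 := norm_roughRate_le hg hk he x
    have e2 : spiralWeight x ^ 2 ≤ spiralWeight x := by nlinarith
    rw [add_sub_right_comm]
    refine (norm_add_le _ _).trans ((add_le_add (hdiff x) e1).trans ?_)
    nlinarith
  refine ⟨by linarith, by simp, hw, hcd, norm_inv_coeffQ_le hg hk he, ?_, fun x => ?_,
    fun x => ?_, fun x y hxy => ?_, fun x => ?_, fun x => ?_, fun x => ?_⟩
  · have h1 := continuous_coeff_integrand hg hk
    exact (continuous_const.mul h1).div (hcQ.pow 2) fun x => pow_ne_zero _ (hne x)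
  · refine (hdn x).trans ?_
    nlinarith [sq_nonneg (spiralWeight x)]
  · refine (norm_roughRate_le hg hk he x).trans ?_
    nlinarith [sq_nonneg (spiralWeight x)]
  · have h0 := (spiralWeight_pos x).le
    have h1 := spiralWeight_le_one x
    -- In the rough rate only `k` is Hölder; its cofactor is differentiable and slowly varying.
    have hwd : SlowOrder spiralWeight 0 4
        (fun x => (1 - (spiralWeight x : ℂ)) * (coeffQ g k x)⁻¹)
        (fun x => -((-1 * spiralWeight x ^ 2 * (1 - spiralWeight x) : ℝ) : ℂ) *
          (coeffQ g k x)⁻¹ + (1 - (spiralWeight x : ℂ)) * derivInvQ g k x) := by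
      refine ⟨fun x => (((hasDerivAt_spiralWeight x).ofReal_comp).const_sub 1).mul (hcd x),
        fun x => ?_, fun x => ?_⟩
      · have h0 := (spiralWeight_pos x).le
        rw [norm_mul, norm_one_sub_spiralWeight]
        have := mul_le_mul (by linarith : 1 - spiralWeight x ≤ 1) (norm_inv_coeffQ_le hg hk he x)
          (norm_nonneg _) zero_le_one
        simp only [pow_zero]
        linarith
      · have h0 := (spiralWeight_pos x).le
        have h1 := spiralWeight_le_one x
        refine (norm_add_le _ _).trans ?_
        rw [norm_mul, norm_mul, norm_one_sub_spiralWeight, norm_neg, Complex.norm_real,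
          Real.norm_eq_abs]
        have e1 := mul_le_mul (hw.abs_deriv_le x) (norm_inv_coeffQ_le hg hk he x) (norm_nonneg _)
          (by positivity)
        have e2 := mul_le_mul (by linarith : 1 - spiralWeight x ≤ 1) (hdn x)
          (norm_nonneg _) zero_le_one
        have e3 : spiralWeight x ^ 2 ≤ spiralWeight x := by nlinarith
        rw [zero_add, pow_one]
        nlinarith [sq_nonneg (spiralWeight x)]
    have hsq : |x - y| ≤ √|x - y| := by simpa using mul_le_mul_sqrt (abs_nonneg _) hxy zero_le_one
    have hsub : roughRate g k x - roughRate g k y =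
        -Complex.I * ((k x - k y) * ((1 - (spiralWeight x : ℂ)) * (coeffQ g k x)⁻¹) +
          k y * ((1 - (spiralWeight x : ℂ)) * (coeffQ g k x)⁻¹ -
            (1 - (spiralWeight y : ℂ)) * (coeffQ g k y)⁻¹)) := by
      unfold roughRate; ring
    have e1 : ‖(k x - k y) * ((1 - (spiralWeight x : ℂ)) * (coeffQ g k x)⁻¹)‖ ≤
        (e * spiralWeight x ^ 2 * √|x - y|) * 4 := by
      rw [norm_mul]
      exact mul_le_mul (hk.norm_sub_le x y hxy) (by simpa using hwd.norm_le x) (norm_nonneg _)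
        (by positivity)
    have e2 : ‖k y * ((1 - (spiralWeight x : ℂ)) * (coeffQ g k x)⁻¹ -
        (1 - (spiralWeight y : ℂ)) * (coeffQ g k y)⁻¹)‖ ≤
        (e * (3 * spiralWeight x) ^ 2) * (4 * 3 * 1 * √|x - y|) := by
      rw [norm_mul]
      refine mul_le_mul ((hk.norm_le y).trans ?_) ((hwd.norm_sub_le hw hxy).trans ?_)
        (norm_nonneg _) (by positivity)
      · have := hw.le_three_mul hxy
        have := (spiralWeight_pos y).le
        gcongr
      · rw [zero_add, pow_one, pow_one]
        gcongr
    rw [hsub, norm_mul, norm_neg, Complex.norm_I, one_mul]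
    refine (norm_add_le _ _).trans ((add_le_add e1 e2).trans ?_)
    have : 0 ≤ spiralWeight x ^ 2 * √|x - y| := by positivity
    nlinarith
  · have h1 := quarter_le_norm hμ x
    have h2 := hdiff x
    have h3 := spiralWeight_le_one x
    have h4 := norm_sub_norm_le (μ * spiralWeight x - Complex.I * (1 - spiralWeight x) : ℂ)
      (smoothRate μ spiralWeight (fun x => (coeffQ g k x)⁻¹) x)
    rw [norm_sub_rev _ (smoothRate _ _ _ _)] at h4
    nlinarith [spiralWeight_pos x]
  · have h1 := quarter_le_norm hμ x
    have h2 := hdiff' x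
    have h3 := spiralWeight_le_one x
    have h4 := norm_sub_norm_le (μ * spiralWeight x - Complex.I * (1 - spiralWeight x) : ℂ)
      (smoothRate μ spiralWeight (fun x => (coeffQ g k x)⁻¹) x + roughRate g k x)
    rw [norm_sub_rev _ (smoothRate _ _ _ _ + _)] at h4
    nlinarith [spiralWeight_pos x]
  · have h2 := (Complex.abs_re_le_norm _).trans (hdiff' x)
    have h3 := (abs_le.1 h2).1
    have hre : (μ * spiralWeight x - Complex.I * (1 - spiralWeight x) : ℂ).re =
      μ * spiralWeight x := by simp
    rw [Complex.sub_re, hre] at h3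
    nlinarith [spiralWeight_pos x]

end Coeff


/-! ### The inner and outer terms at one frequency. -/

/-- A dominated integral of functions holomorphic on a disc is holomorphic. -/
theorem differentiableOn_integral_of_dominated {α : Type*} [MeasurableSpace α] {ν : Measure α}
    {F : ℂ → α → ℂ} {R : ℝ} {b : α → ℝ}
    (hm : ∀ w ∈ Metric.ball (0 : ℂ) R, AEStronglyMeasurable (F w) ν)
    (hd : ∀ᵐ y ∂ν, DifferentiableOn ℂ (fun w => F w y) (Metric.ball 0 R))
    (hb : ∀ᵐ y ∂ν, ∀ w ∈ Metric.ball (0 : ℂ) R, ‖F w y‖ ≤ b y) (hbi : Integrable b ν) :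
    DifferentiableOn ℂ (fun w => ∫ y, F w y ∂ν) (Metric.ball 0 R) := by
  intro w₀ hw₀
  obtain ⟨ρ, hρ, hρs⟩ := Metric.isOpen_iff.1 Metric.isOpen_ball w₀ hw₀
  set r := ρ / 4 with hr
  have hr0 : 0 < r := by positivity
  have hsub : ∀ w ∈ Metric.ball w₀ r, Metric.closedBall w r ⊆ Metric.ball 0 R := by
    intro w hw z hz
    refine hρs ?_
    rw [Metric.mem_ball] at hw ⊢
    rw [Metric.mem_closedBall] at hz
    linarith [dist_triangle z w w₀]
  have hsub' : ∀ w ∈ Metric.ball w₀ r, w ∈ Metric.ball (0 : ℂ) R := fun w hw =>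
    hsub w hw (Metric.mem_closedBall_self hr0.le)
  -- The derivative is an almost everywhere limit of difference quotients along a sequence, hence
  -- measurable.
  have hmeas : AEStronglyMeasurable (fun y => deriv (fun w => F w y) w₀) ν := by
    set h : ℕ → ℂ := fun n => ((r / 2 / (n + 1) : ℝ) : ℂ) with hh
    have hpos : ∀ n : ℕ, 0 < r / 2 / ((n : ℝ) + 1) := fun n => by positivity
    have hmem : ∀ n, w₀ + h n ∈ Metric.ball (0 : ℂ) R := fun n => by
      refine hsub' _ ?_
      rw [Metric.mem_ball, dist_eq_norm, add_sub_cancel_left]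
      simp only [hh]
      rw [Complex.norm_real, Real.norm_eq_abs, abs_of_pos (hpos n)]
      have : r / 2 / ((n : ℝ) + 1) ≤ r / 2 :=
        div_le_self (by positivity) (by have : (0 : ℝ) ≤ n := n.cast_nonneg; linarith)
      linarith
    have hlim : Tendsto h atTop (𝓝[≠] 0) := by
      refine tendsto_nhdsWithin_iff.2 ⟨?_, Eventually.of_forall fun n => ?_⟩
      · have h1 : Tendsto (fun n : ℕ => r / 2 / ((n : ℝ) + 1)) atTop (𝓝 0) :=
          tendsto_const_nhds.div_atTop
            (tendsto_atTop_add_const_right _ _ tendsto_natCast_atTop_atTop)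
        exact (Complex.continuous_ofReal.tendsto' 0 0 (by simp)).comp h1
      · simp only [hh, mem_compl_iff, mem_singleton_iff]
        exact_mod_cast (hpos n).ne'
    refine aestronglyMeasurable_of_tendsto_ae atTop
      (f := fun n y => (h n)⁻¹ • (F (w₀ + h n) y - F w₀ y)) (fun n => ?_) ?_
    · exact ((hm _ (hmem n)).sub (hm _ hw₀)).const_smul ((h n)⁻¹)
    · filter_upwards [hd] with y hy
      have := (hy.differentiableAt (Metric.isOpen_ball.mem_nhds hw₀)).hasDerivAt
      exact (hasDerivAt_iff_tendsto_slope_zero.1 this).comp hlim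
  -- Cauchy's estimate turns the bound on the functions into one on their derivatives.
  have hbound : ∀ᵐ y ∂ν, ∀ w ∈ Metric.ball w₀ r, ‖deriv (fun w => F w y) w‖ ≤ b y / r := by
    filter_upwards [hd, hb] with y hy hyb w hw
    refine Complex.norm_deriv_le_of_forall_mem_sphere_norm_le hr0 ?_ fun z hz =>
      hyb z (hsub w hw (Metric.sphere_subset_closedBall hz))
    exact (hy.mono (hsub w hw)).diffContOnCl_ball subset_rfl
  have key := hasDerivAt_integral_of_dominated_loc_of_deriv_le (F := F)
    (F' := fun w y => deriv (fun w => F w y) w) (Metric.ball_mem_nhds w₀ hr0)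
    (eventually_of_mem (Metric.ball_mem_nhds w₀ hr0) fun w hw => hm w (hsub' w hw))
    (hbi.mono' (hm w₀ hw₀) (hb.mono fun y hy => hy w₀ hw₀)) hmeas hbound (hbi.div_const r)
    (by
      filter_upwards [hd] with y hy w hw
      exact (hy.differentiableAt (Metric.isOpen_ball.mem_nhds (hsub' w hw))).hasDerivAt)
  exact key.2.differentiableAt.differentiableWithinAt

/-- The logarithmic decay rate of the spiral. -/
noncomputable def spiralRate (μ : ℝ) (g k : ℝ → ℂ) (x : ℝ) : ℂ :=
  smoothRate μ spiralWeight (fun x => (coeffQ g k x)⁻¹) x + roughRate g k x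

/-- A primitive of the decay rate. -/
noncomputable def ratePrim (μ : ℝ) (g k : ℝ → ℂ) (x : ℝ) : ℂ :=
  ∫ y in (0 : ℝ)..x, spiralRate μ g k y

/-- The rate at frequency `κ` with weight correction `α`. -/
noncomputable def freqRate (μ α κ : ℝ) (g k : ℝ → ℂ) (x : ℝ) : ℂ :=
  κ * spiralRate μ g k x + α * spiralWeight x

/-- A primitive of `freqRate`. -/
noncomputable def freqPrim (μ α κ : ℝ) (g k : ℝ → ℂ) (x : ℝ) : ℂ :=
  κ * ratePrim μ g k x + α * spiralLog x

/-- The contribution at frequency `κ` of the part of the sheet closer to the centre. -/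
noncomputable def innerTerm (μ a κ : ℝ) (g k : ℝ → ℂ) (x : ℝ) : ℂ :=
  fwdInt (fun y => (spiralWeight y : ℂ)) (freqPrim μ a κ g k) x

/-- The contribution at frequency `κ` of the part of the sheet farther from the centre. -/
noncomputable def outerTerm (μ a κ : ℝ) (g k : ℝ → ℂ) (x : ℝ) : ℂ :=
  fwdInt (fun y => (spiralWeight (-y) : ℂ)) (fun y => -freqPrim μ (-a) κ g k (-y)) (-x)

section Terms

variable {μ a κ e : ℝ} {g k : ℝ → ℂ}

theorem LargeFreq.neg {α : ℝ} (h : LargeFreq μ α κ) : LargeFreq μ (-α) κ :=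
  ⟨h.one_le, h.lt_mul, by rw [abs_neg]; exact h.abs_le, by rw [abs_neg]; exact h.abs_le_mul⟩

theorem continuous_spiralRate (hμ : 1 / 2 < μ) (hg : InBall e g) (hk : InBall e k)
    (he : e ≤ 1 / 1000) : Continuous (spiralRate μ g k) :=
  (spiralData_of_inBall hμ hg hk he).continuous_smooth.add
    (spiralData_of_inBall hμ hg hk he).continuous_rough

theorem norm_spiralRate_le (hμ : 1 / 2 < μ) (hg : InBall e g) (hk : InBall e k)
    (he : e ≤ 1 / 1000) (x : ℝ) : ‖spiralRate μ g k x‖ ≤ μ + 4 := by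
  have h := spiralData_of_inBall hμ hg hk he
  have h2 : ‖smoothRate μ spiralWeight (fun x => (coeffQ g k x)⁻¹) x‖ ≤ μ + 3 := by
    simpa using h.slow_smooth.norm_le x
  have h3 : ‖roughRate g k x‖ ≤ 1 := (h.norm_rough_le x).trans
    (pow_le_one₀ (spiralWeight_pos x).le (spiralWeight_le_one x))
  exact (norm_add_le _ _).trans (by linarith)

theorem hasDerivAt_ratePrim (hμ : 1 / 2 < μ) (hg : InBall e g) (hk : InBall e k)
    (he : e ≤ 1 / 1000) (x : ℝ) : HasDerivAt (ratePrim μ g k) (spiralRate μ g k x) x := by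
  have hc := continuous_spiralRate hμ hg hk he
  exact intervalIntegral.integral_hasDerivAt_right (hc.intervalIntegrable _ _)
    hc.aestronglyMeasurable.stronglyMeasurableAtFilter hc.continuousAt

theorem hasDerivAt_freqPrim (hμ : 1 / 2 < μ) (hg : InBall e g) (hk : InBall e k)
    (he : e ≤ 1 / 1000) (α κ x : ℝ) :
    HasDerivAt (freqPrim μ α κ g k) (freqRate μ α κ g k x) x :=
  ((hasDerivAt_ratePrim hμ hg hk he x).const_mul _).add
    (((hasDerivAt_spiralLog x).ofReal_comp).const_mul _)

theorem hasDerivAt_freqPrim_mirror (hμ : 1 / 2 < μ) (hg : InBall e g) (hk : InBall e k)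
    (he : e ≤ 1 / 1000) (α κ x : ℝ) :
    HasDerivAt (fun y => -freqPrim μ α κ g k (-y)) (freqRate μ α κ g k (-x)) x :=
  ((hasDerivAt_freqPrim hμ hg hk he α κ (-x)).scomp x (hasDerivAt_neg x)).neg.congr_deriv
    (by simp)

theorem decayRate_freq (hμ : 1 / 2 < μ) (hg : InBall e g) (hk : InBall e k)
    (he : e ≤ 1 / 1000) (hκ : LargeFreq μ a κ) :
    DecayRate spiralWeight (κ * μ / 4) (freqRate μ a κ g k) (freqPrim μ a κ g k) :=
  (spiralData_of_inBall hμ hg hk he).decayRate hκ (hasDerivAt_freqPrim hμ hg hk he a κ)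

theorem spiralData_mirror (hμ : 1 / 2 < μ) (hg : InBall e g) (hk : InBall e k)
    (he : e ≤ 1 / 1000) :
    SpiralData μ (-(-1)) (fun x => spiralWeight (-x)) (fun x => -spiralLog (-x))
      (fun x => (coeffQ g k (-x))⁻¹) (fun x => -derivInvQ g k (-x))
      (fun x => roughRate g k (-x)) :=
  (spiralData_of_inBall hμ hg hk he).mirror tendsto_spiralLog_atBot

theorem decayRate_freq_mirror (hμ : 1 / 2 < μ) (hg : InBall e g) (hk : InBall e k)
    (he : e ≤ 1 / 1000) (hκ : LargeFreq μ a κ) :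
    DecayRate (fun x => spiralWeight (-x)) (κ * μ / 4) (fun x => freqRate μ (-a) κ g k (-x))
      (fun y => -freqPrim μ (-a) κ g k (-y)) :=
  (spiralData_mirror hμ hg hk he).decayRate hκ.neg
    (hasDerivAt_freqPrim_mirror hμ hg hk he (-a) κ)

theorem integrableOn_inner (hμ : 1 / 2 < μ) (hg : InBall e g) (hk : InBall e k)
    (he : e ≤ 1 / 1000) (hκ : LargeFreq μ a κ) (x : ℝ) :
    IntegrableOn (fun y => (spiralWeight y : ℂ) *
      Complex.exp (freqPrim μ a κ g k x - freqPrim μ a κ g k y)) (Ioi x) := by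
  have := continuous_spiralWeight
  refine DecayRate.integrableOn slowWeight_spiralWeight (decayRate_freq hμ hg hk he hκ) (b := 0)
    (M := 1) ?_ (by fun_prop) (fun y => ?_) x
  · have := hκ.lt_mul; push_cast; linarith
  · rw [Complex.norm_real, Real.norm_eq_abs, abs_of_pos (spiralWeight_pos y)]; simp

theorem integrableOn_outer (hμ : 1 / 2 < μ) (hg : InBall e g) (hk : InBall e k)
    (he : e ≤ 1 / 1000) (hκ : LargeFreq μ a κ) (x : ℝ) :
    IntegrableOn (fun y => (spiralWeight (-y) : ℂ) *
      Complex.exp (-freqPrim μ (-a) κ g k (-x) - -freqPrim μ (-a) κ g k (-y))) (Ioi x) := by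
  have := continuous_spiralWeight
  refine DecayRate.integrableOn (spiralData_mirror hμ hg hk he).weight
    (decayRate_freq_mirror hμ hg hk he hκ) (F := fun y => (spiralWeight (-y) : ℂ)) (b := 0)
    (M := 1) ?_ (by fun_prop) (fun y => ?_) x
  · have := hκ.lt_mul; push_cast; linarith
  · rw [Complex.norm_real, Real.norm_eq_abs, abs_of_pos (spiralWeight_pos _)]; simp

theorem hasDerivAt_innerTerm (hμ : 1 / 2 < μ) (hg : InBall e g) (hk : InBall e k)
    (he : e ≤ 1 / 1000) (hκ : LargeFreq μ a κ) (x : ℝ) :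
    HasDerivAt (innerTerm μ a κ g k)
      (freqRate μ a κ g k x * innerTerm μ a κ g k x - spiralWeight x) x := by
  have := continuous_spiralWeight
  exact (decayRate_freq hμ hg hk he hκ).hasDerivAt_fwdInt (by fun_prop)
    (integrableOn_inner hμ hg hk he hκ) x

/-- In the original variable the outer term is the integral over y < x of σ(y) exp(κ(Ψ(y) - Ψ(x)) +
a(ℓ(x) - ℓ(y))). The density factor keeps its sign while the exponential of Ψ is inverted, hence the
parameter -a in the rate. -/
theorem hasDerivAt_outerTerm (hμ : 1 / 2 < μ) (hg : InBall e g) (hk : InBall e k)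
    (he : e ≤ 1 / 1000) (hκ : LargeFreq μ a κ) (x : ℝ) :
    HasDerivAt (outerTerm μ a κ g k)
      (-(freqRate μ (-a) κ g k x * outerTerm μ a κ g k x - spiralWeight x)) x := by
  have := continuous_spiralWeight
  have h := (decayRate_freq_mirror hμ hg hk he hκ).hasDerivAt_fwdInt
    (F := fun y => (spiralWeight (-y) : ℂ)) (by fun_prop)
    (integrableOn_outer hμ hg hk he hκ) (-x)
  simp only [neg_neg] at h
  exact (h.scomp x (hasDerivAt_neg x)).congr_deriv (by simp [outerTerm])

theorem exists_norm_terms_le (hμ : 1 / 2 < μ) (a : ℝ) : ∃ C : ℝ, 0 ≤ C ∧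
    ∀ (e κ : ℝ) (g k : ℝ → ℂ), InBall e g → InBall e k → e ≤ 1 / 1000 → LargeFreq μ a κ → ∀ x,
      ‖innerTerm μ a κ g k x - spiralWeight x / freqRate μ a κ g k x‖ ≤
        C * spiralWeight x ^ 2 / (κ * √κ) ∧
      ‖outerTerm μ a κ g k x - spiralWeight x / freqRate μ (-a) κ g k x‖ ≤
        C * spiralWeight x ^ 2 / (κ * √κ) := by
  obtain ⟨C₁, hC₁, h₁⟩ := SpiralData.exists_norm_fwdInt_sub_le μ a
  obtain ⟨C₂, hC₂, h₂⟩ := SpiralData.exists_norm_fwdInt_sub_le μ (-a)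
  refine ⟨max C₁ C₂, hC₁.trans (le_max_left _ _), fun e κ g k hg hk he hκ x => ⟨?_, ?_⟩⟩
  · have hκ0 : 0 < κ := zero_lt_one.trans_le hκ.one_le
    refine (h₁ _ κ _ _ _ _ _ _ (spiralData_of_inBall hμ hg hk he) hκ
      (hasDerivAt_freqPrim hμ hg hk he a κ) x).trans ?_
    gcongr
    exact le_max_left _ _
  · have hκ0 : 0 < κ := zero_lt_one.trans_le hκ.one_le
    have h := h₂ _ κ _ _ _ _ _ _ (spiralData_mirror hμ hg hk he) hκ.neg
      (hasDerivAt_freqPrim_mirror hμ hg hk he (-a) κ) (-x)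
    simp only [neg_neg] at h
    have e1 : fullRate μ (-a) κ (fun x => spiralWeight (-x)) (fun x => (coeffQ g k (-x))⁻¹)
        (fun x => roughRate g k (-x)) (-x) = freqRate μ (-a) κ g k x := by
      simp [fullRate, freqRate, smoothRate, spiralRate]
    rw [e1] at h
    refine h.trans ?_
    gcongr
    exact le_max_right _ _

/-- The derivative of `innerTerm - outerTerm`. -/
noncomputable def derivTerm (μ a κ : ℝ) (g k : ℝ → ℂ) (x : ℝ) : ℂ :=
  freqRate μ a κ g k x * innerTerm μ a κ g k x + freqRate μ (-a) κ g k x * outerTerm μ a κ g k x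
    - 2 * spiralWeight x

/-- The total contribution at frequency `κ`. -/
noncomputable def diffTerm (μ a κ : ℝ) (g k : ℝ → ℂ) (x : ℝ) : ℂ :=
  innerTerm μ a κ g k x - outerTerm μ a κ g k x

theorem hasDerivAt_diffTerm (hμ : 1 / 2 < μ) (hg : InBall e g) (hk : InBall e k)
    (he : e ≤ 1 / 1000) (hκ : LargeFreq μ a κ) (x : ℝ) :
    HasDerivAt (diffTerm μ a κ g k) (derivTerm μ a κ g k x) x :=
  ((hasDerivAt_innerTerm hμ hg hk he hκ x).sub
    (hasDerivAt_outerTerm hμ hg hk he hκ x)).congr_deriv (by unfold derivTerm; ring)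

/-- The leading parts σ/P_a and σ/P_{-a} of the two terms differ only by -2aσ²/(P_a P_{-a}), of size
σ²/κ². In the derivative they contribute exactly 2σ, which cancels, and the errors are multiplied by
P = O(κ). -/
theorem exists_norm_diffTerm_le (hμ : 1 / 2 < μ) (a : ℝ) : ∃ C : ℝ, 0 ≤ C ∧
    ∀ (e κ : ℝ) (g k : ℝ → ℂ), InBall e g → InBall e k → e ≤ 1 / 1000 → LargeFreq μ a κ → ∀ x,
      ‖diffTerm μ a κ g k x‖ ≤ C * spiralWeight x ^ 2 / (κ * √κ) ∧
      ‖derivTerm μ a κ g k x‖ ≤ C * spiralWeight x ^ 2 / √κ := by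
  obtain ⟨C, hC, hterm⟩ := exists_norm_terms_le hμ a
  refine ⟨2 * (μ + 5) * C + 2 * C + 512 * |a|, by positivity, fun e κ g k hg hk he hκ x => ?_⟩
  obtain ⟨h1, h2⟩ := hterm e κ g k hg hk he hκ x
  have hS := spiralData_of_inBall hμ hg hk he
  have h0 := (spiralWeight_pos x).le
  have hκ1 := hκ.one_le
  have hκ0 : 0 < κ := zero_lt_one.trans_le hκ1
  have hsq0 : 0 < √κ := Real.sqrt_pos.2 hκ0
  have hsqκ : √κ ≤ κ := by rw [Real.sqrt_le_left hκ0.le]; nlinarith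
  have n1 : freqRate μ a κ g k x ≠ 0 := hS.fullRate_ne_zero hκ x
  have n2 : freqRate μ (-a) κ g k x ≠ 0 := hS.fullRate_ne_zero hκ.neg x
  have l1 : ‖(freqRate μ a κ g k x)⁻¹‖ ≤ 16 / κ := by
    rw [norm_inv, ← inv_div]
    exact inv_anti₀ (by positivity) (hS.le_norm_fullRate hκ x)
  have l2 : ‖(freqRate μ (-a) κ g k x)⁻¹‖ ≤ 16 / κ := by
    rw [norm_inv, ← inv_div]
    exact inv_anti₀ (by positivity) (hS.le_norm_fullRate hκ.neg x)
  have u1 : ‖freqRate μ a κ g k x‖ ≤ κ * (μ + 5) := hS.norm_fullRate_le hκ x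
  have u2 : ‖freqRate μ (-a) κ g k x‖ ≤ κ * (μ + 5) := hS.norm_fullRate_le hκ.neg x
  have hq : spiralWeight x / freqRate μ a κ g k x - spiralWeight x / freqRate μ (-a) κ g k x =
      -2 * a * spiralWeight x ^ 2 * (freqRate μ a κ g k x)⁻¹ * (freqRate μ (-a) κ g k x)⁻¹ := by
    field_simp
    unfold freqRate
    push_cast
    ring
  have hqn : ‖(spiralWeight x / freqRate μ a κ g k x -
      spiralWeight x / freqRate μ (-a) κ g k x : ℂ)‖ ≤ 512 * |a| * spiralWeight x ^ 2 /
        (κ * √κ) := by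
    rw [hq, norm_mul, norm_mul, norm_mul, norm_mul, norm_pow, Complex.norm_real,
      Complex.norm_real, Real.norm_eq_abs, Real.norm_eq_abs, abs_of_nonneg h0]
    have : ‖(-2 : ℂ)‖ = 2 := by simp
    rw [this]
    calc _ ≤ 2 * |a| * spiralWeight x ^ 2 * (16 / κ) * (16 / κ) := by gcongr
      _ = 512 * |a| * spiralWeight x ^ 2 / (κ * κ) := by field_simp; ring
      _ ≤ _ := by gcongr
  constructor
  · have e1 : diffTerm μ a κ g k x =
        (innerTerm μ a κ g k x - spiralWeight x / freqRate μ a κ g k x) -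
        (outerTerm μ a κ g k x - spiralWeight x / freqRate μ (-a) κ g k x) +
        (spiralWeight x / freqRate μ a κ g k x - spiralWeight x / freqRate μ (-a) κ g k x) := by
      unfold diffTerm; ring
    rw [e1]
    refine (norm_add_le _ _).trans ((add_le_add ((norm_sub_le _ _).trans (add_le_add h1 h2))
      hqn).trans ?_)
    rw [← add_div, ← add_div, ← add_mul, ← add_mul]
    have : 0 ≤ (μ + 5) * C := by positivity
    refine div_le_div_of_nonneg_right (mul_le_mul_of_nonneg_right ?_ (by positivity))
      (by positivity)
    linarith
  · have e1 : derivTerm μ a κ g k x = freqRate μ a κ g k x *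
        (innerTerm μ a κ g k x - spiralWeight x / freqRate μ a κ g k x) +
        freqRate μ (-a) κ g k x *
        (outerTerm μ a κ g k x - spiralWeight x / freqRate μ (-a) κ g k x) := by
      unfold derivTerm
      rw [mul_sub, mul_sub, mul_div_cancel₀ _ n1, mul_div_cancel₀ _ n2]
      ring
    rw [e1]
    refine (norm_add_le _ _).trans ?_
    rw [norm_mul, norm_mul]
    have k1 := mul_le_mul u1 h1 (norm_nonneg _) (by positivity)
    have k2 := mul_le_mul u2 h2 (norm_nonneg _) (by positivity)
    refine (add_le_add k1 k2).trans ?_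
    calc _ = (2 * (μ + 5) * C) * spiralWeight x ^ 2 / √κ := by field_simp; ring
      _ ≤ _ := by
        gcongr
        have := abs_nonneg a
        linarith

end Terms


/-! ### Holomorphic dependence on the pair of profiles. -/

/-- A complex affine family of pairs in the ball. -/
structure AffineFamily (e R : ℝ) (g dg k dk : ℝ → ℂ) : Prop where
  pos : 0 < R
  le : e ≤ 1 / 1000
  fst : ∀ w ∈ Metric.ball (0 : ℂ) R, InBall e fun x => g x + w * dg x
  snd : ∀ w ∈ Metric.ball (0 : ℂ) R, InBall e fun x => k x + w * dk x
  dfst : ∃ d, InBall d dg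
  dsnd : ∃ d, InBall d dk

namespace AffineFamily

variable {e R μ a κ : ℝ} {g dg k dk : ℝ → ℂ}

/-- The coefficient Q is affine in w. Everything built from it is holomorphic because `k` is not
tied to the conjugate of `g`. -/
theorem differentiableOn_coeffQ (h : AffineFamily e R g dg k dk) (x : ℝ) :
    DifferentiableOn ℂ (fun w => coeffQ (fun x => g x + w * dg x) (fun x => k x + w * dk x) x)
      (Metric.ball 0 R) := by
  obtain ⟨d₁, hd₁⟩ := h.dfst
  obtain ⟨d₂, hd₂⟩ := h.dsnd
  have h1 := hd₁.mono (le_max_left d₁ d₂)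
  have h2 := hd₂.mono (le_max_right d₁ d₂)
  have hg0 : InBall e g := by simpa using h.fst 0 (Metric.mem_ball_self h.pos)
  have hk0 : InBall e k := by simpa using h.snd 0 (Metric.mem_ball_self h.pos)
  have heq : ∀ w : ℂ, coeffQ (fun x => g x + w * dg x) (fun x => k x + w * dk x) x =
      coeffQ g k x + w * (Complex.I * ∫ y in Ioi x, (dg y - dk y) * (1 - spiralWeight y)) := by
    intro w
    unfold coeffQ
    have : ∀ y, (g y + w * dg y - (k y + w * dk y)) * (1 - (spiralWeight y : ℂ)) =
        (g y - k y) * (1 - (spiralWeight y : ℂ)) +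
          w * ((dg y - dk y) * (1 - (spiralWeight y : ℂ))) := fun y => by ring
    simp only [this]
    rw [integral_add (integrableOn_coeff hg0 hk0 x)
      ((integrableOn_coeff h1 h2 x).const_mul w), integral_const_mul]
    ring
  simp only [heq]
  fun_prop

theorem differentiableOn_spiralRate (h : AffineFamily e R g dg k dk) (μ x : ℝ) :
    DifferentiableOn ℂ
      (fun w => spiralRate μ (fun x => g x + w * dg x) (fun x => k x + w * dk x) x)
      (Metric.ball 0 R) := by
  have hi := (h.differentiableOn_coeffQ x).inv fun w hw =>
    coeffQ_ne_zero (h.fst w hw) (h.snd w hw) h.le x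
  unfold spiralRate smoothRate roughRate
  have h1 : DifferentiableOn ℂ (fun w : ℂ => k x + w * dk x) (Metric.ball 0 R) := by fun_prop
  exact ((differentiableOn_const _).sub ((differentiableOn_const _).mul hi)).add
    (((differentiableOn_const _).mul h1).mul hi)

theorem differentiableOn_ratePrim (hμ : 1 / 2 < μ) (h : AffineFamily e R g dg k dk) (x : ℝ) :
    DifferentiableOn ℂ
      (fun w => ratePrim μ (fun x => g x + w * dg x) (fun x => k x + w * dk x) x)
      (Metric.ball 0 R) := by
  unfold ratePrim
  simp only [intervalIntegral.intervalIntegral_eq_integral_uIoc]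
  refine DifferentiableOn.const_smul (differentiableOn_integral_of_dominated
    (b := fun _ => μ + 4) (fun w hw => ?_) (ae_of_all _ fun y => h.differentiableOn_spiralRate μ y)
    (ae_of_all _ fun y w hw => norm_spiralRate_le hμ (h.fst w hw) (h.snd w hw) h.le y) ?_) _
  · exact (continuous_spiralRate hμ (h.fst w hw) (h.snd w hw) h.le).aestronglyMeasurable
  · exact integrableOn_const (by simp [uIoc])

theorem differentiableOn_freqPrim (hμ : 1 / 2 < μ) (h : AffineFamily e R g dg k dk)
    (α κ x : ℝ) : DifferentiableOn ℂ
      (fun w => freqPrim μ α κ (fun x => g x + w * dg x) (fun x => k x + w * dk x) x)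
      (Metric.ball 0 R) :=
  ((differentiableOn_const _).mul (h.differentiableOn_ratePrim hμ x)).add
    (differentiableOn_const _)

theorem differentiableOn_freqRate (h : AffineFamily e R g dg k dk) (μ α κ x : ℝ) :
    DifferentiableOn ℂ
      (fun w => freqRate μ α κ (fun x => g x + w * dg x) (fun x => k x + w * dk x) x)
      (Metric.ball 0 R) :=
  ((differentiableOn_const _).mul (h.differentiableOn_spiralRate μ x)).add
    (differentiableOn_const _)

theorem differentiableOn_innerTerm (hμ : 1 / 2 < μ) (h : AffineFamily e R g dg k dk)
    (hκ : LargeFreq μ a κ) (x : ℝ) : DifferentiableOn ℂ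
      (fun w => innerTerm μ a κ (fun x => g x + w * dg x) (fun x => k x + w * dk x) x)
      (Metric.ball 0 R) := by
  unfold innerTerm fwdInt
  have hk : 2 * ((0 : ℕ) : ℝ) < κ * μ / 4 := by have := hκ.lt_mul; push_cast; linarith
  refine differentiableOn_integral_of_dominated
    (b := fun y => 1 * (spiralWeight y ^ (0 + 1) *
      Real.exp ((κ * μ / 4) * (spiralLog x - spiralLog y)))) (fun w hw => ?_)
    (ae_of_all _ fun y => ?_) ?_
    ((slowWeight_spiralWeight.integrableOn_and_integral_le 0 hk x).1.const_mul 1)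
  · exact (integrableOn_inner hμ (h.fst w hw) (h.snd w hw) h.le hκ x).aestronglyMeasurable
  · exact (differentiableOn_const _).mul ((h.differentiableOn_freqPrim hμ a κ x).sub
      (h.differentiableOn_freqPrim hμ a κ y)).cexp
  · filter_upwards [ae_restrict_mem measurableSet_Ioi] with y hy w hw
    refine DecayRate.norm_mul_exp_le slowWeight_spiralWeight
      (decayRate_freq hμ (h.fst w hw) (h.snd w hw) h.le hκ)
      (F := fun y => (spiralWeight y : ℂ)) (fun z => ?_) (le_of_lt hy)
    rw [Complex.norm_real, Real.norm_eq_abs, abs_of_pos (spiralWeight_pos _)]; simp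

theorem differentiableOn_outerTerm (hμ : 1 / 2 < μ) (h : AffineFamily e R g dg k dk)
    (hκ : LargeFreq μ a κ) (x : ℝ) : DifferentiableOn ℂ
      (fun w => outerTerm μ a κ (fun x => g x + w * dg x) (fun x => k x + w * dk x) x)
      (Metric.ball 0 R) := by
  unfold outerTerm fwdInt
  have hk : 2 * ((0 : ℕ) : ℝ) < κ * μ / 4 := by have := hκ.lt_mul; push_cast; linarith
  have h0 := Metric.mem_ball_self (x := (0 : ℂ)) h.pos
  have hw := (spiralData_mirror hμ (h.fst 0 h0) (h.snd 0 h0) h.le).weight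
  refine differentiableOn_integral_of_dominated
    (b := fun y => 1 * (spiralWeight (-y) ^ (0 + 1) *
      Real.exp ((κ * μ / 4) * (-spiralLog (- -x) - -spiralLog (-y))))) (fun w hw => ?_)
    (ae_of_all _ fun y => ?_) ?_
    ((hw.integrableOn_and_integral_le 0 hk (-x)).1.const_mul 1)
  · exact (integrableOn_outer hμ (h.fst w hw) (h.snd w hw) h.le hκ (-x)).aestronglyMeasurable
  · exact (differentiableOn_const _).mul (((h.differentiableOn_freqPrim hμ (-a) κ _).neg).sub
      (h.differentiableOn_freqPrim hμ (-a) κ _).neg).cexp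
  · filter_upwards [ae_restrict_mem measurableSet_Ioi] with y hy w hw'
    refine DecayRate.norm_mul_exp_le hw
      (decayRate_freq_mirror hμ (h.fst w hw') (h.snd w hw') h.le hκ)
      (F := fun y => (spiralWeight (-y) : ℂ)) (fun z => ?_) (le_of_lt hy)
    rw [Complex.norm_real, Real.norm_eq_abs, abs_of_pos (spiralWeight_pos _)]; simp

end AffineFamily

/-- Boundedness of a holomorphic family on a disc of radius `R` gives a Lipschitz bound. -/
theorem norm_sub_le_of_differentiableOn {f : ℂ → ℂ} {R B : ℝ} (hR : 1 < R)
    (hf : DifferentiableOn ℂ f (Metric.ball 0 R)) (hB : ∀ w ∈ Metric.ball (0 : ℂ) R, ‖f w‖ ≤ B) :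
    ‖f 1 - f 0‖ ≤ 2 * B / R := by
  have h0 : (0 : ℂ) ∈ Metric.ball (0 : ℂ) R := Metric.mem_ball_self (by linarith)
  have h := Complex.dist_le_div_mul_dist_of_mapsTo_ball (z := 1) (R₂ := 2 * B) hf (fun w hw => by
    rw [Metric.mem_closedBall, dist_eq_norm]
    exact (norm_sub_le _ _).trans (by linarith [hB w hw, hB 0 h0])) (by simpa using hR)
  simpa [dist_eq_norm] using h

/-- The line w ↦ (g + w dg, k + w dk) stays in the ball of radius 1/1000 for |w| < R with R of order
1/δ. A function holomorphic and bounded by B there changes by at most 2B/R between w = 0 and w = 1.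
-/
theorem exists_norm_diffTerm_sub_le {μ : ℝ} (hμ : 1 / 2 < μ) (a : ℝ) : ∃ C : ℝ, 0 ≤ C ∧
    ∀ (δ κ : ℝ) (g k dg dk : ℝ → ℂ), InBall (1 / 2000) g → InBall (1 / 2000) k →
      InBall (1 / 2000) (fun x => g x + dg x) → InBall (1 / 2000) (fun x => k x + dk x) →
      InBall δ dg → InBall δ dk → LargeFreq μ a κ → ∀ x,
      ‖diffTerm μ a κ (fun x => g x + dg x) (fun x => k x + dk x) x - diffTerm μ a κ g k x‖ ≤
        C * δ * spiralWeight x ^ 2 / (κ * √κ) ∧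
      ‖derivTerm μ a κ (fun x => g x + dg x) (fun x => k x + dk x) x - derivTerm μ a κ g k x‖ ≤
        C * δ * spiralWeight x ^ 2 / √κ := by
  obtain ⟨C, hC, hbd⟩ := exists_norm_diffTerm_le hμ a
  refine ⟨4000 * C, by positivity, fun δ κ g k dg dk hg hk hg' hk' hdg hdk hκ x => ?_⟩
  have hκ0 : 0 < κ := zero_lt_one.trans_le hκ.one_le
  have hsq0 : 0 < √κ := Real.sqrt_pos.2 hκ0
  have h0 := (spiralWeight_pos x).le
  have hδ0 := hdg.nonneg
  rcases le_or_gt (1 / 2000) δ with hδ | hδ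
  -- If δ is not small, the sup bounds alone suffice.
  · obtain ⟨b1, b2⟩ := hbd _ κ g k hg hk (by norm_num) hκ x
    obtain ⟨b3, b4⟩ := hbd _ κ _ _ hg' hk' (by norm_num) hκ x
    have key : ∀ D : ℝ, 0 < D → 2 * (C * spiralWeight x ^ 2 / D) ≤
        4000 * C * δ * spiralWeight x ^ 2 / D := by
      intro D hD
      have h1 : 0 ≤ C * spiralWeight x ^ 2 / D := by positivity
      calc 2 * (C * spiralWeight x ^ 2 / D) ≤ (4000 * δ) * (C * spiralWeight x ^ 2 / D) :=
            mul_le_mul_of_nonneg_right (by linarith) h1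
        _ = _ := by ring
    constructor
    · refine (norm_sub_le _ _).trans ((add_le_add b3 b1).trans ?_)
      have := key (κ * √κ) (by positivity)
      linarith
    · refine (norm_sub_le _ _).trans ((add_le_add b4 b2).trans ?_)
      have := key √κ hsq0
      linarith
  · have main : ∀ δ', 0 < δ' → δ ≤ δ' → δ' < 1 / 2000 →
        ‖diffTerm μ a κ (fun x => g x + dg x) (fun x => k x + dk x) x - diffTerm μ a κ g k x‖ ≤
          4000 * C * δ' * spiralWeight x ^ 2 / (κ * √κ) ∧
        ‖derivTerm μ a κ (fun x => g x + dg x) (fun x => k x + dk x) x -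
          derivTerm μ a κ g k x‖ ≤ 4000 * C * δ' * spiralWeight x ^ 2 / √κ := by
      intro δ' hδ' hle hlt
      -- With this radius w dg has size at most 1/2000, which is exactly the room between the balls
      -- of radius 1/2000 and 1/1000.
      set R : ℝ := 1 / (2000 * δ') with hR
      have hR1 : 1 < R := by
        rw [hR, lt_div_iff₀ (by positivity)]; linarith
      have hball : ∀ f df : ℝ → ℂ, InBall (1 / 2000) f → InBall δ df →
          ∀ w ∈ Metric.ball (0 : ℂ) R, InBall (1 / 1000) fun x => f x + w * df x := by
        intro f df hf hdf w hw
        refine (hf.add (hdf.const_mul w)).mono ?_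
        rw [mem_ball_zero_iff] at hw
        have : ‖w‖ * δ ≤ R * δ' := mul_le_mul hw.le hle hδ0 (by positivity)
        have h2 : R * δ' = 1 / 2000 := by rw [hR]; field_simp
        linarith
      have hfam : AffineFamily (1 / 1000) R g dg k dk :=
        ⟨by positivity, le_rfl, hball g dg hg hdg, hball k dk hk hdk, ⟨δ, hdg⟩, ⟨δ, hdk⟩⟩
      have hi := hfam.differentiableOn_innerTerm hμ hκ x
      have ho := hfam.differentiableOn_outerTerm hμ hκ x
      have hp := hfam.differentiableOn_freqRate μ a κ x
      have hm := hfam.differentiableOn_freqRate μ (-a) κ x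
      have hall := fun w hw => hbd _ κ _ _ (hfam.fst w hw) (hfam.snd w hw) le_rfl hκ x
      have hD := norm_sub_le_of_differentiableOn hR1 (hi.sub ho) fun w hw => (hall w hw).1
      have hE := norm_sub_le_of_differentiableOn hR1
        (((hp.mul hi).add (hm.mul ho)).sub (differentiableOn_const (2 * (spiralWeight x : ℂ))))
        fun w hw => (hall w hw).2
      have e0 : ∀ D : ℝ, 2 * (C * spiralWeight x ^ 2 / D) / R =
          4000 * C * δ' * spiralWeight x ^ 2 / D := by
        intro D; rw [hR]; field_simp; ring
      rw [e0] at hD hE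
      simp only [Pi.sub_apply, Pi.add_apply, Pi.mul_apply, one_mul, zero_mul, add_zero] at hD hE
      exact ⟨hD, hE⟩
    -- For δ = 0 any radius is admissible, and the bound follows by letting δ' tend to 0.
    rcases hδ0.eq_or_lt with h | h
    · have hcl : ∀ {X D : ℝ}, (∀ δ', 0 < δ' → δ' < 1 / 2000 →
          X ≤ 4000 * C * δ' * spiralWeight x ^ 2 / D) →
          X ≤ 4000 * C * δ * spiralWeight x ^ 2 / D := by
        intro X D hX
        have ht : Tendsto (fun δ' : ℝ => 4000 * C * δ' * spiralWeight x ^ 2 / D) (𝓝[>] 0)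
            (𝓝 (4000 * C * 0 * spiralWeight x ^ 2 / D)) :=
          (Continuous.tendsto (by fun_prop) 0).mono_left nhdsWithin_le_nhds
        rw [← h]
        refine ge_of_tendsto ht ?_
        filter_upwards [Ioo_mem_nhdsGT (by norm_num : (0 : ℝ) < 1 / 2000)] with δ' hδ'
        exact hX δ' hδ'.1 hδ'.2
      exact ⟨hcl fun δ' h1 h2 => (main δ' h1 (by rw [← h]; exact h1.le) h2).1,
        hcl fun δ' h1 h2 => (main δ' h1 (by rw [← h]; exact h1.le) h2).2⟩
    · exact main δ h le_rfl hδ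


/-! ### Summation over the frequencies. -/

/-- The terms `n ^ (-3/2) * min 1 (n d)`, shifted to start at `n = 1`. -/
noncomputable def holderTerm (d : ℝ) (n : ℕ) : ℝ :=
  min (1 / (((n : ℝ) + 1) * √((n : ℝ) + 1))) (d / √((n : ℝ) + 1))

theorem holderTerm_nonneg {d : ℝ} (hd : 0 ≤ d) (n : ℕ) : 0 ≤ holderTerm d n :=
  le_min (by positivity) (by positivity)

/-- The sum of min(N^{-3/2}, d N^{-1/2}) is controlled by comparison with the increments of
√(nd)/(1+√(nd)). This function stays below 1, so the telescoping sum is at most 8√d. -/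
theorem holderTerm_le_sub {d : ℝ} (hd : 0 < d) (n : ℕ) :
    holderTerm d n ≤ 8 * √d * (√((n + 1 : ℕ) * d) / (1 + √((n + 1 : ℕ) * d)) -
      √(n * d) / (1 + √(n * d))) := by
  set N : ℝ := (n : ℝ) + 1 with hN
  have hN0 : 0 < N := by positivity
  have hcast : ((n + 1 : ℕ) : ℝ) = N := by push_cast; rfl
  have hn : (n : ℝ) = N - 1 := by rw [hN]; ring
  set s := √N with hs
  set q := √d with hq
  have hs0 : 0 < s := Real.sqrt_pos.2 hN0
  have hq0 : 0 < q := Real.sqrt_pos.2 hd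
  have hss : s * s = N := Real.mul_self_sqrt hN0.le
  have hqq : q * q = d := Real.mul_self_sqrt hd.le
  have e1 : √(N * d) = s * q := Real.sqrt_mul hN0.le d
  set r := √(n : ℝ) with hr
  have hr0 : 0 ≤ r := Real.sqrt_nonneg _
  have hrr : r * r = N - 1 := by rw [hr, Real.mul_self_sqrt (Nat.cast_nonneg n), hn]
  have e2 : √((n : ℝ) * d) = r * q := Real.sqrt_mul (Nat.cast_nonneg n) d
  have hrs : r ≤ s := by nlinarith
  rw [hcast, e1, e2]
  have e3 : s * q / (1 + s * q) - r * q / (1 + r * q) =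
      q * (s - r) / ((1 + s * q) * (1 + r * q)) := by
    field_simp
    ring
  have e4 : s - r = 1 / (s + r) := by
    rw [eq_div_iff (by positivity)]
    nlinarith
  have e5 : 1 / (2 * s) ≤ s - r := by
    rw [e4]; gcongr; linarith
  have e6 : (1 + s * q) * (1 + r * q) ≤ 2 * (1 + N * d) := by
    have h1 : (1 + s * q) * (1 + r * q) ≤ (1 + s * q) * (1 + s * q) := by gcongr
    have h2 : (s * q) * (s * q) = N * d := by rw [← hss, ← hqq]; ring
    nlinarith [sq_nonneg (s * q - 1)]
  have e7 : q * (1 / (2 * s)) / (2 * (1 + N * d)) ≤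
      q * (s - r) / ((1 + s * q) * (1 + r * q)) := by gcongr
  have e8 : holderTerm d n ≤ 2 * d / (s * (1 + N * d)) := by
    unfold holderTerm
    rw [← hN, ← hs]
    rcases le_total (N * d) 1 with h | h
    · refine (min_le_right _ _).trans ?_
      rw [div_le_div_iff₀ hs0 (by positivity)]
      have : 0 ≤ d * s := by positivity
      nlinarith
    · refine (min_le_left _ _).trans ?_
      rw [div_le_div_iff₀ (by positivity) (by positivity)]
      nlinarith
  calc _ ≤ _ := e8
    _ = 8 * q * (q * (1 / (2 * s)) / (2 * (1 + N * d))) := by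
        rw [← hqq]; field_simp; ring
    _ ≤ 8 * q * (q * (s - r) / ((1 + s * q) * (1 + r * q))) := by gcongr
    _ = _ := by rw [e3]

theorem sum_holderTerm_le {d : ℝ} (hd : 0 < d) (N : ℕ) :
    ∑ n ∈ Finset.range N, holderTerm d n ≤ 8 * √d := by
  refine (Finset.sum_le_sum fun n _ => holderTerm_le_sub hd n).trans ?_
  rw [← Finset.mul_sum,
    Finset.sum_range_sub (fun n : ℕ => √((n : ℕ) * d) / (1 + √((n : ℕ) * d))) N]
  have : √((N : ℕ) * d) / (1 + √((N : ℕ) * d)) ≤ 1 := by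
    rw [div_le_one (by positivity)]; linarith
  have h0 : 0 ≤ 8 * √d := by positivity
  simp only [Nat.cast_zero, zero_mul, Real.sqrt_zero, zero_div, sub_zero]
  nlinarith

theorem summable_holderTerm {d : ℝ} (hd : 0 < d) : Summable (holderTerm d) :=
  summable_of_sum_range_le (holderTerm_nonneg hd.le) (sum_holderTerm_le hd)

theorem tsum_holderTerm_le {d : ℝ} (hd : 0 < d) : ∑' n, holderTerm d n ≤ 8 * √d :=
  Real.tsum_le_of_sum_range_le (holderTerm_nonneg hd.le) (sum_holderTerm_le hd)

/-- A factor 1/m is given away here, so that the sup bound and the Hölder bound carry the same power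
m^{-1/2}. -/
theorem inv_mul_sqrt_le {m : ℝ} (hm : 1 ≤ m) (n : ℕ) :
    1 / ((((n : ℝ) + 1) * m) * √(((n : ℝ) + 1) * m)) ≤ 1 / √m * holderTerm 1 n := by
  have hm0 : 0 < m := by linarith
  have h1 : 1 ≤ (n : ℝ) + 1 := by have : (0:ℝ) ≤ n := n.cast_nonneg; linarith
  have e : holderTerm 1 n = 1 / (((n : ℝ) + 1) * √((n : ℝ) + 1)) := by
    unfold holderTerm
    refine min_eq_left ?_
    gcongr
    exact le_mul_of_one_le_left (by positivity) h1
  rw [e, Real.sqrt_mul (by positivity), div_mul_div_comm, one_mul]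
  have : 0 < √m := Real.sqrt_pos.2 hm0
  have : 0 < √((n : ℝ) + 1) := Real.sqrt_pos.2 (by linarith)
  refine one_div_le_one_div_of_le (by positivity) ?_
  have h3 : 0 ≤ ((n : ℝ) + 1) * √((n : ℝ) + 1) * √m := by positivity
  nlinarith

/-- Bounds of order `κ ^ (-3/2)` for the terms and `κ ^ (-1/2)` for their derivatives put a
series over the frequencies `κ = m, 2 m, 3 m, …` into a small Hölder ball. -/
theorem inBall_tsum {m B : ℝ} (hm : 1 ≤ m) (hB : 0 ≤ B) {D D' : ℕ → ℝ → ℂ}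
    (hD : ∀ n x, HasDerivAt (D n) (D' n x) x)
    (h0 : ∀ n x, ‖D n x‖ ≤
      B * spiralWeight x ^ 2 / ((((n : ℝ) + 1) * m) * √(((n : ℝ) + 1) * m)))
    (h1 : ∀ n x, ‖D' n x‖ ≤ B * spiralWeight x ^ 2 / √(((n : ℝ) + 1) * m)) :
    (∀ x, Summable fun n => ‖D n x‖) ∧ InBall (80 * B / √m) fun x => ∑' n, D n x := by
  have hm0 : 0 < m := by linarith
  have hsm : 0 < √m := Real.sqrt_pos.2 hm0
  have hb : ∀ n x, ‖D n x‖ ≤ B * spiralWeight x ^ 2 / √m * holderTerm 1 n := by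
    intro n x
    refine (h0 n x).trans ?_
    calc _ = B * spiralWeight x ^ 2 * (1 / ((((n : ℝ) + 1) * m) * √(((n : ℝ) + 1) * m))) := by
          ring
      _ ≤ B * spiralWeight x ^ 2 * (1 / √m * holderTerm 1 n) := by
          gcongr; exact inv_mul_sqrt_le hm n
      _ = _ := by ring
  have hsum : ∀ x, Summable fun n => ‖D n x‖ := fun x =>
    Summable.of_nonneg_of_le (fun n => norm_nonneg _) (fun n => hb n x)
      ((summable_holderTerm one_pos).mul_left _)
  refine ⟨hsum, fun x => ?_, fun x y hxy => ?_⟩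
  · refine (norm_tsum_le_tsum_norm (hsum x)).trans (((hsum x).tsum_le_tsum (fun n => hb n x)
      ((summable_holderTerm one_pos).mul_left _)).trans ?_)
    rw [tsum_mul_left]
    have h8 := tsum_holderTerm_le one_pos
    rw [Real.sqrt_one, mul_one] at h8
    calc _ ≤ B * spiralWeight x ^ 2 / √m * 8 := by gcongr
      _ ≤ B * spiralWeight x ^ 2 / √m * 80 := by gcongr; norm_num
      _ = _ := by ring
  · rcases eq_or_ne x y with rfl | hne
    · simp
    have hd : 0 < |x - y| := abs_pos.2 (sub_ne_zero.2 hne)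
    -- Weights at distance at most one differ by a factor 3, so their squares differ by a factor 9.
    have hw : ∀ z, |x - z| ≤ 1 → spiralWeight z ^ 2 ≤ 9 * spiralWeight x ^ 2 := by
      intro z hz
      have := slowWeight_spiralWeight.le_three_mul hz
      have h0 := (spiralWeight_pos z).le
      nlinarith
    have hlip : ∀ n, ‖D n x - D n y‖ ≤
        9 * B * spiralWeight x ^ 2 / √(((n : ℝ) + 1) * m) * |x - y| := by
      intro n
      have hconv : Convex ℝ (Metric.closedBall x |x - y|) := convex_closedBall _ _
      refine hconv.norm_image_sub_le_of_norm_hasDerivWithin_le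
        (fun z _ => (hD n z).hasDerivWithinAt) (fun z hz => (h1 n z).trans ?_) (x := y) ?_ ?_
      · rw [Metric.mem_closedBall, dist_comm, Real.dist_eq] at hz
        have := hw z (hz.trans hxy)
        have e : 9 * B * spiralWeight x ^ 2 = B * (9 * spiralWeight x ^ 2) := by ring
        rw [e]
        gcongr
      · rw [Metric.mem_closedBall, dist_comm, Real.dist_eq]
      · exact Metric.mem_closedBall_self hd.le
    -- The sup bounds at the two points give 10 = 1 + 9, and the mean value theorem gives 9; the
    -- smaller of the two is a `holderTerm`.
    have hbd : ∀ n, ‖D n x - D n y‖ ≤ 10 * B * spiralWeight x ^ 2 / √m * holderTerm |x - y| n := by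
      intro n
      have hA : 0 ≤ B * spiralWeight x ^ 2 / √m := by positivity
      have e10 : 10 * B * spiralWeight x ^ 2 / √m = 10 * (B * spiralWeight x ^ 2 / √m) := by ring
      have hmin : ∀ {X A u v : ℝ}, X ≤ A * u → X ≤ A * v → X ≤ A * min u v := by
        intro X A u v h h'
        rcases min_choice u v with e | e <;> rw [e] <;> assumption
      refine hmin ?_ ?_
      · have hmon : holderTerm 1 n ≤ 1 / (((n : ℝ) + 1) * √((n : ℝ) + 1)) := min_le_left _ _
        have hy : ‖D n y‖ ≤ 9 * (B * spiralWeight x ^ 2 / √m) * holderTerm 1 n := by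
          refine (hb n y).trans (mul_le_mul_of_nonneg_right ?_
            (holderTerm_nonneg zero_le_one n))
          calc _ ≤ B * (9 * spiralWeight x ^ 2) / √m := by gcongr; exact hw y hxy
            _ = _ := by ring
        calc _ ≤ ‖D n x‖ + ‖D n y‖ := norm_sub_le _ _
          _ ≤ _ := add_le_add (hb n x) hy
          _ = 10 * B * spiralWeight x ^ 2 / √m * holderTerm 1 n := by ring
          _ ≤ _ := by gcongr
      · refine (hlip n).trans ?_
        rw [Real.sqrt_mul (by positivity)]
        have : 0 < √((n : ℝ) + 1) := Real.sqrt_pos.2 (by positivity)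
        calc _ = 9 * (B * spiralWeight x ^ 2 / √m * (|x - y| / √((n : ℝ) + 1))) := by
              field_simp
          _ ≤ 10 * (B * spiralWeight x ^ 2 / √m * (|x - y| / √((n : ℝ) + 1))) := by
              gcongr; norm_num
          _ = _ := by ring
    have hs1 : Summable fun n => D n x := (hsum x).of_norm
    have hs2 : Summable fun n => D n y := (hsum y).of_norm
    have hsH := (summable_holderTerm hd).mul_left (10 * B * spiralWeight x ^ 2 / √m)
    have hsn : Summable fun n => ‖D n x - D n y‖ :=
      Summable.of_nonneg_of_le (fun n => norm_nonneg _) hbd hsH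
    rw [← hs1.tsum_sub hs2]
    refine (norm_tsum_le_tsum_norm hsn).trans ((hsn.tsum_le_tsum hbd hsH).trans ?_)
    rw [tsum_mul_left]
    calc _ ≤ 10 * B * spiralWeight x ^ 2 / √m * (8 * √|x - y|) := by
          gcongr; exact tsum_holderTerm_le hd
      _ = _ := by ring

theorem InBall.of_tendsto {e : ℝ} {u : ℕ → ℝ → ℂ} {f : ℝ → ℂ} (hu : ∀ᶠ j in atTop, InBall e (u j))
    (h : ∀ x, Tendsto (fun j => u j x) atTop (𝓝 (f x))) : InBall e f := by
  refine ⟨fun x => le_of_tendsto (h x).norm (hu.mono fun j hj => hj.norm_le x),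
    fun x y hxy => le_of_tendsto ((h x).sub (h y)).norm (hu.mono fun j hj => hj.norm_sub_le x y hxy)⟩

theorem InBall.zero {e : ℝ} (he : 0 ≤ e) : InBall e fun _ => 0 :=
  ⟨fun x => by simp only [norm_zero]; positivity,
    fun x y _ => by simp only [sub_self, norm_zero]; positivity⟩

/-! ### The fixed point. -/

/-- The contraction principle in a Hölder ball. -/
theorem exists_fixedPoint {e : ℝ} (he : 0 ≤ e) {G : (ℝ → ℂ) → ℝ → ℂ}
    (hmap : ∀ g, InBall e g → InBall e (G g))
    (hcon : ∀ δ g g', InBall e g → InBall e g' → InBall δ (fun x => g' x - g x) →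
      InBall (δ / 2) (fun x => G g' x - G g x)) : ∃ g, InBall e g ∧ G g = g := by
  set u : ℕ → ℝ → ℂ := fun j => G^[j] fun _ => 0 with hu
  have hsucc : ∀ j, u (j + 1) = G (u j) := fun j => Function.iterate_succ_apply' G j _
  have hball : ∀ j, InBall e (u j) := by
    intro j
    induction j with
    | zero => exact InBall.zero he
    | succ j ih => rw [hsucc]; exact hmap _ ih
  have hstep : ∀ j, InBall (e / 2 / 2 ^ j * 2) (fun x => u (j + 1) x - u j x) := by
    intro j
    induction j with
    | zero =>
      have : (fun x => u (0 + 1) x - u 0 x) = u 1 := by funext x; simp [hu]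
      rw [this]
      exact (hball 1).mono (by simp)
    | succ j ih =>
      have e1 : (fun x => u (j + 1 + 1) x - u (j + 1) x) = fun x => G (u (j + 1)) x - G (u j) x :=
        funext fun x => congrArg₂ (· - ·) (congrFun (hsucc (j + 1)) x) (congrFun (hsucc j) x)
      rw [e1]
      have := hcon _ _ _ (hball j) (hball (j + 1)) ih
      refine this.mono (le_of_eq ?_)
      rw [pow_succ]; field_simp
  -- Balls rather than a metric carry the geometric series; its tail survives the pointwise limit
  -- through `InBall.of_tendsto`.
  have htail : ∀ j i, InBall (2 * e / 2 ^ j * (1 - 1 / 2 ^ i)) (fun x => u (j + i) x - u j x) := by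
    intro j i
    induction i with
    | zero => simpa using InBall.zero le_rfl
    | succ i ih =>
      have := ih.add (hstep (j + i))
      have e1 : (fun x => u (j + i) x - u j x + (u (j + i + 1) x - u (j + i) x)) =
          fun x => u (j + (i + 1)) x - u j x := by funext x; rw [← add_assoc]; ring
      rw [e1] at this
      refine this.mono (le_of_eq ?_)
      rw [pow_add, pow_succ]; field_simp; ring
  have hlim : ∀ x, ∃ l, Tendsto (fun j => u j x) atTop (𝓝 l) := by
    intro x
    refine cauchySeq_tendsto_of_complete (cauchySeq_of_le_geometric_two (C := 2 * e) fun j => ?_)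
    rw [dist_comm, dist_eq_norm]
    refine ((hstep j).norm_le x).trans ?_
    have h2 : spiralWeight x ^ 2 ≤ 1 := pow_le_one₀ (spiralWeight_pos x).le (spiralWeight_le_one x)
    calc _ ≤ e / 2 / 2 ^ j * 2 * 1 := by gcongr
      _ = _ := by ring
  choose g hg using hlim
  have hgb : InBall e g := InBall.of_tendsto (Eventually.of_forall hball) hg
  have hgj : ∀ j, InBall (2 * e / 2 ^ j) (fun x => g x - u j x) := by
    intro j
    refine InBall.of_tendsto (u := fun i x => u (j + i) x - u j x)
      (Eventually.of_forall fun i => (htail j i).mono ?_) fun x => ?_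
    · refine mul_le_of_le_one_right (by positivity) ?_
      have : (0:ℝ) ≤ 1 / 2 ^ i := by positivity
      linarith
    · refine Tendsto.sub_const ?_ _
      simp_rw [add_comm j]
      exact (tendsto_add_atTop_iff_nat j).2 (hg x)
  refine ⟨g, hgb, funext fun x => ?_⟩
  have h1 : Tendsto (fun j => G g x - u (j + 1) x) atTop (𝓝 0) := by
    refine squeeze_zero_norm (a := fun j => (2 * e) / 2 ^ j) (fun j => ?_) ?_
    · rw [hsucc]
      refine ((hcon _ _ _ (hball j) hgb (hgj j)).norm_le x).trans ?_
      have h2 : spiralWeight x ^ 2 ≤ 1 :=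
        pow_le_one₀ (spiralWeight_pos x).le (spiralWeight_le_one x)
      have h3 : 0 ≤ 2 * e / 2 ^ j := by positivity
      nlinarith
    · simpa [div_eq_mul_inv] using (tendsto_inv_atTop_zero.comp
        (tendsto_pow_atTop_atTop_of_one_lt (one_lt_two (α := ℝ)))).const_mul (2 * e)
  have h2 : Tendsto (fun j => G g x - u (j + 1) x) atTop (𝓝 (G g x - g x)) :=
    ((tendsto_add_atTop_iff_nat 1).2 (hg x)).const_sub _
  exact sub_eq_zero.1 (tendsto_nhds_unique h2 h1)

theorem LargeFreq.mono {μ α κ κ' : ℝ} (h : LargeFreq μ α κ) (hμ : 0 ≤ μ) (hle : κ ≤ κ') :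
    LargeFreq μ α κ' := by
  have := mul_le_mul_of_nonneg_right hle hμ
  exact ⟨h.one_le.trans hle, h.lt_mul.trans_le this, h.abs_le.trans hle, h.abs_le_mul.trans this⟩

theorem exists_largeFreq {μ : ℝ} (hμ : 0 < μ) (α : ℝ) : ∃ κ, LargeFreq μ α κ := by
  refine ⟨1 + 25 / μ + 16 * |α| + 4 * |α| / μ, ?_, ?_, ?_, ?_⟩
  · have : 0 ≤ 25 / μ + 16 * |α| + 4 * |α| / μ := by positivity
    linarith
  · have : (1 + 25 / μ + 16 * |α| + 4 * |α| / μ) * μ = μ + 25 + 16 * |α| * μ + 4 * |α| := by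
      field_simp
    rw [this]
    have : 0 ≤ 16 * |α| * μ + 4 * |α| := by positivity
    linarith
  · have : 0 ≤ 1 + 25 / μ + 4 * |α| / μ := by positivity
    linarith
  · have : (1 + 25 / μ + 16 * |α| + 4 * |α| / μ) * μ = μ + 25 + 16 * |α| * μ + 4 * |α| := by
      field_simp
    rw [this]
    have : 0 ≤ 16 * |α| * μ := by positivity
    linarith

/-- The profile equation has a solution for every large number of branches. -/
theorem exists_profile {μ : ℝ} (hμ : 1 / 2 < μ) (a : ℝ) : ∃ M : ℝ, ∀ m : ℝ, M ≤ m →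
    LargeFreq μ a m ∧ ∃ g : ℝ → ℂ, InBall (1 / 2000) g ∧ ∀ x, HasSum (fun n : ℕ =>
      a * diffTerm μ a (((n : ℝ) + 1) * m) g (fun y => (starRingEnd ℂ) (g y)) x) (g x) := by
  obtain ⟨C₁, hC₁, hb⟩ := exists_norm_diffTerm_le hμ a
  obtain ⟨C₂, hC₂, hd⟩ := exists_norm_diffTerm_sub_le hμ a
  obtain ⟨κ, hκ⟩ := exists_largeFreq (by linarith : 0 < μ) a
  -- The self-map needs 80 |a| C₁ / √m ≤ 1/2000, the contraction needs 80 |a| C₂ / √m ≤ 1/2; hence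
  -- 160000 = 80 · 2000 and 160 = 80 · 2.
  set A := 160000 * (|a| * C₁) + 160 * (|a| * C₂) with hA
  have hA0 : 0 ≤ A := by positivity
  refine ⟨max κ ((A + 1) ^ 2), fun m hm => ?_⟩
  have hLm := hκ.mono (by linarith) ((le_max_left _ _).trans hm)
  have hm1 := hLm.one_le
  have hm0 : 0 < m := by linarith
  have hAm : A + 1 ≤ √m := Real.le_sqrt_of_sq_le ((le_max_right _ _).trans hm)
  have hsm : 0 < √m := by linarith
  have hL : ∀ n : ℕ, LargeFreq μ a (((n : ℝ) + 1) * m) := fun n =>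
    hLm.mono (by linarith) (le_mul_of_one_le_left hm0.le (by
      have : (0 : ℝ) ≤ n := n.cast_nonneg
      linarith))
  have hself : ∀ g, InBall (1 / 2000) g → (∀ x, Summable fun n : ℕ =>
      ‖(a : ℂ) * diffTerm μ a (((n : ℝ) + 1) * m) g (fun y => (starRingEnd ℂ) (g y)) x‖) ∧
      InBall (1 / 2000) fun x => ∑' n : ℕ,
      (a : ℂ) * diffTerm μ a (((n : ℝ) + 1) * m) g (fun y => (starRingEnd ℂ) (g y)) x := by
    intro g hg
    have hbn := fun (n : ℕ) x => hb _ _ g _ hg hg.conj (by norm_num) (hL n) x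
    have h := inBall_tsum (B := |a| * C₁) hm1 (by positivity)
      (D := fun (n : ℕ) x => (a : ℂ) * diffTerm μ a (((n : ℝ) + 1) * m) g
        (fun y => (starRingEnd ℂ) (g y)) x)
      (D' := fun (n : ℕ) x => (a : ℂ) * derivTerm μ a (((n : ℝ) + 1) * m) g
        (fun y => (starRingEnd ℂ) (g y)) x)
      (fun n x => (hasDerivAt_diffTerm hμ hg hg.conj (by norm_num) (hL n) x).const_mul _)
      (fun n x => by
        rw [norm_mul, Complex.norm_real, Real.norm_eq_abs]
        exact (mul_le_mul_of_nonneg_left (hbn n x).1 (abs_nonneg a)).trans_eq (by ring))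
      (fun n x => by
        rw [norm_mul, Complex.norm_real, Real.norm_eq_abs]
        exact (mul_le_mul_of_nonneg_left (hbn n x).2 (abs_nonneg a)).trans_eq (by ring))
    refine ⟨h.1, h.2.mono ?_⟩
    rw [div_le_div_iff₀ hsm (by norm_num)]
    have : 0 ≤ 160 * (|a| * C₂) := by positivity
    linarith
  have hcon : ∀ δ g g', InBall (1 / 2000) g → InBall (1 / 2000) g' →
      InBall δ (fun x => g' x - g x) → InBall (δ / 2) fun x => (∑' n : ℕ,
      (a : ℂ) * diffTerm μ a (((n : ℝ) + 1) * m) g' (fun y => (starRingEnd ℂ) (g' y)) x) -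
      ∑' n : ℕ,
      (a : ℂ) * diffTerm μ a (((n : ℝ) + 1) * m) g (fun y => (starRingEnd ℂ) (g y)) x := by
    intro δ g g' hg hg' hδ
    have hδ0 := hδ.nonneg
    have e1 : (fun x => g x + (g' x - g x)) = g' := by funext x; ring
    have e2 : (fun x => (starRingEnd ℂ) (g x) + (starRingEnd ℂ) (g' x - g x)) =
        fun x => (starRingEnd ℂ) (g' x) := by funext x; rw [← map_add]; ring_nf
    have hbn := fun (n : ℕ) x => hd δ _ g (fun x => (starRingEnd ℂ) (g x)) (fun x => g' x - g x)
      (fun x => (starRingEnd ℂ) (g' x - g x)) hg hg.conj (by rw [e1]; exact hg')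
      (by rw [e2]; exact hg'.conj) hδ hδ.conj (hL n) x
    rw [e1, e2] at hbn
    have h := inBall_tsum (B := |a| * (C₂ * δ)) hm1 (by positivity)
      (D := fun (n : ℕ) x => (a : ℂ) * diffTerm μ a (((n : ℝ) + 1) * m) g'
        (fun y => (starRingEnd ℂ) (g' y)) x - (a : ℂ) * diffTerm μ a (((n : ℝ) + 1) * m) g
        (fun y => (starRingEnd ℂ) (g y)) x)
      (D' := fun (n : ℕ) x => (a : ℂ) * derivTerm μ a (((n : ℝ) + 1) * m) g'
        (fun y => (starRingEnd ℂ) (g' y)) x - (a : ℂ) * derivTerm μ a (((n : ℝ) + 1) * m) g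
        (fun y => (starRingEnd ℂ) (g y)) x)
      (fun n x => ((hasDerivAt_diffTerm hμ hg' hg'.conj (by norm_num) (hL n) x).const_mul _).sub
        ((hasDerivAt_diffTerm hμ hg hg.conj (by norm_num) (hL n) x).const_mul _))
      (fun n x => by
        rw [← mul_sub, norm_mul, Complex.norm_real, Real.norm_eq_abs]
        exact (mul_le_mul_of_nonneg_left (hbn n x).1 (abs_nonneg a)).trans_eq (by ring))
      (fun n x => by
        rw [← mul_sub, norm_mul, Complex.norm_real, Real.norm_eq_abs]
        exact (mul_le_mul_of_nonneg_left (hbn n x).2 (abs_nonneg a)).trans_eq (by ring))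
    have h2 := h.2.mono (e' := δ / 2) (by
      rw [div_le_div_iff₀ hsm (by norm_num)]
      have : 160 * (|a| * C₂) ≤ √m := by
        have : 0 ≤ 160000 * (|a| * C₁) := by positivity
        linarith
      nlinarith)
    refine (congrArg (InBall (δ / 2)) (funext fun x => ?_)).mp h2
    exact ((hself g' hg').1 x).of_norm.tsum_sub ((hself g hg).1 x).of_norm
  obtain ⟨g, hg, hfix⟩ := exists_fixedPoint (by norm_num) (fun g hg => (hself g hg).2) hcon
  refine ⟨hLm, g, hg, fun x => ?_⟩
  have := ((hself g hg).1 x).of_norm.hasSum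
  rwa [congrFun hfix x] at this


/-! ### Geometric resummation and one-sided logarithmic asymptotics. -/

/-- The bound ρ < 1 is uniform, so the integrals of the norms are dominated by a geometric series
and sum and integral may be exchanged. -/
theorem hasSum_integral_geometric {α : Type*} [MeasurableSpace α] {ν : Measure α} {G E : α → ℂ}
    {ρ : ℝ} (hρ : ρ < 1) (hG : Integrable G ν) (hE : AEStronglyMeasurable E ν)
    (hEρ : ∀ᵐ y ∂ν, ‖E y‖ ≤ ρ) :
    Integrable (fun y => G y / (1 - E y)) ν ∧
      HasSum (fun n : ℕ => ∫ y, G y * E y ^ n ∂ν) (∫ y, G y / (1 - E y) ∂ν) := by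
  have hb : ∀ n : ℕ, ∀ᵐ y ∂ν, ‖G y * E y ^ n‖ ≤ ‖G y‖ * ρ ^ n := by
    intro n
    filter_upwards [hEρ] with y hy
    rw [norm_mul, norm_pow]
    gcongr
  have hintg : ∀ n : ℕ, Integrable (fun y => G y * E y ^ n) ν := fun n =>
    Integrable.mono' (hG.norm.mul_const _) (hG.1.mul (hE.pow n)) (hb n)
  have hgeo : (fun y => G y / (1 - E y)) =ᵐ[ν] fun y => ∑' n : ℕ, G y * E y ^ n := by
    filter_upwards [hEρ] with y hy
    rw [tsum_mul_left, tsum_geometric_of_norm_lt_one (hy.trans_lt hρ), div_eq_mul_inv]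
  have hden : AEStronglyMeasurable (fun y => (1 - E y)⁻¹) ν :=
    (aestronglyMeasurable_const.sub hE).inv₀
  rcases eq_or_ne ν 0 with rfl | hν
  · simp [hasSum_zero]
  have hρ0 : 0 ≤ ρ := by
    have : (ae ν).NeBot := ae_neBot.2 hν
    obtain ⟨y, hy⟩ := hEρ.exists
    exact (norm_nonneg _).trans hy
  refine ⟨?_, ?_⟩
  · refine Integrable.mono' (hG.norm.mul_const (1 - ρ)⁻¹) ?_ ?_
    · exact (hG.1.mul hden).congr (ae_of_all _ fun y => (div_eq_mul_inv _ _).symm)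
    · filter_upwards [hEρ] with y hy
      rw [norm_div, div_eq_mul_inv]
      have h1 : 1 - ρ ≤ ‖1 - E y‖ := by
        have := norm_sub_norm_le (1 : ℂ) (E y)
        rw [norm_one] at this
        linarith
      gcongr
  · rw [integral_congr_ae hgeo]
    refine hasSum_integral_of_summable_integral_norm hintg ?_
    refine Summable.of_nonneg_of_le (fun n => integral_nonneg fun y => norm_nonneg _) (fun n => ?_)
      ((summable_geometric_of_lt_one hρ0 hρ).mul_left (∫ y, ‖G y‖ ∂ν))
    rw [← integral_mul_const]
    exact integral_mono_ae (hintg n).norm (hG.norm.mul_const _) (hb n)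

/-- Abel-type asymptotics of a power series whose coefficients behave like `H / (n + 1)`. -/
theorem tendsto_tsum_add_log {A : ℕ → ℝ → ℂ} {H w E : ℝ → ℂ} {b : ℕ → ℝ} {A0 : ℕ → ℂ} {H0 q : ℂ}
    (hb : Summable b) (hA : ∀ n, Tendsto (A n) (𝓝[>] 0) (𝓝 (A0 n)))
    (hbd : ∀ n, ∀ δ > 0, ‖A n δ - H δ / (n + 1)‖ ≤ b n) (hw : Tendsto w (𝓝[>] 0) (𝓝 1))
    (hE : ∀ δ > 0, ‖E δ‖ < 1)
    (hE0 : Tendsto (fun δ : ℝ => (1 - E δ) / (δ : ℂ)) (𝓝[>] 0) (𝓝 q)) (hq : 0 < q.re)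
    (hH : Tendsto H (𝓝[>] 0) (𝓝 H0))
    (hH' : Tendsto (fun δ : ℝ => (w δ * H δ - H0) * (Real.log δ : ℂ)) (𝓝[>] 0) (𝓝 0)) :
    Tendsto (fun δ : ℝ => (∑' n, w δ * E δ ^ (n + 1) * A n δ) + H0 * (Real.log δ : ℂ)) (𝓝[>] 0)
      (𝓝 ((∑' n : ℕ, (A0 n - H0 / (n + 1))) - H0 * Complex.log q)) := by
  have hδ0 : Tendsto (fun δ : ℝ => (δ : ℂ)) (𝓝[>] 0) (𝓝 0) := by
    have : Continuous fun δ : ℝ => (δ : ℂ) := by fun_prop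
    simpa using (this.tendsto 0).mono_left nhdsWithin_le_nhds
  have hpos : ∀ᶠ δ : ℝ in 𝓝[>] 0, 0 < δ := eventually_mem_nhdsWithin
  have hE1 : Tendsto E (𝓝[>] 0) (𝓝 1) := by
    have h1 : Tendsto (fun δ : ℝ => 1 - (δ : ℂ) * ((1 - E δ) / (δ : ℂ))) (𝓝[>] 0)
        (𝓝 (1 - 0 * q)) := (hδ0.mul hE0).const_sub 1
    rw [zero_mul, sub_zero] at h1
    refine h1.congr' ?_
    filter_upwards [hpos] with δ hδ
    have : (δ : ℂ) ≠ 0 := by exact_mod_cast hδ.ne'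
    field_simp
    ring
  -- Once the model coefficients H/(n+1) are removed, the series converges uniformly in δ.
  have hrem : Tendsto (fun δ => ∑' n : ℕ, w δ * E δ ^ (n + 1) * (A n δ - H δ / (n + 1))) (𝓝[>] 0)
      (𝓝 (∑' n : ℕ, (A0 n - H0 / (n + 1)))) := by
    refine tendsto_tsum_of_dominated_convergence (hb.mul_left 2) (fun n => ?_) ?_
    · have := (hw.mul (hE1.pow (n + 1))).mul ((hA n).sub (hH.div_const ((n : ℂ) + 1)))
      simpa using this
    · have hw2 : ∀ᶠ δ in 𝓝[>] 0, ‖w δ‖ < 2 :=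
        (hw.norm).eventually_lt_const (by simp)
      filter_upwards [hpos, hw2] with δ hδ h2 n
      rw [norm_mul, norm_mul, norm_pow]
      refine mul_le_mul ?_ (hbd n δ hδ) (norm_nonneg _) (by norm_num)
      calc _ ≤ 2 * 1 := mul_le_mul h2.le (pow_le_one₀ (norm_nonneg _) (hE δ hδ).le) (by positivity)
            (by norm_num)
        _ = 2 := by norm_num
  have hlogq : Tendsto (fun δ : ℝ => Complex.log ((1 - E δ) / (δ : ℂ))) (𝓝[>] 0)
      (𝓝 (Complex.log q)) := hE0.clog (Or.inl hq)
  have hwH : Tendsto (fun δ => w δ * H δ) (𝓝[>] 0) (𝓝 H0) := by simpa using hw.mul hH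
  have hlim := (hrem.sub hH').sub (hwH.mul hlogq)
  rw [sub_zero] at hlim
  refine hlim.congr' ?_
  filter_upwards [hpos] with δ hδ
  have hδc : (δ : ℂ) ≠ 0 := by exact_mod_cast hδ.ne'
  have hEδ := hE δ hδ
  have hne : 1 - E δ ≠ 0 := by
    intro h
    rw [← sub_eq_zero.1 h] at hEδ
    simp at hEδ
  -- The model part sums to -H log(1-E). Splitting off the positive factor δ leaves log((1-E)/δ),
  -- which converges because q lies in the right half-plane.
  have hl : Complex.log (1 - E δ) = Real.log δ + Complex.log ((1 - E δ) / δ) := by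
    rw [← Complex.log_ofReal_mul hδ (div_ne_zero hne hδc), mul_div_cancel₀ _ hδc]
  have hs1 : HasSum (fun n : ℕ => w δ * H δ * (E δ ^ (n + 1) / (n + 1)))
      (w δ * H δ * -Complex.log (1 - E δ)) :=
    (Complex.hasSum_taylorSeries_neg_log' hEδ).mul_left _
  have hs2 : Summable fun n : ℕ => w δ * E δ ^ (n + 1) * (A n δ - H δ / (n + 1)) := by
    refine Summable.of_norm_bounded (hb.mul_left ‖w δ‖) fun n => ?_
    rw [norm_mul, norm_mul, norm_pow]
    refine mul_le_mul ?_ (hbd n δ hδ) (norm_nonneg _) (norm_nonneg _)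
    exact mul_le_of_le_one_right (norm_nonneg _) (pow_le_one₀ (norm_nonneg _) hEδ.le)
  have hs3 := (hs2.hasSum.add hs1).tsum_eq
  have e : (fun n : ℕ => w δ * E δ ^ (n + 1) * (A n δ - H δ / (n + 1)) +
      w δ * H δ * (E δ ^ (n + 1) / (n + 1))) = fun n : ℕ => w δ * E δ ^ (n + 1) * A n δ := by
    funext n; ring
  rw [e] at hs3
  rw [hs3, hl]
  ring

theorem tendsto_sub_mul_log {u : ℝ → ℂ} {u' : ℂ} {x : ℝ} (hu : HasDerivAt u u' x) :
    Tendsto (fun δ : ℝ => (u (x + δ) - u x) * (Real.log δ : ℂ)) (𝓝[>] 0) (𝓝 0) := by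
  have h1 : Tendsto (fun δ : ℝ => δ⁻¹ • (u (x + δ) - u x)) (𝓝[>] 0) (𝓝 u') :=
    hu.tendsto_slope_zero_right
  have h2 : Tendsto (fun δ : ℝ => ((Real.log δ * δ ^ (1 : ℝ) : ℝ) : ℂ)) (𝓝[>] 0) (𝓝 0) := by
    have := (Complex.continuous_ofReal.tendsto 0).comp
      (tendsto_log_mul_rpow_nhdsGT_zero one_pos)
    rwa [Complex.ofReal_zero] at this
  have h3 := h1.mul h2
  rw [mul_zero] at h3
  refine h3.congr' ?_
  filter_upwards [eventually_mem_nhdsWithin] with δ hδ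
  have hδc : (δ : ℂ) ≠ 0 := by exact_mod_cast (ne_of_gt hδ)
  rw [Real.rpow_one, Complex.real_smul]
  push_cast
  field_simp

theorem tendsto_mul_log_of_norm_le_sqrt {v : ℝ → ℂ} {C : ℝ}
    (hv : ∀ δ : ℝ, 0 < δ → δ ≤ 1 → ‖v δ‖ ≤ C * √δ) :
    Tendsto (fun δ : ℝ => v δ * (Real.log δ : ℂ)) (𝓝[>] 0) (𝓝 0) := by
  have h2 : Tendsto (fun δ : ℝ => C * |Real.log δ * δ ^ (1 / 2 : ℝ)|) (𝓝[>] 0) (𝓝 0) := by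
    simpa using ((tendsto_log_mul_rpow_nhdsGT_zero (r := 1 / 2) (by norm_num)).abs).const_mul C
  refine squeeze_zero_norm' ?_ h2
  filter_upwards [Ioc_mem_nhdsGT (zero_lt_one' ℝ)] with δ hδ
  rw [norm_mul, Complex.norm_real, Real.norm_eq_abs, abs_mul, ← Real.sqrt_eq_rpow,
    abs_of_nonneg (Real.sqrt_nonneg δ)]
  calc _ ≤ C * √δ * |Real.log δ| := by gcongr; exact hv δ hδ.1 hδ.2
    _ = _ := by ring

namespace SpiralData

variable {μ χ α m : ℝ} {s ℓ : ℝ → ℝ} {c dc r Ψ : ℝ → ℂ}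

theorem strictMono_primitive (h : SpiralData μ χ s ℓ c dc r) : StrictMono ℓ :=
  strictMono_of_hasDerivAt_pos h.weight.hasDerivAt_primitive h.weight.pos

/-- With α = 0 the bounds on the full rate apply to the bare exponent m Ψ. -/
theorem largeFreq_zero (hκ : LargeFreq μ α m) : LargeFreq μ 0 m :=
  ⟨hκ.one_le, hκ.lt_mul, by simpa using (abs_nonneg α).trans (by linarith [hκ.abs_le, abs_nonneg α]),
    by simpa using (by linarith [hκ.lt_mul] : 0 ≤ m * μ)⟩

theorem largeFreq_mul (h : SpiralData μ χ s ℓ c dc r) (hκ : LargeFreq μ α m) (n : ℕ) :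
    LargeFreq μ α (((n : ℝ) + 1) * m) := by
  refine hκ.mono h.pos.le (le_mul_of_one_le_left (by linarith [hκ.one_le]) ?_)
  have : (0 : ℝ) ≤ n := n.cast_nonneg
  linarith

theorem hasDerivAt_harmonic (h : SpiralData μ χ s ℓ c dc r)
    (hΨ : ∀ y, HasDerivAt Ψ (smoothRate μ s c y + r y) y) (α κ x : ℝ) :
    HasDerivAt (fun y => (κ : ℂ) * Ψ y + α * ℓ y) (fullRate μ α κ s c r x) x :=
  ((hΨ x).const_mul _).add (((h.weight.hasDerivAt_primitive x).ofReal_comp).const_mul _)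

/-- Away from the diagonal |E| has a bound below 1 that is uniform over all further points, as the
geometric expansion requires. -/
theorem norm_exp_sub_lt_one (h : SpiralData μ χ s ℓ c dc r) (hκ : LargeFreq μ α m)
    (hΨ : ∀ y, HasDerivAt Ψ (smoothRate μ s c y + r y) y) {x y : ℝ} (hxy : x < y) :
    ∀ z, y ≤ z → ‖Complex.exp (m * Ψ x - m * Ψ z)‖ ≤ Real.exp (m * μ / 4 * (ℓ x - ℓ y)) ∧
      Real.exp (m * μ / 4 * (ℓ x - ℓ y)) < 1 := by
  intro z hz
  have hk : 0 < m * μ / 4 := by linarith [hκ.lt_mul]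
  have hd := h.decayRate (largeFreq_zero hκ) (h.hasDerivAt_harmonic hΨ 0 m)
  have h1 := DecayRate.norm_exp_le h.weight hd (hxy.le.trans hz)
  simp only [Complex.ofReal_zero, zero_mul, add_zero] at h1
  have h2 := h.strictMono_primitive.monotone hz
  have h3 := h.strictMono_primitive hxy
  refine ⟨h1.trans (Real.exp_le_exp.2 (by gcongr)), Real.exp_lt_one_iff.2 ?_⟩
  exact mul_neg_of_pos_of_neg hk (by linarith)

theorem integrableOn_harmonic (h : SpiralData μ χ s ℓ c dc r) (hκ : LargeFreq μ α m)
    (hΨ : ∀ y, HasDerivAt Ψ (smoothRate μ s c y + r y) y) (n : ℕ) (x : ℝ) :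
    IntegrableOn (fun y => (s y : ℂ) * Complex.exp
      ((((((n : ℝ) + 1) * m : ℝ) : ℂ) * Ψ x + α * ℓ x) -
        (((((n : ℝ) + 1) * m : ℝ) : ℂ) * Ψ y + α * ℓ y))) (Ioi x) := by
  have hc := h.weight.continuous
  have hL := h.largeFreq_mul hκ n
  refine DecayRate.integrableOn h.weight (h.decayRate hL (h.hasDerivAt_harmonic hΨ α _)) (b := 0)
    (M := 1) ?_ (by fun_prop) (fun y => ?_) x
  · have := hL.lt_mul; push_cast; linarith
  · rw [Complex.norm_real, Real.norm_eq_abs, abs_of_pos (h.weight.pos y)]; simp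

/-- The resummed integrand `s e^{α (ℓ(x) - ℓ)} E / (1 - E)` with `E = exp (m (Ψ(x) - Ψ))`. -/
noncomputable def resummed (α m : ℝ) (s ℓ : ℝ → ℝ) (Ψ : ℝ → ℂ) (x y : ℝ) : ℂ :=
  (s y : ℂ) * Complex.exp ((m * Ψ x + α * ℓ x) - (m * Ψ y + α * ℓ y)) /
    (1 - Complex.exp (m * Ψ x - m * Ψ y))

/-- The truncated integral starts at x + δ while its exponents are normalised at x. Renormalising
each harmonic at x + δ produces the factors E^(n+1), so the truncation acts like Abel summation of
the full harmonics. -/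
theorem hasSum_integral_resummed (h : SpiralData μ χ s ℓ c dc r) (hκ : LargeFreq μ α m)
    (hΨ : ∀ y, HasDerivAt Ψ (smoothRate μ s c y + r y) y) {x δ : ℝ} (hδ : 0 < δ) :
    IntegrableOn (resummed α m s ℓ Ψ x) (Ioi (x + δ)) ∧
      HasSum (fun n : ℕ => Complex.exp (α * (ℓ x - ℓ (x + δ))) *
        Complex.exp (m * Ψ x - m * Ψ (x + δ)) ^ (n + 1) *
        fwdInt (fun y => (s y : ℂ)) (fun y => (((((n : ℝ) + 1) * m : ℝ)) : ℂ) * Ψ y + α * ℓ y)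
          (x + δ)) (∫ y in Ioi (x + δ), resummed α m s ℓ Ψ x y) := by
  have hxδ : x < x + δ := by linarith
  have hΨc : Continuous Ψ := continuous_iff_continuousAt.2 fun y => (hΨ y).continuousAt
  have hE := h.norm_exp_sub_lt_one hκ hΨ hxδ
  have hG : IntegrableOn (fun y => (s y : ℂ) * Complex.exp ((m * Ψ x + α * ℓ x) -
      (m * Ψ y + α * ℓ y))) (Ioi (x + δ)) := by
    have := (h.integrableOn_harmonic hκ hΨ 0 x).mono_set (Ioi_subset_Ioi hxδ.le)
    simpa using this
  obtain ⟨h1, h2⟩ := hasSum_integral_geometric (ν := volume.restrict (Ioi (x + δ)))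
    (E := fun y => Complex.exp (m * Ψ x - m * Ψ y)) (hE _ le_rfl).2 hG
    (by fun_prop : Continuous fun y => Complex.exp (m * Ψ x - m * Ψ y)).aestronglyMeasurable
    (by
      filter_upwards [ae_restrict_mem measurableSet_Ioi] with y hy
      exact (hE y (le_of_lt hy)).1)
  refine ⟨h1, ?_⟩
  refine (congrArg (fun f => HasSum f _) (funext fun n => ?_)).mp h2
  unfold fwdInt
  rw [← integral_const_mul]
  refine setIntegral_congr_fun measurableSet_Ioi fun y _ => ?_
  simp only
  rw [← Complex.exp_nat_mul, ← Complex.exp_nat_mul, mul_assoc, ← Complex.exp_add,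
    mul_left_comm, ← Complex.exp_add, ← Complex.exp_add]
  congr 2
  push_cast
  ring

theorem norm_rate_sub_le (h : SpiralData μ χ s ℓ c dc r) (hκ : LargeFreq μ α m) {x y : ℝ}
    (hxy : |x - y| ≤ 1) : ‖(smoothRate μ s c x + r x) - (smoothRate μ s c y + r y)‖ ≤
      (3 * μ + 19) * √|x - y| := by
  have h1 := h.norm_fullRate_sub_le (largeFreq_zero hκ) hxy
  have hm : 0 < m := by linarith [hκ.one_le]
  simp only [fullRate, Complex.ofReal_zero, zero_mul, add_zero] at h1
  rw [← mul_sub, norm_mul, Complex.norm_real, Real.norm_eq_abs, abs_of_pos hm, mul_assoc] at h1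
  exact le_of_mul_le_mul_left h1 hm

theorem rate_ne_zero (h : SpiralData μ χ s ℓ c dc r) (x : ℝ) : smoothRate μ s c x + r x ≠ 0 :=
  norm_pos_iff.1 (lt_of_lt_of_le (by norm_num) (h.le_norm_rate x))

/-- The high-frequency estimate with κ = (n+1)m: replacing the full rate by κ times the bare rate
costs O(κ^{-2}), so the total error O(κ^{-3/2}) is summable. -/
theorem exists_norm_fwdInt_sub_div_le (h : SpiralData μ χ s ℓ c dc r) (hκ : LargeFreq μ α m)
    (hΨ : ∀ y, HasDerivAt Ψ (smoothRate μ s c y + r y) y) : ∃ b : ℕ → ℝ, Summable b ∧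
      ∀ (n : ℕ) (x : ℝ), ‖fwdInt (fun y => (s y : ℂ))
        (fun y => (((((n : ℝ) + 1) * m : ℝ)) : ℂ) * Ψ y + α * ℓ y) x -
        s x / (m * (smoothRate μ s c x + r x)) / (n + 1)‖ ≤ b n := by
  obtain ⟨C, hC, hkey⟩ := exists_norm_fwdInt_sub_le μ α
  refine ⟨fun n => (C + 128 * |α|) * (1 / √m * holderTerm 1 n),
    ((summable_holderTerm one_pos).mul_left _).mul_left _, fun n x => ?_⟩
  have hL := h.largeFreq_mul hκ n
  have h0 := h.weight.pos x
  have h1 := h.weight.le_one x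
  set κ : ℝ := ((n : ℝ) + 1) * m with hκdef
  have hκ1 := hL.one_le
  have hκ0 : 0 < κ := by linarith
  have hsq0 : 0 < √κ := Real.sqrt_pos.2 hκ0
  have hsqκ : √κ ≤ κ := by rw [Real.sqrt_le_left hκ0.le]; nlinarith
  have hk := hkey χ κ s ℓ c dc r _ h hL (h.hasDerivAt_harmonic hΨ α κ) x
  have hP := h.fullRate_ne_zero hL x
  have hp := h.rate_ne_zero x
  have hm0 : 0 < m := by linarith [hκ.one_le]
  have hmc : (m : ℂ) ≠ 0 := by exact_mod_cast hm0.ne'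
  have hκc : (κ : ℂ) ≠ 0 := by exact_mod_cast hκ0.ne'
  have hnc : (n : ℂ) + 1 ≠ 0 := by exact_mod_cast n.succ_ne_zero
  have e1 : (s x : ℂ) / (m * (smoothRate μ s c x + r x)) / (n + 1) =
      s x / (κ * (smoothRate μ s c x + r x)) := by
    rw [hκdef, div_div]
    push_cast
    ring_nf
  have e2 : (s x : ℂ) / fullRate μ α κ s c r x - s x / (κ * (smoothRate μ s c x + r x)) =
      -α * s x ^ 2 * (fullRate μ α κ s c r x)⁻¹ * (κ : ℂ)⁻¹ *
        (smoothRate μ s c x + r x)⁻¹ := by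
    field_simp
    unfold fullRate
    ring
  have l1 : ‖(fullRate μ α κ s c r x)⁻¹‖ ≤ 16 / κ := by
    rw [norm_inv, ← inv_div]
    exact inv_anti₀ (by positivity) (h.le_norm_fullRate hL x)
  have l2 : ‖(smoothRate μ s c x + r x)⁻¹‖ ≤ 8 := by
    rw [norm_inv]
    exact inv_le_of_inv_le₀ (by norm_num) (by simpa using h.le_norm_rate x)
  have hs2 : s x ^ 2 ≤ 1 := pow_le_one₀ h0.le h1
  have e3 : ‖(s x : ℂ) / fullRate μ α κ s c r x - s x / (κ * (smoothRate μ s c x + r x))‖ ≤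
      128 * |α| * (1 / (κ * √κ)) := by
    rw [e2, norm_mul, norm_mul, norm_mul, norm_mul, norm_neg, norm_pow, norm_inv (κ : ℂ),
      Complex.norm_real, Complex.norm_real, Complex.norm_real, Real.norm_eq_abs, Real.norm_eq_abs,
      Real.norm_eq_abs, abs_of_pos h0, abs_of_pos hκ0]
    calc _ ≤ |α| * 1 * (16 / κ) * κ⁻¹ * 8 := by gcongr
      _ = 128 * |α| * (1 / (κ * κ)) := by field_simp; ring
      _ ≤ _ := by gcongr
  rw [e1]
  calc _ ≤ ‖fwdInt (fun y => (s y : ℂ)) (fun y => (κ : ℂ) * Ψ y + α * ℓ y) x -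
        s x / fullRate μ α κ s c r x‖ + ‖(s x : ℂ) / fullRate μ α κ s c r x -
        s x / (κ * (smoothRate μ s c x + r x))‖ := norm_sub_le_norm_sub_add_norm_sub _ _ _
    _ ≤ C * s x ^ 2 / (κ * √κ) + 128 * |α| * (1 / (κ * √κ)) := add_le_add hk e3
    _ ≤ C * 1 / (κ * √κ) + 128 * |α| * (1 / (κ * √κ)) := by gcongr
    _ = (C + 128 * |α|) * (1 / (κ * √κ)) := by ring
    _ ≤ _ := mul_le_mul_of_nonneg_left (inv_mul_sqrt_le hκ.one_le n) (by positivity)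

/-- One-sided asymptotics of the truncated resummed integral. -/
theorem tendsto_integral_resummed (h : SpiralData μ χ s ℓ c dc r) (hκ : LargeFreq μ α m)
    (hΨ : ∀ y, HasDerivAt Ψ (smoothRate μ s c y + r y) y) (x : ℝ) :
    Summable (fun n : ℕ => fwdInt (fun y => (s y : ℂ))
      (fun y => (((((n : ℝ) + 1) * m : ℝ)) : ℂ) * Ψ y + α * ℓ y) x -
        s x / (m * (smoothRate μ s c x + r x)) / (n + 1)) ∧
    Tendsto (fun δ : ℝ => (∫ y in Ioi (x + δ), resummed α m s ℓ Ψ x y) +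
        s x / (m * (smoothRate μ s c x + r x)) * (Real.log δ : ℂ)) (𝓝[>] 0)
      (𝓝 ((∑' n : ℕ, (fwdInt (fun y => (s y : ℂ))
        (fun y => (((((n : ℝ) + 1) * m : ℝ)) : ℂ) * Ψ y + α * ℓ y) x -
        s x / (m * (smoothRate μ s c x + r x)) / (n + 1))) -
        s x / (m * (smoothRate μ s c x + r x)) *
          Complex.log (m * (smoothRate μ s c x + r x)))) := by
  obtain ⟨b, hb, hbd⟩ := h.exists_norm_fwdInt_sub_div_le hκ hΨ
  have hm0 : 0 < m := by linarith [hκ.one_le]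
  have hmc : (m : ℂ) ≠ 0 := by exact_mod_cast hm0.ne'
  have hsc := h.weight.continuous
  have hℓc := h.weight.continuous_primitive
  have hΨc : Continuous Ψ := continuous_iff_continuousAt.2 fun y => (hΨ y).continuousAt
  have hpc : Continuous fun y => smoothRate μ s c y + r y := h.continuous_smooth.add h.continuous_rough
  have hp := h.rate_ne_zero
  refine ⟨Summable.of_norm_bounded hb fun n => hbd n x, ?_⟩
  have hadd : Tendsto (fun δ : ℝ => x + δ) (𝓝[>] 0) (𝓝 x) := by
    have : Continuous fun δ : ℝ => x + δ := by fun_prop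
    simpa using (this.tendsto 0).mono_left nhdsWithin_le_nhds
  have hcont : ∀ {f : ℝ → ℂ}, ContinuousAt f x →
      Tendsto (fun δ : ℝ => f (x + δ)) (𝓝[>] 0) (𝓝 (f x)) := fun hf => hf.tendsto.comp hadd
  have hHc : Continuous fun y => (s y : ℂ) / (m * (smoothRate μ s c y + r y)) :=
    Continuous.div (by fun_prop) (by fun_prop) fun y => mul_ne_zero hmc (hp y)
  have hmain := tendsto_tsum_add_log
    (A := fun n δ => fwdInt (fun y => (s y : ℂ))
      (fun y => (((((n : ℝ) + 1) * m : ℝ)) : ℂ) * Ψ y + α * ℓ y) (x + δ))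
    (H := fun δ => s (x + δ) / (m * (smoothRate μ s c (x + δ) + r (x + δ))))
    (w := fun δ => Complex.exp (α * (ℓ x - ℓ (x + δ))))
    (E := fun δ => Complex.exp (m * Ψ x - m * Ψ (x + δ)))
    (q := m * (smoothRate μ s c x + r x))
    (H0 := s x / (m * (smoothRate μ s c x + r x))) hb
    (fun n => hcont (((h.decayRate (h.largeFreq_mul hκ n)
      (h.hasDerivAt_harmonic hΨ α _)).hasDerivAt_fwdInt (by fun_prop)
      (h.integrableOn_harmonic hκ hΨ n) x).continuousAt))
    (fun n δ _ => hbd n (x + δ))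
    (by
      have := hcont (f := fun y => Complex.exp (α * (ℓ x - ℓ y)))
        (by fun_prop : Continuous fun y => Complex.exp (α * ((ℓ x : ℂ) - ℓ y))).continuousAt
      simpa using this)
    (fun δ hδ => by
      have := h.norm_exp_sub_lt_one hκ hΨ (by linarith : x < x + δ) _ le_rfl
      exact this.1.trans_lt this.2)
    (by
      have hd : HasDerivAt (fun y => -Complex.exp (m * Ψ x - m * Ψ y))
          (m * (smoothRate μ s c x + r x)) x :=
        ((((hΨ x).const_mul (m : ℂ)).const_sub (m * Ψ x)).cexp).neg.congr_deriv (by simp)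
      refine hd.tendsto_slope_zero_right.congr fun δ => ?_
      rw [Complex.real_smul, sub_self, Complex.exp_zero]
      push_cast
      ring)
    (by
      rw [Complex.re_ofReal_mul]
      have := h.le_re_rate x
      have h2 : 0 < μ / 2 * s x := mul_pos (by linarith [h.pos]) (h.weight.pos x)
      exact mul_pos hm0 (by linarith))
    (hcont hHc.continuousAt)
    (by
      -- The variation of w·H is the sum of a differentiable part, O(δ), and a part from the Hölder
      -- continuous rate, O(√δ). Both beat log δ.
      set p : ℝ → ℂ := fun y => smoothRate μ s c y + r y with hpdef
      have hu : HasDerivAt (fun y => Complex.exp (α * (ℓ x - ℓ y)) * s y)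
          (Complex.exp (α * (ℓ x - ℓ x)) * (α * -(s x : ℂ)) * s x +
            Complex.exp (α * (ℓ x - ℓ x)) * ((χ * s x ^ 2 * (1 - s x) : ℝ) : ℂ)) x := by
        have h1 := ((((h.weight.hasDerivAt_primitive x).ofReal_comp).const_sub
          (ℓ x : ℂ)).const_mul (α : ℂ)).cexp
        exact h1.mul ((h.weight.hasDerivAt x).ofReal_comp)
      have hpi : Tendsto (fun δ : ℝ => (m * p (x + δ))⁻¹) (𝓝[>] 0) (𝓝 (m * p x)⁻¹) :=
        hcont (f := fun y => (m * p y)⁻¹)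
          (by fun_prop (disch := exact mul_ne_zero hmc (hp x)))
      have t1 := (tendsto_sub_mul_log hu).mul hpi
      have t2 := (tendsto_mul_log_of_norm_le_sqrt (v := fun δ => p x - p (x + δ))
        (C := 3 * μ + 19) fun δ h0 h1 => by
          have e : |x - (x + δ)| = δ := by rw [sub_add_cancel_left, abs_neg, abs_of_pos h0]
          have := h.norm_rate_sub_le hκ (x := x) (y := x + δ) (by rw [e]; exact h1)
          rwa [e] at this).mul (hpi.mul_const ((s x : ℂ) / p x))
      have t3 := t1.add t2
      simp only [zero_mul, add_zero] at t3
      refine t3.congr fun δ => ?_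
      have hpx : p x ≠ 0 := hp x
      have hpy : p (x + δ) ≠ 0 := hp _
      simp only [sub_self, mul_zero, Complex.exp_zero, one_mul]
      change _ = (Complex.exp (α * (ℓ x - ℓ (x + δ))) * (s (x + δ) / (m * p (x + δ))) -
        s x / (m * p x)) * _
      field_simp
      ring)
  refine hmain.congr' ?_
  filter_upwards [eventually_mem_nhdsWithin] with δ hδ
  rw [(h.hasSum_integral_resummed hκ hΨ hδ).2.tsum_eq]

end SpiralData


/-! ### The principal value in the logarithmic coordinate. -/

/-- The Birkhoff–Rott kernel in the logarithmic coordinate, with the density of the circulation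
normalised at `x`. -/
noncomputable def spiralKernel (μ a m : ℝ) (g k : ℝ → ℂ) (x y : ℝ) : ℂ :=
  a * spiralWeight y * Complex.exp (a * (spiralLog x - spiralLog y)) /
    (1 - Complex.exp (m * ratePrim μ g k x - m * ratePrim μ g k y))

section Kernel

variable {μ a m e : ℝ} {g k : ℝ → ℂ}

theorem hasDerivAt_ratePrim_mirror (hμ : 1 / 2 < μ) (hg : InBall e g) (hk : InBall e k)
    (he : e ≤ 1 / 1000) (y : ℝ) : HasDerivAt (fun y => -ratePrim μ g k (-y))
      (smoothRate μ (fun x => spiralWeight (-x)) (fun x => (coeffQ g k (-x))⁻¹) y +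
        roughRate g k (-y)) y :=
  ((hasDerivAt_ratePrim hμ hg hk he (-y)).scomp y (hasDerivAt_neg y)).neg.congr_deriv
    (by simp [spiralRate, smoothRate]; ring)

/-- This is 1/(1-E) = 1 + E/(1-E). The 1 produces the enclosed circulation, the rest the inner
harmonics. -/
theorem spiralKernel_eq_inner (hμ : 1 / 2 < μ) (hg : InBall e g) (hk : InBall e k)
    (he : e ≤ 1 / 1000) (hκ : LargeFreq μ a m) {x y : ℝ} (hxy : x < y) :
    spiralKernel μ a m g k x y = ((a * (spiralWeight y *
      Real.exp (a * (spiralLog x - spiralLog y))) : ℝ) : ℂ) +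
      a * SpiralData.resummed a m spiralWeight spiralLog (ratePrim μ g k) x y := by
  have h := (spiralData_of_inBall hμ hg hk he).norm_exp_sub_lt_one hκ
    (hasDerivAt_ratePrim hμ hg hk he) hxy y le_rfl
  have hne : 1 - Complex.exp (m * ratePrim μ g k x - m * ratePrim μ g k y) ≠ 0 := by
    intro h0
    have := h.1.trans_lt h.2
    rw [← sub_eq_zero.1 h0] at this
    simp at this
  unfold spiralKernel SpiralData.resummed
  rw [add_sub_add_comm, Complex.exp_add, ← mul_sub (a : ℂ)]
  push_cast
  generalize Complex.exp (m * ratePrim μ g k x - m * ratePrim μ g k y) = E at hne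
  field_simp
  ring

/-- Here the expansion is in E⁻¹, through 1/(1-E) = -E⁻¹/(1-E⁻¹), so there is no constant term. -/
theorem spiralKernel_neg_eq_outer (x y : ℝ) :
    spiralKernel μ a m g k x (-y) = -(a * SpiralData.resummed (-a) m (fun x => spiralWeight (-x))
      (fun x => -spiralLog (-x)) (fun x => -ratePrim μ g k (-x)) (-x) y) := by
  unfold spiralKernel SpiralData.resummed
  simp only [neg_neg]
  set E := Complex.exp (m * ratePrim μ g k x - m * ratePrim μ g k (-y)) with hE
  have hE0 : E ≠ 0 := Complex.exp_ne_zero _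
  have e1 : Complex.exp (m * -ratePrim μ g k x - m * -ratePrim μ g k (-y)) = E⁻¹ := by
    rw [hE, ← Complex.exp_neg]; ring_nf
  have e2 : Complex.exp (m * -ratePrim μ g k x + ((-a : ℝ) : ℂ) * ((-spiralLog x : ℝ) : ℂ) -
      (m * -ratePrim μ g k (-y) + ((-a : ℝ) : ℂ) * ((-spiralLog (-y) : ℝ) : ℂ))) =
      E⁻¹ * Complex.exp (a * (spiralLog x - spiralLog (-y))) := by
    rw [← e1, ← Complex.exp_add]
    congr 1
    push_cast
    ring
  rw [e1, e2]
  have e3 : (1 - E⁻¹) = -(E⁻¹ * (1 - E)) := by field_simp; ring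
  rw [e3]
  rcases eq_or_ne (1 - E) 0 with h | h
  · simp [h]
  · field_simp

theorem integrableOn_density (ha : 0 < a) (x : ℝ) :
    IntegrableOn (fun y => spiralWeight y * Real.exp (a * (spiralLog x - spiralLog y))) (Ioi x) := by
  have h := (slowWeight_spiralWeight.integrableOn_and_integral_le 0 (k := a) (by simpa using ha) x).1
  simpa using h

theorem integral_density (ha : 0 < a) (x z : ℝ) (hz : x ≤ z) :
    ∫ y in Ioi z, a * (spiralWeight y * Real.exp (a * (spiralLog x - spiralLog y))) =
      Real.exp (a * (spiralLog x - spiralLog z)) := by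
  have hd : ∀ y ∈ Ici z, HasDerivAt (fun y => -Real.exp (a * (spiralLog x - spiralLog y)))
      (a * (spiralWeight y * Real.exp (a * (spiralLog x - spiralLog y)))) y := fun y _ =>
    ((((hasDerivAt_spiralLog y).const_sub _).const_mul a).exp).neg.congr_deriv (by ring)
  have hl : Tendsto (fun y => -Real.exp (a * (spiralLog x - spiralLog y))) atTop (𝓝 0) := by
    simpa using (slowWeight_spiralWeight.tendsto_exp ha x).neg
  rw [integral_Ioi_of_hasDerivAt_of_tendsto' hd
    (((integrableOn_density ha x).mono_set (Ioi_subset_Ioi hz)).const_mul a) hl]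
  ring

theorem integrableOn_spiralKernel_inner (hμ : 1 / 2 < μ) (hg : InBall e g) (hk : InBall e k)
    (he : e ≤ 1 / 1000) (hκ : LargeFreq μ a m) (ha : 0 < a) {x δ : ℝ} (hδ : 0 < δ) :
    IntegrableOn (spiralKernel μ a m g k x) (Ioi (x + δ)) ∧
      ∫ y in Ioi (x + δ), spiralKernel μ a m g k x y =
        (Real.exp (a * (spiralLog x - spiralLog (x + δ))) : ℂ) + a * ∫ y in Ioi (x + δ),
          SpiralData.resummed a m spiralWeight spiralLog (ratePrim μ g k) x y := by
  have h1 := ((spiralData_of_inBall hμ hg hk he).hasSum_integral_resummed hκ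
    (hasDerivAt_ratePrim hμ hg hk he) (x := x) hδ).1
  have h2 : IntegrableOn (fun y => ((a * (spiralWeight y *
      Real.exp (a * (spiralLog x - spiralLog y))) : ℝ) : ℂ)) (Ioi (x + δ)) :=
    (((integrableOn_density ha x).mono_set (Ioi_subset_Ioi (by linarith))).const_mul a).ofReal
  have heq : EqOn (spiralKernel μ a m g k x) (fun y => ((a * (spiralWeight y *
      Real.exp (a * (spiralLog x - spiralLog y))) : ℝ) : ℂ) +
      a * SpiralData.resummed a m spiralWeight spiralLog (ratePrim μ g k) x y) (Ioi (x + δ)) :=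
    fun y hy => spiralKernel_eq_inner hμ hg hk he hκ (by rw [mem_Ioi] at hy; linarith)
  have h3 := Integrable.add h2 (h1.const_mul (a : ℂ))
  refine ⟨(integrableOn_congr_fun heq measurableSet_Ioi).2 h3, ?_⟩
  rw [setIntegral_congr_fun measurableSet_Ioi heq, integral_add h2 (h1.const_mul (a : ℂ)),
    integral_complex_ofReal, integral_density ha x _ (by linarith), integral_const_mul]

theorem integrableOn_spiralKernel_outer (hμ : 1 / 2 < μ) (hg : InBall e g) (hk : InBall e k)
    (he : e ≤ 1 / 1000) (hκ : LargeFreq μ a m) {x δ : ℝ} (hδ : 0 < δ) :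
    IntegrableOn (spiralKernel μ a m g k x) (Iic (x - δ)) ∧
      ∫ y in Iic (x - δ), spiralKernel μ a m g k x y = -(a * ∫ y in Ioi (-x + δ),
          SpiralData.resummed (-a) m (fun x => spiralWeight (-x))
      (fun x => -spiralLog (-x)) (fun x => -ratePrim μ g k (-x)) (-x) y) := by
  have h1 := ((spiralData_mirror hμ hg hk he).hasSum_integral_resummed hκ.neg
    (hasDerivAt_ratePrim_mirror hμ hg hk he) (x := -x) hδ).1
  have e : x - δ = -(-x + δ) := by ring
  rw [e]
  constructor
  · rw [← (Measure.measurePreserving_neg (volume : Measure ℝ)).integrableOn_comp_preimage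
      (Homeomorph.neg ℝ).measurableEmbedding]
    have e' : (Neg.neg : ℝ → ℝ) ⁻¹' Iic (-(-x + δ)) = Ici (-x + δ) := by
      ext y; simp only [mem_preimage, mem_Iic, mem_Ici, neg_le_neg_iff]
    rw [e', integrableOn_Ici_iff_integrableOn_Ioi]
    refine ((h1.const_mul (a : ℂ)).neg).congr (ae_of_all _ fun y => ?_)
    exact (spiralKernel_neg_eq_outer x y).symm
  · rw [← integral_comp_neg_Ioi, ← integral_const_mul, ← integral_neg]
    exact integral_congr_ae (ae_of_all _ fun y => spiralKernel_neg_eq_outer x y)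

/-- The principal value in the logarithmic coordinate. -/
theorem tendsto_integral_spiralKernel (hμ : 1 / 2 < μ) (hg : InBall e g) (hk : InBall e k)
    (he : e ≤ 1 / 1000) (hκ : LargeFreq μ a m) (ha : 0 < a) {x : ℝ} {v : ℂ}
    (hv : HasSum (fun n : ℕ => (a : ℂ) * diffTerm μ a (((n : ℝ) + 1) * m) g k x) v)
    {ι : Type*} {l : Filter ι} {d d' : ι → ℝ} (hd : Tendsto d l (𝓝[>] 0))
    (hd' : Tendsto d' l (𝓝[>] 0))
    (hdd : Tendsto (fun i => Real.log (d i) - Real.log (d' i)) l (𝓝 0)) :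
    Tendsto (fun i => (∫ y in Ioi (x + d i), spiralKernel μ a m g k x y) +
      ∫ y in Iic (x - d' i), spiralKernel μ a m g k x y) l (𝓝 (1 + v)) := by
  obtain ⟨s1, t1⟩ := (spiralData_of_inBall hμ hg hk he).tendsto_integral_resummed hκ
    (hasDerivAt_ratePrim hμ hg hk he) x
  obtain ⟨s2, t2⟩ := (spiralData_mirror hμ hg hk he).tendsto_integral_resummed hκ.neg
    (hasDerivAt_ratePrim_mirror hμ hg hk he) (-x)
  -- The coefficient of log δ does not involve the sign of `a`, so it is the same on both sides and
  -- the singularities cancel up to log d - log d'.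
  set h0 : ℂ := spiralWeight x / (m * spiralRate μ g k x) with hh0
  have e1 : (spiralWeight x / (m * (smoothRate μ spiralWeight (fun x => (coeffQ g k x)⁻¹) x +
      roughRate g k x)) : ℂ) = h0 := rfl
  have e3 : smoothRate μ (fun x => spiralWeight (-x)) (fun x => (coeffQ g k (-x))⁻¹) (-x) +
      roughRate g k x = spiralRate μ g k x := by
    simp [spiralRate, smoothRate]
  have e4 : ∀ n : ℕ, fwdInt (fun y => (spiralWeight (-y) : ℂ))
      (fun y => ((((n : ℝ) + 1) * m : ℝ) : ℂ) * -ratePrim μ g k (-y) +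
        ((-a : ℝ) : ℂ) * ((-spiralLog (-y) : ℝ) : ℂ)) (-x) =
      outerTerm μ a (((n : ℝ) + 1) * m) g k x := by
    intro n
    unfold outerTerm freqPrim
    congr 1
    funext y
    push_cast
    ring
  have e5 : ∀ n : ℕ, fwdInt (fun y => (spiralWeight y : ℂ))
      (fun y => ((((n : ℝ) + 1) * m : ℝ) : ℂ) * ratePrim μ g k y + (a : ℂ) * (spiralLog y : ℂ)) x =
      innerTerm μ a (((n : ℝ) + 1) * m) g k x := fun n => rfl
  simp only [e1, e5] at s1 t1
  simp only [neg_neg, e3, e4, ← hh0] at s2 t2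
  -- The two model series h0/(n+1) diverge separately but cancel term by term.
  have hsum : v = a * ((∑' n : ℕ, (innerTerm μ a (((n : ℝ) + 1) * m) g k x - h0 / (n + 1))) -
      ∑' n : ℕ, (outerTerm μ a (((n : ℝ) + 1) * m) g k x - h0 / (n + 1))) := by
    rw [← hv.tsum_eq, tsum_mul_left, ← s1.tsum_sub s2]
    congr 2
    funext n
    unfold diffTerm
    ring
  have hx : Tendsto (fun i => (Real.exp (a * (spiralLog x - spiralLog (x + d i))) : ℂ)) l (𝓝 1) := by
    have hc : Continuous fun δ => (Real.exp (a * (spiralLog x - spiralLog (x + δ))) : ℂ) := by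
      have := continuous_spiralLog
      fun_prop
    have := (hc.tendsto 0).comp (hd.mono_right nhdsWithin_le_nhds)
    simpa using! this
  have hlog : Tendsto (fun i => ((Real.log (d i) - Real.log (d' i) : ℝ) : ℂ)) l (𝓝 0) := by
    have := (Complex.continuous_ofReal.tendsto 0).comp hdd
    rwa [Complex.ofReal_zero] at this
  have hfin := (hx.add (((t1.comp hd).sub (t2.comp hd')).const_mul (a : ℂ))).sub
    ((hlog.const_mul h0).const_mul (a : ℂ))
  have hval : (1 : ℂ) + a * ((∑' n : ℕ, (innerTerm μ a (((n : ℝ) + 1) * m) g k x -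
      h0 / (n + 1))) - h0 * Complex.log (m * spiralRate μ g k x) -
      ((∑' n : ℕ, (outerTerm μ a (((n : ℝ) + 1) * m) g k x - h0 / (n + 1))) -
        h0 * Complex.log (m * spiralRate μ g k x))) - a * (h0 * 0) = 1 + v := by
    rw [hsum]; ring
  rw [← hval]
  refine hfin.congr' ?_
  have p1 : ∀ᶠ i in l, 0 < d i := hd.eventually eventually_mem_nhdsWithin
  have p2 : ∀ᶠ i in l, 0 < d' i := hd'.eventually eventually_mem_nhdsWithin
  filter_upwards [p1, p2] with i i1 i2
  rw [(integrableOn_spiralKernel_inner hμ hg hk he hκ ha i1).2,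
    (integrableOn_spiralKernel_outer hμ hg hk he hκ i2).2]
  simp only [Function.comp_apply]
  push_cast
  ring

end Kernel


/-! ### Change of variable from the logarithmic coordinate to the circulation. -/

/-- The circulation as a function of the logarithmic coordinate. -/
noncomputable def circ (a B y : ℝ) : ℝ := -(B * Real.exp (-(a * spiralLog y)))

/-- The logarithmic coordinate as a function of the circulation. -/
noncomputable def circInv (a B Γ : ℝ) : ℝ :=
  -(Real.log (-Γ / B) / a) + Real.exp (-(Real.log (-Γ / B) / a))

section Circ

variable {a B : ℝ}

theorem circ_neg (hB : 0 < B) (y : ℝ) : circ a B y < 0 := by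
  unfold circ
  have := Real.exp_pos (-(a * spiralLog y))
  have := mul_pos hB this
  linarith

theorem strictMono_circ (ha : 0 < a) (hB : 0 < B) : StrictMono (circ a B) := by
  intro x y hxy
  unfold circ
  have := strictMono_spiralLog hxy
  rw [neg_lt_neg_iff]
  refine mul_lt_mul_of_pos_left (Real.exp_lt_exp.2 ?_) hB
  nlinarith

theorem hasDerivAt_circ (y : ℝ) : HasDerivAt (circ a B)
    (B * (a * spiralWeight y * Real.exp (-(a * spiralLog y)))) y :=
  ((((hasDerivAt_spiralLog y).const_mul a).fun_neg.exp).const_mul B).neg.congr_deriv (by ring)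

theorem spiralLog_circInv (Γ : ℝ) : spiralLog (circInv a B Γ) = -(Real.log (-Γ / B) / a) :=
  spiralLog_of_add_exp _

theorem circ_circInv (ha : 0 < a) (hB : 0 < B) {Γ : ℝ} (hΓ : Γ < 0) :
    circ a B (circInv a B Γ) = Γ := by
  unfold circ
  rw [spiralLog_circInv, mul_neg, mul_div_cancel₀ _ ha.ne', neg_neg,
    Real.exp_log (div_pos (by linarith) hB)]
  field_simp

theorem hasDerivAt_circInv {Γ : ℝ} (hΓ : Γ < 0) (hB : 0 < B) : HasDerivAt (circInv a B)
    ((1 + Real.exp (-(Real.log (-Γ / B) / a))) / (a * -Γ)) Γ := by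
  have h0 : -Γ / B ≠ 0 := (div_pos (by linarith) hB).ne'
  have h1 : HasDerivAt (fun Γ => -(Real.log (-Γ / B) / a)) (1 / (a * -Γ)) Γ := by
    refine (((((hasDerivAt_id' Γ).fun_neg.div_const B).log h0)).div_const a).neg.congr_deriv ?_
    have : Γ ≠ 0 := hΓ.ne
    field_simp
  exact (h1.add h1.exp).congr_deriv (by ring)

theorem circ_image_Iic (ha : 0 < a) (hB : 0 < B) (x : ℝ) :
    circ a B '' Iic x = Iic (circ a B x) := by
  have hm := strictMono_circ ha hB
  ext Γ
  constructor
  · rintro ⟨y, hy, rfl⟩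
    exact hm.monotone hy
  · intro hΓ
    have h0 : Γ < 0 := lt_of_le_of_lt hΓ (circ_neg hB x)
    refine ⟨circInv a B Γ, ?_, circ_circInv ha hB h0⟩
    rw [mem_Iic, ← hm.le_iff_le, circ_circInv ha hB h0]
    exact hΓ

theorem circ_image_Ici (ha : 0 < a) (hB : 0 < B) (x : ℝ) :
    circ a B '' Ici x = Ico (circ a B x) 0 := by
  have hm := strictMono_circ ha hB
  ext Γ
  constructor
  · rintro ⟨y, hy, rfl⟩
    exact ⟨hm.monotone hy, circ_neg hB y⟩
  · intro hΓ
    refine ⟨circInv a B Γ, ?_, circ_circInv ha hB hΓ.2⟩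
    rw [mem_Ici, ← hm.le_iff_le, circ_circInv ha hB hΓ.2]
    exact hΓ.1

/-- Both one-sided increments are f'(x) ε to first order, so their ratio tends to 1. This makes a
cutoff symmetric in Γ admissible in the logarithmic coordinate. -/
theorem tendsto_log_sub_log_of_hasDerivAt {f : ℝ → ℝ} {f' x : ℝ} (hf : HasDerivAt f f' x)
    (hf' : 0 < f') :
    Tendsto (fun ε => Real.log (f (x + ε) - f x) - Real.log (f x - f (x - ε))) (𝓝[>] 0) (𝓝 0) := by
  have h1 : Tendsto (fun ε => ε⁻¹ * (f (x + ε) - f x)) (𝓝[>] 0) (𝓝 f') :=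
    hf.tendsto_slope_zero_right
  have hneg : Tendsto (fun ε : ℝ => -ε) (𝓝[>] 0) (𝓝[<] 0) := by
    simpa using tendsto_neg_nhdsGT (a := (0 : ℝ))
  have h2 : Tendsto (fun ε => ε⁻¹ * (f x - f (x - ε))) (𝓝[>] 0) (𝓝 f') := by
    refine (hf.tendsto_slope_zero_left.comp hneg).congr fun ε => ?_
    simp only [Function.comp_apply, smul_eq_mul, inv_neg, ← sub_eq_add_neg]
    ring
  have h3 := (h1.log hf'.ne').sub (h2.log hf'.ne')
  rw [sub_self] at h3
  refine h3.congr' ?_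
  filter_upwards [h1.eventually_const_lt hf', h2.eventually_const_lt hf',
    eventually_mem_nhdsWithin] with ε e1 e2 e3
  have e3' : 0 < ε⁻¹ := inv_pos.2 e3
  rw [Real.log_mul e3'.ne' (pos_of_mul_pos_right e1 e3'.le).ne',
    Real.log_mul e3'.ne' (pos_of_mul_pos_right e2 e3'.le).ne']
  ring

/-- Enlarging ε shrinks the domain, so integrability for small ε suffices; for these, Γ + ε < 0 and
the truncated set has two pieces. -/
theorem HasPV.of_small {f : ℝ → ℂ} {Γ ε₀ : ℝ} {v : ℂ} (hε₀ : 0 < ε₀)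
    (hi : ∀ ε, 0 < ε → ε < ε₀ → IntegrableOn f (Iio 0 \ Ioo (Γ - ε) (Γ + ε)))
    (ht : Tendsto (fun ε : ℝ => ∫ x in Iio 0 \ Ioo (Γ - ε) (Γ + ε), f x) (𝓝[>] 0) (𝓝 v)) :
    HasPV f Γ v := by
  refine ⟨fun ε hε => ?_, ht⟩
  have h1 : min ε (ε₀ / 2) ≤ ε := min_le_left _ _
  have h2 : min ε (ε₀ / 2) < ε₀ := (min_le_right _ _).trans_lt (by linarith)
  refine (hi _ (lt_min hε (by linarith)) h2).mono_set ?_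
  exact sdiff_subset_sdiff_right (Ioo_subset_Ioo (by linarith) (by linarith))

end Circ

/-- The principal value of a kernel that pulls back to `1 / (1 - E)`. -/
theorem hasPV_of_comp_circ {μ a m e B : ℝ} {g k : ℝ → ℂ} (hμ : 1 / 2 < μ) (hg : InBall e g)
    (hk : InBall e k) (he : e ≤ 1 / 1000) (hκ : LargeFreq μ a m) (ha : 0 < a) (hB : 0 < B)
    {x : ℝ} {v c : ℂ}
    (hv : HasSum (fun n : ℕ => (a : ℂ) * diffTerm μ a (((n : ℝ) + 1) * m) g k x) v)
    {K : ℝ → ℂ} (hK : ∀ y, y ≠ x → K (circ a B y) =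
      c / (1 - Complex.exp (m * ratePrim μ g k x - m * ratePrim μ g k y))) :
    HasPV K (circ a B x) (c * (-circ a B x : ℝ) * (1 + v)) := by
  set Γ := circ a B x with hΓ
  have hΓ0 : Γ < 0 := circ_neg hB x
  have hm := strictMono_circ ha hB
  set w : ℂ := c * (-Γ : ℝ) with hw
  -- The density relative to its value at `x` is `exp (a * (ℓ x - ℓ y))`; the factor `-Γ` collected
  -- in `w` compensates the normalisation.
  have hpull : ∀ y, y ≠ x → |B * (a * spiralWeight y * Real.exp (-(a * spiralLog y)))| •
      K (circ a B y) = w * spiralKernel μ a m g k x y := by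
    intro y hy
    have h0 : 0 ≤ B * (a * spiralWeight y * Real.exp (-(a * spiralLog y))) := by
      have := spiralWeight_pos y
      positivity
    rw [abs_of_nonneg h0, hK y hy, Complex.real_smul, hw, hΓ, spiralKernel, circ, mul_sub (a : ℂ),
      sub_eq_add_neg (a * _ : ℂ) (a * _), Complex.exp_add]
    have e1 : Complex.exp (a * spiralLog x) * Complex.exp (-(a * spiralLog x)) = 1 := by
      rw [← Complex.exp_add, add_neg_cancel, Complex.exp_zero]
    push_cast
    rw [neg_neg]
    calc _ = B * (a * spiralWeight y * Complex.exp (-(a * spiralLog y))) *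
          (c / (1 - Complex.exp (m * ratePrim μ g k x - m * ratePrim μ g k y))) *
          (Complex.exp (a * spiralLog x) * Complex.exp (-(a * spiralLog x))) := by
          rw [e1, mul_one]
      _ = _ := by ring
  have hset : ∀ {s : Set ℝ}, MeasurableSet s → x ∉ s →
      IntegrableOn (spiralKernel μ a m g k x) s → IntegrableOn K (circ a B '' s) ∧
      ∫ y in circ a B '' s, K y = w * ∫ y in s, spiralKernel μ a m g k x y := by
    intro s hs hxs hintg
    have hne : ∀ y ∈ s, y ≠ x := fun y hy h => hxs (h ▸ hy)
    have hd : ∀ y ∈ s, HasDerivWithinAt (circ a B)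
        (B * (a * spiralWeight y * Real.exp (-(a * spiralLog y)))) s y := fun y _ =>
      (hasDerivAt_circ y).hasDerivWithinAt
    have hcongr : EqOn (fun y => |B * (a * spiralWeight y * Real.exp (-(a * spiralLog y)))| •
      K (circ a B y)) (fun y => w * spiralKernel μ a m g k x y) s := fun y hy => hpull y (hne y hy)
    constructor
    · rw [integrableOn_image_iff_integrableOn_abs_deriv_smul hs hd hm.injective.injOn,
        integrableOn_congr_fun hcongr hs]
      exact hintg.const_mul w
    · rw [integral_image_eq_integral_abs_deriv_smul hs hd hm.injective.injOn,
        setIntegral_congr_fun hs hcongr, integral_const_mul]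
  -- These are the distances in the logarithmic coordinate of the two ends of the interval of radius
  -- ε about Γ.
  set d : ℝ → ℝ := fun ε => circInv a B (Γ + ε) - x with hd
  set d' : ℝ → ℝ := fun ε => x - circInv a B (Γ - ε) with hd'
  have hinv : circInv a B Γ = x := hm.injective (circ_circInv ha hB hΓ0)
  have hdpos : ∀ ε, 0 < ε → ε < -Γ → 0 < d ε := by
    intro ε h1 h2
    rw [hd]
    simp only [sub_pos]
    rw [← hm.lt_iff_lt, circ_circInv ha hB (by linarith)]
    linarith
  have hdpos' : ∀ ε, 0 < ε → 0 < d' ε := by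
    intro ε h1
    rw [hd']
    simp only [sub_pos]
    rw [← hm.lt_iff_lt, circ_circInv ha hB (by linarith)]
    linarith
  have hdecomp : ∀ ε, 0 < ε → ε < -Γ → Iio 0 \ Ioo (Γ - ε) (Γ + ε) =
      circ a B '' Ici (x + d ε) ∪ circ a B '' Iic (x - d' ε) := by
    intro ε h1 h2
    rw [circ_image_Ici ha hB, circ_image_Iic ha hB]
    simp only [hd, hd', add_sub_cancel, sub_sub_cancel]
    rw [circ_circInv ha hB (by linarith), circ_circInv ha hB (by linarith)]
    ext z
    simp only [Set.mem_sdiff, mem_Iio, mem_Ioo, mem_union, mem_Ico, mem_Iic, not_and, not_lt]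
    constructor
    · rintro ⟨z0, hz⟩
      rcases le_or_gt z (Γ - ε) with h | h
      · exact Or.inr h
      · exact Or.inl ⟨hz h, z0⟩
    · rintro (⟨z1, z2⟩ | z1)
      · exact ⟨z2, fun _ => z1⟩
      · exact ⟨by linarith, fun h => absurd z1 (not_le.2 h)⟩
  have hin : ∀ ε, 0 < ε → ε < -Γ → IntegrableOn K (circ a B '' Ici (x + d ε)) ∧
      ∫ y in circ a B '' Ici (x + d ε), K y =
        w * ∫ y in Ioi (x + d ε), spiralKernel μ a m g k x y := by
    intro ε h1 h2
    have := hset (measurableSet_Ici (a := x + d ε)) (by simpa using hdpos ε h1 h2)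
      ((integrableOn_Ici_iff_integrableOn_Ioi).2
        (integrableOn_spiralKernel_inner hμ hg hk he hκ ha (hdpos ε h1 h2)).1)
    rwa [integral_Ici_eq_integral_Ioi] at this
  have hout : ∀ ε, 0 < ε → IntegrableOn K (circ a B '' Iic (x - d' ε)) ∧
      ∫ y in circ a B '' Iic (x - d' ε), K y =
        w * ∫ y in Iic (x - d' ε), spiralKernel μ a m g k x y := fun ε h1 =>
    hset measurableSet_Iic (by simpa using hdpos' ε h1)
      (integrableOn_spiralKernel_outer hμ hg hk he hκ (hdpos' ε h1)).1
  have hsmall : ∀ᶠ ε : ℝ in 𝓝[>] 0, 0 < ε ∧ ε < -Γ := Ioo_mem_nhdsGT (by linarith)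
  refine HasPV.of_small (neg_pos.2 hΓ0) (fun ε h1 h2 => ?_) ?_
  · rw [hdecomp ε h1 h2]
    exact (hin ε h1 h2).1.union (hout ε h1).1
  · have hci := hasDerivAt_circInv (a := a) hΓ0 hB
    have hlog := tendsto_log_sub_log_of_hasDerivAt hci (by
      have := Real.exp_pos (-(Real.log (-Γ / B) / a))
      have : 0 < a * -Γ := mul_pos ha (by linarith)
      positivity)
    rw [hinv] at hlog
    have hcont := hci.continuousAt
    have t1 : Tendsto d (𝓝[>] 0) (𝓝[>] 0) := by
      refine tendsto_nhdsWithin_iff.2 ⟨?_, hsmall.mono fun ε h => hdpos ε h.1 h.2⟩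
      have h1 : Tendsto (fun ε : ℝ => Γ + ε) (𝓝[>] 0) (𝓝 Γ) := by
        have : Continuous fun ε : ℝ => Γ + ε := by fun_prop
        simpa using (this.tendsto 0).mono_left nhdsWithin_le_nhds
      have h2 := (hcont.tendsto.comp h1).sub_const x
      rwa [hinv, sub_self] at h2
    have t2 : Tendsto d' (𝓝[>] 0) (𝓝[>] 0) := by
      refine tendsto_nhdsWithin_iff.2 ⟨?_, hsmall.mono fun ε h => hdpos' ε h.1⟩
      have h1 : Tendsto (fun ε : ℝ => Γ - ε) (𝓝[>] 0) (𝓝 Γ) := by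
        have : Continuous fun ε : ℝ => Γ - ε := by fun_prop
        simpa using (this.tendsto 0).mono_left nhdsWithin_le_nhds
      have h2 := (hcont.tendsto.comp h1).const_sub x
      rwa [hinv, sub_self] at h2
    have hmain := (tendsto_integral_spiralKernel hμ hg hk he hκ ha hv t1 t2 hlog).const_mul w
    refine hmain.congr' ?_
    filter_upwards [hsmall] with ε hε
    have hdisj : Disjoint (circ a B '' Ici (x + d ε)) (circ a B '' Iic (x - d' ε)) := by
      rw [disjoint_image_iff hm.injective, Set.disjoint_left]
      intro y h1 h2
      have := hdpos ε hε.1 hε.2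
      have := hdpos' ε hε.1
      rw [mem_Ici] at h1
      rw [mem_Iic] at h2
      linarith
    rw [hdecomp ε hε.1 hε.2, setIntegral_union hdisj ?_ (hin ε hε.1 hε.2).1 (hout ε hε.1).1,
      (hin ε hε.1 hε.2).2, (hout ε hε.1).2, mul_add]
    rw [circ_image_Iic ha hB]
    exact measurableSet_Iic


/-! ### Principal values and the partial fraction over the branches. -/

theorem HasPV.sub {f g : ℝ → ℂ} {Γ : ℝ} {v w : ℂ} (hf : HasPV f Γ v) (hg : HasPV g Γ w) :
    HasPV (fun x => f x - g x) Γ (v - w) := by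
  refine ⟨fun ε hε => (hf.1 ε hε).sub (hg.1 ε hε), (hf.2.sub hg.2).congr' ?_⟩
  filter_upwards [eventually_mem_nhdsWithin] with ε hε
  exact (integral_sub (hf.1 ε hε) (hg.1 ε hε)).symm

theorem HasPV.sum {ι : Type*} {s : Finset ι} {f : ι → ℝ → ℂ} {Γ : ℝ} {v : ι → ℂ}
    (hf : ∀ i ∈ s, HasPV (f i) Γ (v i)) :
    HasPV (fun x => ∑ i ∈ s, f i x) Γ (∑ i ∈ s, v i) := by
  refine ⟨fun ε hε => integrable_finsetSum s fun i hi => (hf i hi).1 ε hε,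
    (tendsto_finsetSum s fun i hi => (hf i hi).2).congr' ?_⟩
  filter_upwards [eventually_mem_nhdsWithin] with ε hε
  exact (integral_finsetSum s fun i hi => (hf i hi).1 ε hε).symm

/-- Dominated convergence: the removed interval shrinks to a single point. -/
theorem HasPV.of_integrableOn {f : ℝ → ℂ} (hf : IntegrableOn f (Iio 0)) (Γ : ℝ) :
    HasPV f Γ (∫ x in Iio 0, f x) := by
  refine ⟨fun ε _ => hf.mono_set sdiff_subset, ?_⟩
  have hm : ∀ ε : ℝ, MeasurableSet (Ioo (Γ - ε) (Γ + ε))ᶜ := fun ε => measurableSet_Ioo.compl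
  have hrw : ∀ ε : ℝ, ∫ x in Iio 0 \ Ioo (Γ - ε) (Γ + ε), f x =
      ∫ x in Iio 0, (Ioo (Γ - ε) (Γ + ε))ᶜ.indicator f x := by
    intro ε
    rw [setIntegral_indicator (hm ε)]
    rfl
  simp_rw [hrw]
  refine tendsto_integral_filter_of_dominated_convergence (fun x => ‖f x‖)
    (Eventually.of_forall fun ε => hf.1.indicator (hm ε))
    (Eventually.of_forall fun ε => ae_of_all _ fun x => norm_indicator_le_norm_self _ _)
    hf.norm ?_
  have hne : ∀ᵐ x ∂(volume.restrict (Iio (0 : ℝ))), x ≠ Γ :=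
    ae_restrict_of_ae (Measure.ae_ne volume Γ)
  filter_upwards [hne] with x hx
  refine tendsto_const_nhds.congr' ?_
  have hd : 0 < |x - Γ| := abs_pos.2 (sub_ne_zero.2 hx)
  filter_upwards [Ioo_mem_nhdsGT hd] with ε hε
  rw [indicator_of_mem]
  intro h
  have : |x - Γ| < ε := abs_lt.2 ⟨by linarith [h.1], by linarith [h.2]⟩
  exact absurd this (not_lt.2 hε.2.le)

theorem isPrimitiveRoot_xiRoot {m : ℕ} (hm : m ≠ 0) : IsPrimitiveRoot (xiRoot m) m :=
  Complex.isPrimitiveRoot_exp m hm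

/-- The partial fraction expansion of `m / (1 - u ^ m)`. -/
theorem sum_inv_one_sub_pow_mul {m : ℕ} {ξ u : ℂ} (hξ : IsPrimitiveRoot ξ m) (hm : 0 < m)
    (hu : u ^ m ≠ 1) : ∑ k ∈ Finset.range m, (1 - ξ ^ k * u)⁻¹ = m / (1 - u ^ m) := by
  have hu' : 1 - u ^ m ≠ 0 := sub_ne_zero.2 hu.symm
  have hterm : ∀ k, (1 - ξ ^ k * u)⁻¹ =
      (∑ j ∈ Finset.range m, (ξ ^ k * u) ^ j) / (1 - u ^ m) := by
    intro k
    have h1 : (ξ ^ k * u) ^ m = u ^ m := by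
      rw [mul_pow, ← pow_mul, mul_comm k m, pow_mul, hξ.pow_eq_one, one_pow, one_mul]
    have h2 := mul_neg_geom_sum (ξ ^ k * u) m
    rw [h1] at h2
    have h3 : 1 - ξ ^ k * u ≠ 0 := by
      intro h
      rw [h, zero_mul] at h2
      exact hu' h2.symm
    rw [eq_div_iff hu', ← h2, inv_mul_cancel_left₀ h3]
  rw [Finset.sum_congr rfl fun k _ => hterm k, ← Finset.sum_div, Finset.sum_comm]
  congr 1
  -- Orthogonality of the m-th roots of unity: only the power j = 0 survives the sum over k.
  have hj : ∀ j ∈ Finset.range m, ∑ k ∈ Finset.range m, (ξ ^ k * u) ^ j =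
      if j = 0 then (m : ℂ) else 0 := by
    intro j hj
    split_ifs with h
    · simp [h]
    · have h1 : ∀ k, (ξ ^ k * u) ^ j = (ξ ^ j) ^ k * u ^ j := by
        intro k; rw [mul_pow, ← pow_mul, ← pow_mul, mul_comm k j]
      rw [Finset.sum_congr rfl fun k _ => h1 k, ← Finset.sum_mul]
      have h2 : ξ ^ j ≠ 1 := hξ.pow_ne_one_of_pos_of_lt h (Finset.mem_range.1 hj)
      have h3 := mul_neg_geom_sum (ξ ^ j) m
      rw [← pow_mul, mul_comm j m, pow_mul, hξ.pow_eq_one, one_pow, sub_self] at h3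
      rcases mul_eq_zero.1 h3 with h4 | h4
      · exact absurd (sub_eq_zero.1 h4).symm h2
      · rw [h4, zero_mul]
  rw [Finset.sum_congr rfl hj, Finset.sum_ite_eq' (Finset.range m) 0 (fun _ => (m : ℂ)),
    if_pos (Finset.mem_range.2 hm)]

theorem branchKernel_eq {m k : ℕ} {w : ℝ → ℂ} {Γ Γ' : ℝ} (hw : w Γ ≠ 0) :
    branchKernel m k w Γ Γ' = (w Γ)⁻¹ * (1 - xiRoot m ^ k * (w Γ' / w Γ))⁻¹ := by
  unfold branchKernel
  rw [← mul_inv, one_div, mul_sub, mul_one]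
  congr 2
  field_simp

theorem sum_branchKernel {m : ℕ} (hm : 0 < m) {w : ℝ → ℂ} {Γ Γ' : ℝ} (hw : w Γ ≠ 0)
    (hu : (w Γ' / w Γ) ^ m ≠ 1) : ∑ k ∈ Finset.range m, branchKernel m k w Γ Γ' =
      m / w Γ / (1 - (w Γ' / w Γ) ^ m) := by
  rw [Finset.sum_congr rfl fun k _ => branchKernel_eq hw, ← Finset.mul_sum,
    sum_inv_one_sub_pow_mul (isPrimitiveRoot_xiRoot hm.ne') hm hu]
  ring


/-! ### Geometry of the spiral: angle, radius and the factor Q. -/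

theorem integrableOn_Ioi_comp_neg {E : Type*} [NormedAddCommGroup E] {f : ℝ → E} {c : ℝ} :
    IntegrableOn (fun y => f (-y)) (Ioi (-c)) ↔ IntegrableOn f (Iic c) := by
  rw [← (Measure.measurePreserving_neg (volume : Measure ℝ)).integrableOn_comp_preimage
    (Homeomorph.neg ℝ).measurableEmbedding (f := f)]
  have e : (Neg.neg : ℝ → ℝ) ⁻¹' Iic c = Ici (-c) := by
    ext y; simp only [mem_preimage, mem_Iic, mem_Ici, neg_le]
  rw [e, integrableOn_Ici_iff_integrableOn_Ioi]
  rfl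

theorem integrableOn_Iic_deriv_of_nonneg {f f' : ℝ → ℝ} {l c : ℝ}
    (hd : ∀ x, HasDerivAt f (f' x) x) (h0 : ∀ x, 0 ≤ f' x) (hl : Tendsto f atBot (𝓝 l)) :
    IntegrableOn f' (Iic c) := by
  rw [← integrableOn_Ioi_comp_neg]
  refine integrableOn_Ioi_deriv_of_nonneg' (g := fun y => -f (-y)) (l := -l)
    (fun x _ => ?_) (fun x _ => h0 _) ?_
  · exact ((hd (-x)).scomp x (hasDerivAt_neg x)).neg.congr_deriv (by simp)
  · exact (hl.comp tendsto_neg_atTop_atBot).neg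

theorem hasDerivAt_exp_spiralLog (x : ℝ) :
    HasDerivAt (fun x => Real.exp (spiralLog x)) (1 - spiralWeight x) x := by
  rw [one_sub_spiralWeight]
  exact (hasDerivAt_spiralLog x).exp

theorem tendsto_exp_spiralLog_atBot : Tendsto (fun x => Real.exp (spiralLog x)) atBot (𝓝 0) :=
  Real.tendsto_exp_atBot.comp tendsto_spiralLog_atBot

theorem tendsto_exp_spiralLog_atTop : Tendsto (fun x => Real.exp (spiralLog x)) atTop atTop :=
  Real.tendsto_exp_atTop.comp tendsto_spiralLog_atTop

theorem spiralWeight_lt_one (x : ℝ) : spiralWeight x < 1 := by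
  have := one_sub_spiralWeight x
  have := mul_pos (Real.exp_pos (spiralLog x)) (spiralWeight_pos x)
  linarith

theorem tendsto_spiralWeight_atBot : Tendsto spiralWeight atBot (𝓝 1) := by
  have h : Tendsto (fun x => (1 + Real.exp (spiralLog x))⁻¹) atBot (𝓝 (1 + 0)⁻¹) :=
    (tendsto_exp_spiralLog_atBot.const_add 1).inv₀ (by norm_num)
  simpa using! h

theorem hasDerivAt_log_one_add (x : ℝ) : HasDerivAt (fun x => Real.log (1 + Real.exp (spiralLog x)))
    (spiralWeight x * (1 - spiralWeight x)) x := by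
  refine (((hasDerivAt_exp_spiralLog x).const_add 1).log ?_).congr_deriv ?_
  · have := Real.exp_pos (spiralLog x)
    positivity
  · rw [div_eq_mul_inv, mul_comm]; rfl

theorem tendsto_log_one_add_atBot :
    Tendsto (fun x => Real.log (1 + Real.exp (spiralLog x))) atBot (𝓝 0) := by
  have h := (tendsto_exp_spiralLog_atBot.const_add 1).log (by norm_num)
  simpa using h

/-- The primitive is log(1+T), which vanishes at the outer end; this bounds the deviation of the
angle from T. -/
theorem integrableOn_weight_mul_one_sub (x : ℝ) :
    IntegrableOn (fun y => spiralWeight y * (1 - spiralWeight y)) (Iic x) ∧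
      ∫ y in Iic x, spiralWeight y * (1 - spiralWeight y) =
        Real.log (1 + Real.exp (spiralLog x)) := by
  have hi : IntegrableOn (fun y => spiralWeight y * (1 - spiralWeight y)) (Iic x) :=
    integrableOn_Iic_deriv_of_nonneg hasDerivAt_log_one_add (fun y =>
      mul_nonneg (spiralWeight_pos y).le (by linarith [spiralWeight_le_one y]))
      tendsto_log_one_add_atBot
  refine ⟨hi, ?_⟩
  rw [integral_Iic_of_hasDerivAt_of_tendsto' (fun y _ => hasDerivAt_log_one_add y) hi
    tendsto_log_one_add_atBot, sub_zero]

/-- The real coefficient `Q` attached to a profile `g` and its conjugate. -/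
noncomputable def realQ (g : ℝ → ℂ) (x : ℝ) : ℝ :=
  (coeffQ g (fun y => (starRingEnd ℂ) (g y)) x).re

/-- The angular speed in the logarithmic coordinate. -/
noncomputable def angleDens (g : ℝ → ℂ) (x : ℝ) : ℝ :=
  (1 - spiralWeight x) * ((1 + (g x).re) / realQ g x)

/-- The polar angle of the spiral. -/
noncomputable def angleFn (g : ℝ → ℂ) (x : ℝ) : ℝ :=
  Real.exp (spiralLog x) + ∫ y in Iic x, (angleDens g y - (1 - spiralWeight y))

/-- The radius of the spiral. -/
noncomputable def radiusFn (μ : ℝ) (g : ℝ → ℂ) (x : ℝ) : ℝ :=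
  √(realQ g x / (2 * Real.pi)) * Real.exp (-(μ * spiralLog x))

/-- The spiral in the complex plane. -/
noncomputable def sheetProfile (μ : ℝ) (g : ℝ → ℂ) (x : ℝ) : ℂ :=
  radiusFn μ g x * Complex.exp (Complex.I * angleFn g x)

section Profile

variable {μ e : ℝ} {g : ℝ → ℂ}

/-- The product of i with g - ḡ is real. -/
theorem coeffQ_eq_realQ (g : ℝ → ℂ) (x : ℝ) :
    coeffQ g (fun y => (starRingEnd ℂ) (g y)) x = realQ g x := by
  refine (Complex.conj_eq_iff_re.1 ?_).symm
  unfold coeffQ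
  rw [map_add, map_one, map_mul, Complex.conj_I, ← integral_conj, neg_mul, ← mul_neg,
    ← integral_neg]
  congr 3
  funext y
  simp only [map_mul, map_sub, map_one, Complex.conj_conj, Complex.conj_ofReal]
  ring

theorem abs_realQ_sub_one_le (hg : InBall e g) (x : ℝ) : |realQ g x - 1| ≤ 2 * e * spiralWeight x := by
  have h := norm_coeffQ_sub_one_le hg hg.conj x
  rw [coeffQ_eq_realQ] at h
  have e1 : (realQ g x : ℂ) - 1 = ((realQ g x - 1 : ℝ) : ℂ) := by push_cast; ring
  rwa [e1, Complex.norm_real, Real.norm_eq_abs] at h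

theorem realQ_bounds (hg : InBall e g) (he : e ≤ 1 / 1000) (x : ℝ) :
    1 / 2 ≤ realQ g x ∧ realQ g x ≤ 2 := by
  have h := abs_le.1 (abs_realQ_sub_one_le hg x)
  have h0 := spiralWeight_pos x
  have h1 := spiralWeight_le_one x
  have h2 := hg.nonneg
  constructor <;> nlinarith [h.1, h.2]

theorem hasDerivAt_realQ (hg : InBall e g) (x : ℝ) :
    HasDerivAt (realQ g) (2 * (g x).im * (1 - spiralWeight x)) x := by
  have h := Complex.reCLM.hasFDerivAt.comp_hasDerivAt x (hasDerivAt_coeffQ hg hg.conj x)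
  refine h.congr_deriv ?_
  have e1 : g x - (starRingEnd ℂ) (g x) = ((2 * (g x).im : ℝ) : ℂ) * Complex.I :=
    Complex.sub_conj (g x)
  have e2 : -Complex.I * ((g x - (starRingEnd ℂ) (g x)) * (1 - spiralWeight x)) =
      ((2 * (g x).im * (1 - spiralWeight x) : ℝ) : ℂ) := by
    rw [e1]
    push_cast
    linear_combination (-(2 * ((g x).im : ℂ) * (1 - spiralWeight x))) * Complex.I_mul_I
  rw [Complex.reCLM_apply, e2, Complex.ofReal_re]

theorem continuous_realQ (hg : InBall e g) : Continuous (realQ g) :=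
  continuous_iff_continuousAt.2 fun x => (hasDerivAt_realQ hg x).continuousAt

theorem abs_re_le (hg : InBall e g) (x : ℝ) : |(g x).re| ≤ e * spiralWeight x ^ 2 :=
  (Complex.abs_re_le_norm _).trans (hg.norm_le x)

theorem abs_im_le (hg : InBall e g) (x : ℝ) : |(g x).im| ≤ e * spiralWeight x ^ 2 :=
  (Complex.abs_im_le_norm _).trans (hg.norm_le x)

theorem abs_speed_sub_one_le (hg : InBall e g) (he : e ≤ 1 / 1000) (x : ℝ) :
    |(1 + (g x).re) / realQ g x - 1| ≤ 1 / 100 * spiralWeight x := by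
  have hq := (realQ_bounds hg he x).1
  have h0 := spiralWeight_pos x
  have h1 := spiralWeight_le_one x
  have h2 := hg.nonneg
  have e1 : (1 + (g x).re) / realQ g x - 1 = ((g x).re - (realQ g x - 1)) / realQ g x := by
    field_simp
    ring
  rw [e1, abs_div, abs_of_pos (by linarith : 0 < realQ g x), div_le_iff₀ (by linarith)]
  have e2 := (abs_sub (g x).re (realQ g x - 1)).trans
    (add_le_add (abs_re_le hg x) (abs_realQ_sub_one_le hg x))
  refine e2.trans ?_
  have e3 : e * spiralWeight x ^ 2 ≤ 1 / 1000 * spiralWeight x := by nlinarith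
  nlinarith

theorem angleDens_bounds (hg : InBall e g) (he : e ≤ 1 / 1000) (x : ℝ) :
    |angleDens g x - (1 - spiralWeight x)| ≤
      1 / 100 * (spiralWeight x * (1 - spiralWeight x)) := by
  have h1 : 0 ≤ 1 - spiralWeight x := by linarith [spiralWeight_le_one x]
  have e1 : angleDens g x - (1 - spiralWeight x) =
      (1 - spiralWeight x) * ((1 + (g x).re) / realQ g x - 1) := by unfold angleDens; ring
  rw [e1, abs_mul, abs_of_nonneg h1]
  calc _ ≤ (1 - spiralWeight x) * (1 / 100 * spiralWeight x) := by
        gcongr; exact abs_speed_sub_one_le hg he x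
    _ = _ := by ring

theorem angleDens_pos (hg : InBall e g) (he : e ≤ 1 / 1000) (x : ℝ) : 0 < angleDens g x := by
  have h1 : 0 < 1 - spiralWeight x := by linarith [spiralWeight_lt_one x]
  have h2 := abs_le.1 (abs_speed_sub_one_le hg he x)
  exact mul_pos h1 (by linarith [h2.1, spiralWeight_le_one x])

theorem continuous_angleDens (hg : InBall e g) (he : e ≤ 1 / 1000) : Continuous (angleDens g) := by
  have h1 := continuous_spiralWeight
  have h2 := hg.continuous
  have h3 := continuous_realQ hg
  have h4 : ∀ x, realQ g x ≠ 0 := fun x => by linarith [(realQ_bounds hg he x).1]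
  unfold angleDens
  exact (continuous_const.sub h1).mul ((continuous_const.add (Complex.continuous_re.comp h2)).div h3 h4)

theorem integrableOn_angle (hg : InBall e g) (he : e ≤ 1 / 1000) (x : ℝ) :
    IntegrableOn (fun y => angleDens g y - (1 - spiralWeight y)) (Iic x) :=
  Integrable.mono' ((integrableOn_weight_mul_one_sub x).1.const_mul (1 / 100))
    ((continuous_angleDens hg he).sub
      (continuous_const.sub continuous_spiralWeight)).aestronglyMeasurable
    (ae_of_all _ fun y => angleDens_bounds hg he y)

theorem abs_angleFn_sub_le (hg : InBall e g) (he : e ≤ 1 / 1000) (x : ℝ) :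
    |angleFn g x - Real.exp (spiralLog x)| ≤ 1 / 100 * Real.log (1 + Real.exp (spiralLog x)) := by
  unfold angleFn
  rw [add_sub_cancel_left, ← (integrableOn_weight_mul_one_sub x).2, ← integral_const_mul]
  refine norm_integral_le_of_norm_le (f := fun y => angleDens g y - (1 - spiralWeight y))
    ((integrableOn_weight_mul_one_sub x).1.const_mul (1 / 100)) (ae_of_all _ fun y => ?_)
  exact angleDens_bounds hg he y

theorem angleFn_bounds (hg : InBall e g) (he : e ≤ 1 / 1000) (x : ℝ) :
    1 / 2 * Real.exp (spiralLog x) ≤ angleFn g x ∧ angleFn g x ≤ 2 * Real.exp (spiralLog x) := by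
  have h := abs_le.1 (abs_angleFn_sub_le hg he x)
  have h0 := Real.exp_pos (spiralLog x)
  have h1 := Real.log_le_sub_one_of_pos (by linarith : 0 < 1 + Real.exp (spiralLog x))
  constructor <;> linarith [h.1, h.2]

theorem angleFn_pos (hg : InBall e g) (he : e ≤ 1 / 1000) (x : ℝ) : 0 < angleFn g x :=
  lt_of_lt_of_le (by have := Real.exp_pos (spiralLog x); positivity) (angleFn_bounds hg he x).1

theorem hasDerivAt_angleFn (hg : InBall e g) (he : e ≤ 1 / 1000) (x : ℝ) :
    HasDerivAt (angleFn g) (angleDens g x) x := by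
  set h : ℝ → ℝ := fun y => angleDens g y - (1 - spiralWeight y) with hh
  have hc : Continuous h := (continuous_angleDens hg he).sub
    (continuous_const.sub continuous_spiralWeight)
  have hI : HasDerivAt (fun x => ∫ y in (0:ℝ)..x, h y) (h x) x :=
    intervalIntegral.integral_hasDerivAt_right (hc.intervalIntegrable _ _)
      hc.aestronglyMeasurable.stronglyMeasurableAtFilter hc.continuousAt
  have heq : angleFn g = fun x => Real.exp (spiralLog x) +
      ((∫ y in Iic 0, h y) + ∫ y in (0:ℝ)..x, h y) := by
    funext x
    unfold angleFn
    rw [← intervalIntegral.integral_Iic_sub_Iic (integrableOn_angle hg he 0)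
      (integrableOn_angle hg he x)]
    ring
  rw [heq]
  exact ((hasDerivAt_exp_spiralLog x).add (hI.const_add _)).congr_deriv (by simp only [hh]; ring)

theorem strictMono_angleFn (hg : InBall e g) (he : e ≤ 1 / 1000) : StrictMono (angleFn g) :=
  strictMono_of_hasDerivAt_pos (hasDerivAt_angleFn hg he) (angleDens_pos hg he)

theorem tendsto_angleFn_atTop (hg : InBall e g) (he : e ≤ 1 / 1000) :
    Tendsto (angleFn g) atTop atTop :=
  tendsto_atTop_mono (fun x => (angleFn_bounds hg he x).1)
    (tendsto_exp_spiralLog_atTop.const_mul_atTop (by norm_num))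

theorem tendsto_angleFn_atBot (hg : InBall e g) (he : e ≤ 1 / 1000) :
    Tendsto (angleFn g) atBot (𝓝 0) := by
  refine squeeze_zero (fun x => (angleFn_pos hg he x).le) (fun x => (angleFn_bounds hg he x).2) ?_
  simpa using tendsto_exp_spiralLog_atBot.const_mul 2

/-- The angle deviates from T by at most a multiple of log(1+T). -/
theorem tendsto_angleFn_div (hg : InBall e g) (he : e ≤ 1 / 1000) :
    Tendsto (fun x => angleFn g x / Real.exp (spiralLog x)) atTop (𝓝 1) := by
  have hlog : Tendsto (fun T : ℝ => Real.log (1 + T) / T) atTop (𝓝 0) := by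
    have h1 : Tendsto (fun T : ℝ => Real.log (1 + T) / (1 + T)) atTop (𝓝 0) :=
      (Real.isLittleO_log_id_atTop.tendsto_div_nhds_zero).comp
        (tendsto_atTop_add_const_left _ 1 tendsto_id)
    have h2 : Tendsto (fun T : ℝ => 1 + T⁻¹) atTop (𝓝 (1 + 0)) :=
      tendsto_inv_atTop_zero.const_add 1
    have h3 := h1.mul h2
    rw [zero_mul] at h3
    refine h3.congr' ?_
    filter_upwards [eventually_gt_atTop 0] with T hT
    field_simp
    ring
  have h4 := (hlog.comp tendsto_exp_spiralLog_atTop).const_mul (1 / 100)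
  rw [mul_zero] at h4
  refine tendsto_iff_norm_sub_tendsto_zero.2 (squeeze_zero (fun x => norm_nonneg _) (fun x => ?_) h4)
  have h0 := Real.exp_pos (spiralLog x)
  have e1 : angleFn g x / Real.exp (spiralLog x) - 1 =
      (angleFn g x - Real.exp (spiralLog x)) / Real.exp (spiralLog x) := by field_simp
  rw [Real.norm_eq_abs, e1, abs_div, abs_of_pos h0]
  simp only [Function.comp_apply]
  rw [← mul_div_assoc]
  gcongr
  exact abs_angleFn_sub_le hg he x

theorem radiusFn_pos (hg : InBall e g) (he : e ≤ 1 / 1000) (x : ℝ) : 0 < radiusFn μ g x := by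
  have := (realQ_bounds hg he x).1
  have : 0 < √(realQ g x / (2 * Real.pi)) := Real.sqrt_pos.2 (div_pos (by linarith) (by positivity))
  unfold radiusFn
  positivity

theorem hasDerivAt_radiusFn (hg : InBall e g) (he : e ≤ 1 / 1000) (x : ℝ) :
    HasDerivAt (radiusFn μ g) (radiusFn μ g x *
      ((1 - spiralWeight x) * (g x).im / realQ g x - μ * spiralWeight x)) x := by
  have hq : 0 < realQ g x := by linarith [(realQ_bounds hg he x).1]
  have hq' : 0 < realQ g x / (2 * Real.pi) := by positivity
  have h1 := ((hasDerivAt_realQ hg x).div_const (2 * Real.pi)).sqrt hq'.ne'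
  have h2 := ((hasDerivAt_spiralLog x).const_mul μ).fun_neg.exp
  refine (h1.mul h2).congr_deriv ?_
  unfold radiusFn
  set s := √(realQ g x / (2 * Real.pi)) with hs
  have hs0 : 0 < s := Real.sqrt_pos.2 hq'
  have hss : s * s = realQ g x / (2 * Real.pi) := Real.mul_self_sqrt hq'.le
  have hQ : realQ g x = s * s * (2 * Real.pi) := by rw [hss]; field_simp
  rw [hQ]
  field_simp
  ring

/-- The perturbation is O(eσ²) and μσ dominates it, also near the centre where both vanish. -/
theorem radius_rate_neg (hμ : 1 / 2 < μ) (hg : InBall e g) (he : e ≤ 1 / 1000) (x : ℝ) :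
    (1 - spiralWeight x) * (g x).im / realQ g x - μ * spiralWeight x < 0 := by
  have hq := (realQ_bounds hg he x).1
  have h0 := spiralWeight_pos x
  have h1 := spiralWeight_lt_one x
  have h2 := hg.nonneg
  have h3 := (abs_le.1 (abs_im_le hg x)).2
  rw [sub_neg, div_lt_iff₀ (by linarith)]
  have h4 : (1 - spiralWeight x) * (g x).im ≤ 1 / 1000 * spiralWeight x := by
    calc _ ≤ (1 - spiralWeight x) * (e * spiralWeight x ^ 2) := by gcongr
      _ ≤ 1 * (1 / 1000 * spiralWeight x) := by
        refine mul_le_mul (by linarith) ?_ (by positivity) zero_le_one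
        nlinarith
      _ = _ := one_mul _
  have h5 : 1 / 2 * spiralWeight x * (1 / 2) ≤ μ * spiralWeight x * realQ g x := by
    gcongr
  linarith

theorem strictAnti_radiusFn (hμ : 1 / 2 < μ) (hg : InBall e g) (he : e ≤ 1 / 1000) :
    StrictAnti (radiusFn μ g) :=
  strictAnti_of_hasDerivAt_neg (hasDerivAt_radiusFn hg he) fun x =>
    mul_neg_of_pos_of_neg (radiusFn_pos hg he x) (radius_rate_neg hμ hg he x)

theorem radiusFn_bounds (hg : InBall e g) (he : e ≤ 1 / 1000) (x : ℝ) :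
    1 / 4 * Real.exp (-(μ * spiralLog x)) ≤ radiusFn μ g x ∧
      radiusFn μ g x ≤ Real.exp (-(μ * spiralLog x)) := by
  obtain ⟨h1, h2⟩ := realQ_bounds hg he x
  have hpi := Real.pi_gt_three
  have hpi4 := Real.pi_le_four
  unfold radiusFn
  constructor
  · gcongr
    refine Real.le_sqrt_of_sq_le ?_
    rw [le_div_iff₀ (by positivity)]
    nlinarith
  · refine mul_le_of_le_one_left (Real.exp_pos _).le (Real.sqrt_le_one.2 ?_)
    rw [div_le_one (by positivity)]
    linarith

theorem tendsto_radiusFn_atTop (hμ : 1 / 2 < μ) (hg : InBall e g) (he : e ≤ 1 / 1000) :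
    Tendsto (radiusFn μ g) atTop (𝓝 0) := by
  refine squeeze_zero (fun x => (radiusFn_pos hg he x).le) (fun x => (radiusFn_bounds hg he x).2) ?_
  exact Real.tendsto_exp_atBot.comp (tendsto_neg_atTop_atBot.comp
    (tendsto_spiralLog_atTop.const_mul_atTop (by linarith)))

theorem tendsto_radiusFn_atBot (hμ : 1 / 2 < μ) (hg : InBall e g) (he : e ≤ 1 / 1000) :
    Tendsto (radiusFn μ g) atBot atTop := by
  refine tendsto_atTop_mono (fun x => (radiusFn_bounds hg he x).1)
    (Tendsto.const_mul_atTop (by norm_num) ?_)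
  exact Real.tendsto_exp_atTop.comp (tendsto_neg_atBot_atTop.comp
    (tendsto_spiralLog_atBot.const_mul_atBot (by linarith)))

/-- The majorant σ²(1-σ) is integrable over the whole line. The limit fixes the amplitude of the
initial data, and the uniform lower bound on Q keeps it positive. -/
theorem exists_tendsto_realQ_atBot (hg : InBall e g) (he : e ≤ 1 / 1000) :
    ∃ q, 0 < q ∧ Tendsto (realQ g) atBot (𝓝 q) := by
  have hmaj : Integrable fun y => spiralWeight y ^ 2 * (1 - spiralWeight y) := by
    rw [← integrableOn_univ, ← Iic_union_Ioi (a := (0 : ℝ))]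
    refine IntegrableOn.union ?_ (integrableOn_sq_mul_one_sub 0).1
    refine integrableOn_Iic_deriv_of_nonneg (f := fun y => -spiralWeight y) (l := -1)
      (fun y => (hasDerivAt_spiralWeight y).fun_neg.congr_deriv (by ring)) (fun y => ?_)
      tendsto_spiralWeight_atBot.neg
    exact mul_nonneg (sq_nonneg _) (by linarith [spiralWeight_le_one y])
  have hi : Integrable fun y => (g y - (starRingEnd ℂ) (g y)) * (1 - (spiralWeight y : ℂ)) :=
    Integrable.mono' (hmaj.const_mul (2 * e))
      (continuous_coeff_integrand hg hg.conj).aestronglyMeasurable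
      (ae_of_all _ (norm_coeff_integrand_le hg hg.conj))
  have ht := (aecover_Ioi (μ := volume) (tendsto_id (α := ℝ) (x := atBot))
    ).integral_tendsto_of_countably_generated hi
  have ht2 := (Complex.continuous_re.tendsto _).comp ((ht.const_mul Complex.I).const_add 1)
  refine ⟨_, ?_, ht2⟩
  refine lt_of_lt_of_le (by norm_num : (0 : ℝ) < 1 / 2) (ge_of_tendsto' ht2 fun x => ?_)
  exact (realQ_bounds hg he x).1

theorem tendsto_realQ_atTop (hg : InBall e g) : Tendsto (realQ g) atTop (𝓝 1) := by
  have h : Tendsto (fun x => 2 * e * spiralWeight x) atTop (𝓝 0) := by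
    simpa using tendsto_spiralWeight.const_mul (2 * e)
  exact tendsto_iff_norm_sub_tendsto_zero.2
    (squeeze_zero (fun x => norm_nonneg _) (abs_realQ_sub_one_le hg) h)

theorem sheetProfile_ne_zero (hg : InBall e g) (he : e ≤ 1 / 1000) (x : ℝ) :
    sheetProfile μ g x ≠ 0 :=
  mul_ne_zero (by exact_mod_cast (radiusFn_pos hg he x).ne') (Complex.exp_ne_zero _)

theorem norm_sheetProfile (hg : InBall e g) (he : e ≤ 1 / 1000) (x : ℝ) :
    ‖sheetProfile μ g x‖ = radiusFn μ g x := by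
  unfold sheetProfile
  rw [norm_mul, mul_comm Complex.I, Complex.norm_exp_ofReal_mul_I, mul_one, Complex.norm_real,
    Real.norm_eq_abs, abs_of_pos (radiusFn_pos hg he x)]

/-- For k = ḡ the real part of the rate is minus the logarithmic derivative of the radius, because
Q' = 2(1-σ) Im g, and its imaginary part is minus the angular speed. -/
theorem hasDerivAt_sheetProfile (hg : InBall e g) (he : e ≤ 1 / 1000) (x : ℝ) :
    HasDerivAt (sheetProfile μ g)
      (-spiralRate μ g (fun y => (starRingEnd ℂ) (g y)) x * sheetProfile μ g x) x := by
  have h1 := (hasDerivAt_radiusFn (μ := μ) hg he x).ofReal_comp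
  have h2 := (((hasDerivAt_angleFn hg he x).ofReal_comp).const_mul Complex.I).cexp
  refine (h1.mul h2).congr_deriv ?_
  have hq : (realQ g x : ℂ) ≠ 0 := by
    exact_mod_cast (by linarith [(realQ_bounds hg he x).1] : realQ g x ≠ 0)
  have e1 : (starRingEnd ℂ) (g x) = (g x).re - (g x).im * Complex.I := by
    conv_lhs => rw [← Complex.re_add_im (g x)]
    simp only [map_add, map_mul, Complex.conj_I, Complex.conj_ofReal]
    ring
  have e2 : spiralRate μ g (fun y => (starRingEnd ℂ) (g y)) x = μ * spiralWeight x -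
      Complex.I * (1 - spiralWeight x) * (1 + ((g x).re - (g x).im * Complex.I)) / realQ g x := by
    unfold spiralRate smoothRate roughRate
    simp only [coeffQ_eq_realQ, e1]
    field_simp
    ring
  rw [e2]
  unfold sheetProfile angleDens
  push_cast
  field_simp
  linear_combination ((radiusFn μ g x : ℂ) * (1 - spiralWeight x) * (g x).im) * Complex.I_mul_I

/-- The product of the profile with exp Ψ has zero derivative. -/
theorem sheetProfile_div (hμ : 1 / 2 < μ) (hg : InBall e g) (he : e ≤ 1 / 1000) (x y : ℝ) :
    sheetProfile μ g y / sheetProfile μ g x =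
      Complex.exp (ratePrim μ g (fun y => (starRingEnd ℂ) (g y)) x -
        ratePrim μ g (fun y => (starRingEnd ℂ) (g y)) y) := by
  set k : ℝ → ℂ := fun y => (starRingEnd ℂ) (g y) with hk
  have hd : ∀ z, HasDerivAt (fun z => sheetProfile μ g z * Complex.exp (ratePrim μ g k z)) 0 z :=
    fun z => ((hasDerivAt_sheetProfile hg he z).mul
      (hasDerivAt_ratePrim hμ hg hg.conj he z).cexp).congr_deriv (by ring)
  have hc := is_const_of_deriv_eq_zero (fun z => (hd z).differentiableAt) (fun z => (hd z).deriv) x y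
  have h0 := sheetProfile_ne_zero (μ := μ) hg he x
  rw [Complex.exp_sub, div_eq_div_iff h0 (Complex.exp_ne_zero _)]
  rw [mul_comm (Complex.exp _)]
  exact hc.symm

end Profile


/-! ### The sheet in time moves with its induced velocity. -/

/-- The self-similar vortex sheet generated by a profile. -/
noncomputable def spiralSheet (μ b : ℝ) (g : ℝ → ℂ) (t Γ : ℝ) : ℂ :=
  if t ≤ 0 then (((-((2 * μ - 1) / μ * Γ)) ^ (μ / (2 * μ - 1)) : ℝ) : ℂ)
  else ((b * t ^ μ : ℝ) : ℂ) *
    sheetProfile μ g (circInv (2 * μ - 1) (b ^ 2 * t ^ (2 * μ - 1)) Γ)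

theorem circInv_circ {a B : ℝ} (ha : 0 < a) (hB : 0 < B) (y : ℝ) :
    circInv a B (circ a B y) = y :=
  (strictMono_circ ha hB).injective (circ_circInv ha hB (circ_neg hB y))

/-- At fixed Γ, log T = log t + const; T is proportional to time. -/
theorem log_div_mul_rpow {a B t Γ : ℝ} (ha : 0 < a) (hB : 0 < B) (ht : 0 < t) (hΓ : Γ < 0) :
    -(Real.log (-Γ / (B * t ^ a)) / a) = Real.log t + -(Real.log (-Γ / B) / a) := by
  have h1 : -Γ ≠ 0 := by linarith
  have h2 : 0 < t ^ a := Real.rpow_pos_of_pos ht a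
  rw [Real.log_div h1 (by positivity), Real.log_div h1 hB.ne', Real.log_mul hB.ne' h2.ne',
    Real.log_rpow ht]
  field_simp
  ring

section Sheet

variable {μ b e : ℝ} {g : ℝ → ℂ}

theorem spiralSheet_of_pos {t : ℝ} (ht : 0 < t) (Γ : ℝ) :
    spiralSheet μ b g t Γ = ((b * t ^ μ : ℝ) : ℂ) *
      sheetProfile μ g (circInv (2 * μ - 1) (b ^ 2 * t ^ (2 * μ - 1)) Γ) :=
  if_neg (not_le.2 ht)

theorem spiralSheet_ne_zero (hg : InBall e g) (he : e ≤ 1 / 1000) (hb : 0 < b) {t : ℝ}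
    (ht : 0 < t) (Γ : ℝ) : spiralSheet μ b g t Γ ≠ 0 := by
  rw [spiralSheet_of_pos ht]
  refine mul_ne_zero ?_ (sheetProfile_ne_zero hg he _)
  exact_mod_cast (mul_pos hb (Real.rpow_pos_of_pos ht μ)).ne'

theorem spiralSheet_circ_div (hμ : 1 / 2 < μ) (hb : 0 < b) {t : ℝ} (ht : 0 < t) (x y : ℝ) :
    spiralSheet μ b g t (circ (2 * μ - 1) (b ^ 2 * t ^ (2 * μ - 1)) y) /
      spiralSheet μ b g t (circ (2 * μ - 1) (b ^ 2 * t ^ (2 * μ - 1)) x) =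
      sheetProfile μ g y / sheetProfile μ g x := by
  have hB : 0 < b ^ 2 * t ^ (2 * μ - 1) :=
    mul_pos (pow_pos hb 2) (Real.rpow_pos_of_pos ht _)
  have ha : 0 < 2 * μ - 1 := by linarith
  rw [spiralSheet_of_pos ht, spiralSheet_of_pos ht, circInv_circ ha hB, circInv_circ ha hB,
    mul_div_mul_left]
  exact_mod_cast (mul_pos hb (Real.rpow_pos_of_pos ht μ)).ne'

theorem norm_profile_div (hg : InBall e g) (he : e ≤ 1 / 1000) (x y : ℝ) :
    ‖sheetProfile μ g y / sheetProfile μ g x‖ = radiusFn μ g y / radiusFn μ g x := by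
  rw [norm_div, norm_sheetProfile hg he, norm_sheetProfile hg he]

/-- The radius is injective, so even the moduli differ: rotated copies of distinct points never
meet. -/
theorem pow_profile_div_ne_one (hμ : 1 / 2 < μ) (hg : InBall e g) (he : e ≤ 1 / 1000) {m : ℕ}
    (hm : 0 < m) {x y : ℝ} (hxy : y ≠ x) : (sheetProfile μ g y / sheetProfile μ g x) ^ m ≠ 1 := by
  intro h
  have h1 := congrArg norm h
  rw [norm_pow, norm_one, norm_profile_div hg he] at h1
  have hpos := radiusFn_pos (μ := μ) hg he
  have h2 := (pow_eq_one_iff_of_nonneg (div_pos (hpos y) (hpos x)).le hm.ne').1 h1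
  rw [div_eq_one_iff_eq (hpos x).ne'] at h2
  exact hxy ((strictAnti_radiusFn hμ hg he).injective h2)

/-- The velocity induced by the whole sheet, as a principal value. -/
theorem hasPV_sum_branchKernel (hμ : 1 / 2 < μ) (hg : InBall e g) (he : e ≤ 1 / 1000) (hb : 0 < b)
    {m : ℕ} (hm : 0 < m) (hκ : LargeFreq μ (2 * μ - 1) m) {t : ℝ} (ht : 0 < t) {x : ℝ}
    (hfix : HasSum (fun n : ℕ => ((2 * μ - 1 : ℝ) : ℂ) *
      diffTerm μ (2 * μ - 1) (((n : ℝ) + 1) * m) g (fun y => (starRingEnd ℂ) (g y)) x) (g x))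
    {Γ : ℝ} (hΓ : circ (2 * μ - 1) (b ^ 2 * t ^ (2 * μ - 1)) x = Γ) :
    HasPV (fun Γ' => ∑ k ∈ Finset.range m, branchKernel m k (spiralSheet μ b g t) Γ Γ') Γ
      (m / spiralSheet μ b g t Γ * (-Γ : ℝ) * (1 + g x)) := by
  have hB : 0 < b ^ 2 * t ^ (2 * μ - 1) :=
    mul_pos (pow_pos hb 2) (Real.rpow_pos_of_pos ht _)
  subst hΓ
  refine hasPV_of_comp_circ hμ hg hg.conj he hκ (by linarith) hB hfix fun y hy => ?_
  have hdiv := spiralSheet_circ_div (g := g) hμ hb ht x y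
  rw [sum_branchKernel hm (spiralSheet_ne_zero hg he hb ht _)
    (by rw [hdiv]; exact pow_profile_div_ne_one hμ hg he hm hy), hdiv, sheetProfile_div hμ hg he,
    ← Complex.exp_nat_mul, mul_sub]
  rfl

theorem spiralRate_conj (hg : InBall e g) (he : e ≤ 1 / 1000) (x : ℝ) :
    spiralRate μ g (fun y => (starRingEnd ℂ) (g y)) x = μ * spiralWeight x -
      Complex.I * (1 - spiralWeight x) * (1 + (starRingEnd ℂ) (g x)) / realQ g x := by
  have hq : (realQ g x : ℂ) ≠ 0 := by
    exact_mod_cast (by linarith [(realQ_bounds hg he x).1] : realQ g x ≠ 0)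
  unfold spiralRate smoothRate roughRate
  simp only [coeffQ_eq_realQ]
  field_simp
  ring

/-- The velocity of the sheet. -/
theorem hasDerivAt_spiralSheet (hμ : 1 / 2 < μ) (hg : InBall e g) (he : e ≤ 1 / 1000) (hb : 0 < b)
    {t Γ : ℝ} (ht : 0 < t) (hΓ : Γ < 0) {x : ℝ}
    (hx : circInv (2 * μ - 1) (b ^ 2 * t ^ (2 * μ - 1)) Γ = x) :
    HasDerivAt (fun s => spiralSheet μ b g s Γ) (spiralSheet μ b g t Γ *
      (Complex.I * (Real.exp (spiralLog x) / t) * (1 + (starRingEnd ℂ) (g x)) / realQ g x)) t := by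
  have ha : 0 < 2 * μ - 1 := by linarith
  have hb2 : 0 < b ^ 2 := pow_pos hb 2
  set c : ℝ := -(Real.log (-Γ / b ^ 2) / (2 * μ - 1)) with hc
  have hX : ∀ s, 0 < s → circInv (2 * μ - 1) (b ^ 2 * s ^ (2 * μ - 1)) Γ =
      (Real.log s + c) + Real.exp (Real.log s + c) := by
    intro s hs
    unfold circInv
    rw [log_div_mul_rpow ha hb2 hs hΓ]
  have hℓ : spiralLog x = Real.log t + c := by rw [← hx, hX t ht, spiralLog_of_add_exp]
  have hd1 : HasDerivAt (fun s => (Real.log s + c) + Real.exp (Real.log s + c))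
      (t⁻¹ + Real.exp (Real.log t + c) * t⁻¹) t := by
    have h1 := (Real.hasDerivAt_log ht.ne').add_const c
    exact h1.add h1.exp
  have hd2 : HasDerivAt (fun s : ℝ => ((b * s ^ μ : ℝ) : ℂ)) ((b * (μ * t ^ (μ - 1)) : ℝ) : ℂ) t :=
    (((Real.hasDerivAt_rpow_const (Or.inl ht.ne')).const_mul b)).ofReal_comp
  have hx' : (Real.log t + c) + Real.exp (Real.log t + c) = x := by rw [← hX t ht, hx]
  have hd3 : HasDerivAt (fun s => sheetProfile μ g ((Real.log s + c) + Real.exp (Real.log s + c)))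
      ((t⁻¹ + Real.exp (Real.log t + c) * t⁻¹) •
        (-spiralRate μ g (fun y => (starRingEnd ℂ) (g y)) x * sheetProfile μ g x)) t := by
    have h4 : HasDerivAt (sheetProfile μ g)
        (-spiralRate μ g (fun y => (starRingEnd ℂ) (g y)) x * sheetProfile μ g x)
        ((Real.log t + c) + Real.exp (Real.log t + c)) := by
      rw [hx']
      exact hasDerivAt_sheetProfile hg he x
    exact h4.scomp t hd1
  have hd := hd2.mul hd3
  have hev : (fun s => spiralSheet μ b g s Γ) =ᶠ[𝓝 t] fun s => ((b * s ^ μ : ℝ) : ℂ) *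
      sheetProfile μ g ((Real.log s + c) + Real.exp (Real.log s + c)) := by
    filter_upwards [Ioi_mem_nhds ht] with s hs
    rw [spiralSheet_of_pos hs, hX s hs]
  refine (hd.congr_of_eventuallyEq hev).congr_deriv ?_
  rw [spiralSheet_of_pos ht, hx, hx', ← hℓ]
  have hq : (realQ g x : ℂ) ≠ 0 := by
    exact_mod_cast (by linarith [(realQ_bounds hg he x).1] : realQ g x ≠ 0)
  have htc : (t : ℂ) ≠ 0 := by exact_mod_cast ht.ne'
  have hT := Real.exp_pos (spiralLog x)
  have e1 : (t ^ (μ - 1) : ℝ) = t ^ μ / t := by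
    rw [Real.rpow_sub ht, Real.rpow_one]
  have e2 : (spiralWeight x : ℂ) = (1 + (Real.exp (spiralLog x) : ℂ))⁻¹ := by
    unfold spiralWeight; push_cast; rfl
  have e3 : (1 + (Real.exp (spiralLog x) : ℂ)) ≠ 0 := by
    exact_mod_cast (by linarith : 1 + Real.exp (spiralLog x) ≠ 0)
  rw [spiralRate_conj hg he, e1, e2, Complex.real_smul]
  push_cast at e3 ⊢
  field_simp
  ring

/-- This identity for |Z|² converts the Z* of the conjugated velocity into the 1/Z of the
Birkhoff–Rott integral. The factor Q it brings in cancels the Q in the angular velocity. -/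
theorem conj_spiralSheet_mul (hμ : 1 / 2 < μ) (hg : InBall e g) (he : e ≤ 1 / 1000) (hb : 0 < b)
    {t Γ : ℝ} (ht : 0 < t) {x : ℝ}
    (hx : circ (2 * μ - 1) (b ^ 2 * t ^ (2 * μ - 1)) x = Γ) :
    (starRingEnd ℂ) (spiralSheet μ b g t Γ) * spiralSheet μ b g t Γ =
      ((-Γ * t * realQ g x / (2 * Real.pi * Real.exp (spiralLog x)) : ℝ) : ℂ) := by
  have hB : 0 < b ^ 2 * t ^ (2 * μ - 1) :=
    mul_pos (pow_pos hb 2) (Real.rpow_pos_of_pos ht _)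
  have ha : 0 < 2 * μ - 1 := by linarith
  rw [mul_comm, Complex.mul_conj, Complex.normSq_eq_norm_sq]
  congr 1
  subst hx
  rw [spiralSheet_of_pos ht, circInv_circ ha hB, norm_mul, norm_sheetProfile hg he,
    Complex.norm_real, Real.norm_eq_abs, abs_of_pos (mul_pos hb (Real.rpow_pos_of_pos ht μ))]
  unfold radiusFn circ
  have hq : 0 ≤ realQ g x / (2 * Real.pi) :=
    div_nonneg (by linarith [(realQ_bounds hg he x).1]) (by positivity)
  have h1 : t ^ (2 * μ - 1) * t = t ^ μ * t ^ μ := by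
    rw [← Real.rpow_add ht, ← Real.rpow_add_one ht.ne']
    congr 1
    ring
  have h2 : Real.exp (-((2 * μ - 1) * spiralLog x)) = Real.exp (-(μ * spiralLog x)) *
      Real.exp (-(μ * spiralLog x)) * Real.exp (spiralLog x) := by
    rw [← Real.exp_add, ← Real.exp_add]
    congr 1
    ring
  have h3 := Real.exp_pos (spiralLog x)
  rw [mul_pow, mul_pow, mul_pow, Real.sq_sqrt hq, h2]
  calc _ = b ^ 2 * (t ^ μ * t ^ μ) * (realQ g x / (2 * Real.pi)) *
        (Real.exp (-(μ * spiralLog x)) * Real.exp (-(μ * spiralLog x))) := by ring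
    _ = _ := by
      rw [← h1]
      field_simp

/-- The sheet moves with the velocity it induces. -/
theorem hasDerivAt_conj_spiralSheet (hμ : 1 / 2 < μ) (hg : InBall e g) (he : e ≤ 1 / 1000)
    (hb : 0 < b) {m : ℕ} (hm : 0 < m) {t Γ : ℝ} (ht : 0 < t) {x : ℝ}
    (hx : circ (2 * μ - 1) (b ^ 2 * t ^ (2 * μ - 1)) x = Γ) :
    HasDerivAt (fun s => (starRingEnd ℂ) (spiralSheet μ b g s Γ))
      (1 / (2 * m * Real.pi * Complex.I) *
        (m / spiralSheet μ b g t Γ * (-Γ : ℝ) * (1 + g x))) t := by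
  have hB : 0 < b ^ 2 * t ^ (2 * μ - 1) :=
    mul_pos (pow_pos hb 2) (Real.rpow_pos_of_pos ht _)
  have ha : 0 < 2 * μ - 1 := by linarith
  have hΓ : Γ < 0 := hx ▸ circ_neg hB x
  have hd := hasDerivAt_spiralSheet hμ hg he hb ht hΓ (x := x) (by rw [← hx, circInv_circ ha hB])
  have hd' : HasDerivAt (fun s => (starRingEnd ℂ) (spiralSheet μ b g s Γ)) _ t :=
    (Complex.conjCLE.toContinuousLinearMap.hasFDerivAt.comp_hasDerivAt t hd)
  refine hd'.congr_deriv ?_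
  have hz := conj_spiralSheet_mul hμ hg he hb ht hx
  have hz0 := spiralSheet_ne_zero (μ := μ) hg he hb ht Γ
  have hq : (realQ g x : ℂ) ≠ 0 := by
    exact_mod_cast (by linarith [(realQ_bounds hg he x).1] : realQ g x ≠ 0)
  have htc : (t : ℂ) ≠ 0 := by exact_mod_cast ht.ne'
  have hmc : (m : ℂ) ≠ 0 := by exact_mod_cast hm.ne'
  have hpi : (Real.pi : ℂ) ≠ 0 := by exact_mod_cast Real.pi_ne_zero
  have hT : (Real.exp (spiralLog x) : ℂ) ≠ 0 := by
    exact_mod_cast (Real.exp_pos (spiralLog x)).ne'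
  have hconj : (starRingEnd ℂ) (spiralSheet μ b g t Γ) =
      ((-Γ * t * realQ g x / (2 * Real.pi * Real.exp (spiralLog x)) : ℝ) : ℂ) /
        spiralSheet μ b g t Γ := by rw [eq_div_iff hz0, hz]
  change (starRingEnd ℂ) (_ * _) = _
  simp only [map_mul, map_div₀, map_add, map_one, Complex.conj_I, Complex.conj_ofReal,
    Complex.conj_conj, hconj]
  generalize spiralSheet μ b g t Γ = Z at hz0
  push_cast at hT ⊢
  field_simp
  linear_combination ((Γ : ℂ) * (1 + g x)) * Complex.I_mul_I

end Sheet


/-! ### Separate convergence of the branches for μ < 1. -/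

section Branch

variable {μ b e : ℝ} {g : ℝ → ℂ}

theorem continuous_sheetProfile (hg : InBall e g) (he : e ≤ 1 / 1000) :
    Continuous (sheetProfile μ g) :=
  continuous_iff_continuousAt.2 fun x => (hasDerivAt_sheetProfile hg he x).continuousAt

/-- Off the diagonal the moduli differ; on it the factor is a nontrivial root of unity. -/
theorem one_sub_root_mul_ne_zero (hμ : 1 / 2 < μ) (hg : InBall e g) (he : e ≤ 1 / 1000) {m k : ℕ}
    (hk : k ≠ 0) (hkm : k < m) (x y : ℝ) :
    1 - xiRoot m ^ k * (sheetProfile μ g y / sheetProfile μ g x) ≠ 0 := by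
  have hξ := isPrimitiveRoot_xiRoot (m := m) (by omega)
  intro h
  have h1 : xiRoot m ^ k * (sheetProfile μ g y / sheetProfile μ g x) = 1 :=
    (sub_eq_zero.1 h).symm
  rcases eq_or_ne y x with rfl | hne
  · rw [div_self (sheetProfile_ne_zero hg he y), mul_one] at h1
    exact hξ.pow_ne_one_of_pos_of_lt hk hkm h1
  · refine pow_profile_div_ne_one hμ hg he (m := m) (by omega) hne ?_
    have h2 := congrArg (· ^ m) h1
    simp only [one_pow] at h2
    rwa [mul_pow, ← pow_mul, mul_comm k m, pow_mul, hξ.pow_eq_one, one_pow, one_mul] at h2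

/-- Away from its own branch, the kernel has an integrable pull-back when `μ < 1`. -/
theorem integrable_branch (hμ : 1 / 2 < μ) (hμ1 : μ < 1) (hg : InBall e g) (he : e ≤ 1 / 1000)
    {m k : ℕ} (hk : k ≠ 0) (hkm : k < m) (x : ℝ) :
    Integrable fun y => ((spiralWeight y * Real.exp (-((2 * μ - 1) * spiralLog y)) : ℝ) : ℂ) *
      (1 - xiRoot m ^ k * (sheetProfile μ g y / sheetProfile μ g x))⁻¹ := by
  have hξ := isPrimitiveRoot_xiRoot (m := m) (by omega)
  have hξn : ‖xiRoot m ^ k‖ = 1 := by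
    rw [norm_pow, hξ.norm'_eq_one (by omega), one_pow]
  have hpos := radiusFn_pos (μ := μ) hg he
  have hw := continuous_spiralWeight
  have hl := continuous_spiralLog
  have hs := continuous_sheetProfile (μ := μ) hg he
  have hne := one_sub_root_mul_ne_zero hμ hg he hk hkm x
  have hcont : Continuous fun y =>
      (1 - xiRoot m ^ k * (sheetProfile μ g y / sheetProfile μ g x))⁻¹ :=
    Continuous.inv₀ (continuous_const.sub (continuous_const.mul (hs.div_const _))) hne
  have hnorm : ∀ y, ‖xiRoot m ^ k * (sheetProfile μ g y / sheetProfile μ g x)‖ =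
      radiusFn μ g y / radiusFn μ g x := fun y => by
    rw [norm_mul, hξn, one_mul, norm_profile_div hg he]
  -- At the outer end the kernel decays like T^μ against the density σ T^{-(2μ-1)}, which gives σ
  -- T^{1-μ}. At the centre the kernel tends to 1.
  refine LocallyIntegrable.integrable_of_isBigO_atBot_atTop
    (g := fun y => spiralWeight y * Real.exp ((1 - μ) * spiralLog y))
    (g' := fun y => spiralWeight y * Real.exp (-((2 * μ - 1) * spiralLog y)))
    (Continuous.locallyIntegrable (by fun_prop)) ?_ ?_ ?_ ?_
  · refine Asymptotics.IsBigO.of_bound (8 * radiusFn μ g x) ?_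
    have hlarge : ∀ᶠ y in atBot, 2 * radiusFn μ g x ≤ radiusFn μ g y :=
      (tendsto_radiusFn_atBot hμ hg he).eventually_ge_atTop _
    filter_upwards [hlarge] with y hy
    have hwy := spiralWeight_pos y
    have hx0 := hpos x
    have h2 : 2 ≤ radiusFn μ g y / radiusFn μ g x := by rwa [le_div_iff₀ hx0]
    have h3 : radiusFn μ g y / radiusFn μ g x / 2 ≤
        ‖1 - xiRoot m ^ k * (sheetProfile μ g y / sheetProfile μ g x)‖ := by
      have := norm_sub_norm_le (xiRoot m ^ k * (sheetProfile μ g y / sheetProfile μ g x)) 1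
      rw [hnorm, norm_one, norm_sub_rev] at this
      linarith
    have h4 : ‖(1 - xiRoot m ^ k * (sheetProfile μ g y / sheetProfile μ g x))⁻¹‖ ≤
        8 * radiusFn μ g x * Real.exp (μ * spiralLog y) := by
      rw [norm_inv]
      have h5 : 1 / (8 * radiusFn μ g x) * Real.exp (-(μ * spiralLog y)) ≤
          radiusFn μ g y / radiusFn μ g x / 2 := by
        calc _ = 1 / 4 * Real.exp (-(μ * spiralLog y)) / radiusFn μ g x / 2 := by
              field_simp; ring
          _ ≤ _ := by
              gcongr
              exact (radiusFn_bounds hg he y).1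
      have h6 : 0 < 1 / (8 * radiusFn μ g x) * Real.exp (-(μ * spiralLog y)) := by positivity
      refine (inv_anti₀ h6 (h5.trans h3)).trans_eq ?_
      rw [mul_inv, one_div, inv_inv, Real.exp_neg, inv_inv]
    rw [norm_mul, Complex.norm_real, Real.norm_of_nonneg (by positivity),
      Real.norm_of_nonneg (by positivity)]
    calc _ ≤ spiralWeight y * Real.exp (-((2 * μ - 1) * spiralLog y)) *
          (8 * radiusFn μ g x * Real.exp (μ * spiralLog y)) := by gcongr
      _ = 8 * radiusFn μ g x * (spiralWeight y *
          (Real.exp (-((2 * μ - 1) * spiralLog y)) * Real.exp (μ * spiralLog y))) := by ring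
      _ = _ := by
          rw [← Real.exp_add]
          ring_nf
  · refine ⟨Iic 0, Iic_mem_atBot 0, ?_⟩
    -- The condition μ < 1 enters here: the primitive T^{1-μ}/(1-μ) vanishes at the outer end.
    have hν : 0 < 1 - μ := by linarith
    refine integrableOn_Iic_deriv_of_nonneg
      (f := fun y => Real.exp ((1 - μ) * spiralLog y) / (1 - μ)) (l := 0 / (1 - μ))
      (fun y => ?_) (fun y => mul_nonneg (spiralWeight_pos y).le (Real.exp_pos _).le) ?_
    · refine ((((hasDerivAt_spiralLog y).const_mul (1 - μ)).exp).div_const _).congr_deriv ?_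
      field_simp
    · exact (Real.tendsto_exp_atBot.comp
        (tendsto_spiralLog_atBot.const_mul_atBot hν)).div_const _
  · have hlim : Tendsto (fun y => (1 - xiRoot m ^ k *
        (sheetProfile μ g y / sheetProfile μ g x))⁻¹) atTop (𝓝 1) := by
      have h0 : Tendsto (fun y => xiRoot m ^ k * (sheetProfile μ g y / sheetProfile μ g x)) atTop
          (𝓝 0) := by
        refine tendsto_zero_iff_norm_tendsto_zero.2 ?_
        simp_rw [hnorm]
        simpa using (tendsto_radiusFn_atTop hμ hg he).div_const (radiusFn μ g x)
      have h1 := (h0.const_sub 1).inv₀ (by simp)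
      simpa using h1
    have hO := (Asymptotics.isBigO_refl (fun y => ((spiralWeight y *
      Real.exp (-((2 * μ - 1) * spiralLog y)) : ℝ) : ℂ)) atTop).mul (hlim.isBigO_one ℂ)
    refine hO.trans (Asymptotics.IsBigO.of_norm_le fun y => ?_)
    rw [mul_one, Complex.norm_real, Real.norm_of_nonneg
      (mul_nonneg (spiralWeight_pos y).le (Real.exp_pos _).le)]
  · refine ⟨Ioi 0, Ioi_mem_atTop 0, ?_⟩
    have h := (integrableOn_density (a := 2 * μ - 1) (by linarith) 0).mul_const
      (Real.exp (-((2 * μ - 1) * spiralLog 0)))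
    refine h.congr (ae_of_all _ fun y => ?_)
    simp only
    rw [mul_assoc, ← Real.exp_add]
    ring_nf

theorem circ_image_univ {a B : ℝ} (ha : 0 < a) (hB : 0 < B) : circ a B '' univ = Iio 0 := by
  ext Γ
  constructor
  · rintro ⟨y, -, rfl⟩
    exact circ_neg hB y
  · intro hΓ
    exact ⟨circInv a B Γ, mem_univ _, circ_circInv ha hB hΓ⟩

theorem integrableOn_branchKernel (hμ : 1 / 2 < μ) (hμ1 : μ < 1) (hg : InBall e g)
    (he : e ≤ 1 / 1000) (hb : 0 < b) {m k : ℕ} (hk : k ≠ 0) (hkm : k < m) {t : ℝ} (ht : 0 < t)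
    {Γ : ℝ} (hΓ : Γ < 0) :
    IntegrableOn (branchKernel m k (spiralSheet μ b g t) Γ) (Iio 0) := by
  have hB : 0 < b ^ 2 * t ^ (2 * μ - 1) :=
    mul_pos (pow_pos hb 2) (Real.rpow_pos_of_pos ht _)
  have ha : 0 < 2 * μ - 1 := by linarith
  obtain ⟨x, rfl⟩ : ∃ x, circ (2 * μ - 1) (b ^ 2 * t ^ (2 * μ - 1)) x = Γ :=
    ⟨_, circ_circInv ha hB hΓ⟩
  rw [← circ_image_univ ha hB, integrableOn_image_iff_integrableOn_abs_deriv_smul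
    MeasurableSet.univ (fun y _ => (hasDerivAt_circ y).hasDerivWithinAt)
    (strictMono_circ ha hB).injective.injOn, integrableOn_univ]
  refine ((integrable_branch hμ hμ1 hg he hk hkm x).const_mul
    ((((b ^ 2 * t ^ (2 * μ - 1)) * (2 * μ - 1) : ℝ) : ℂ) * (spiralSheet μ b g t
      (circ (2 * μ - 1) (b ^ 2 * t ^ (2 * μ - 1)) x))⁻¹)).congr (ae_of_all _ fun y => ?_)
  have h0 : 0 ≤ b ^ 2 * t ^ (2 * μ - 1) * ((2 * μ - 1) * spiralWeight y *
      Real.exp (-((2 * μ - 1) * spiralLog y))) := by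
    have := spiralWeight_pos y
    positivity
  simp only
  rw [branchKernel_eq (spiralSheet_ne_zero hg he hb ht _), spiralSheet_circ_div hμ hb ht,
    abs_of_nonneg h0, Complex.real_smul]
  push_cast
  ring

theorem solvesBirkhoffRott_spiralSheet (hμ : 1 / 2 < μ) (hg : InBall e g) (he : e ≤ 1 / 1000)
    (hb : 0 < b) {m : ℕ} (hm : 0 < m) (hκ : LargeFreq μ (2 * μ - 1) m)
    (hfix : ∀ x, HasSum (fun n : ℕ => ((2 * μ - 1 : ℝ) : ℂ) *
      diffTerm μ (2 * μ - 1) (((n : ℝ) + 1) * m) g (fun y => (starRingEnd ℂ) (g y)) x) (g x)) :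
    SolvesBirkhoffRott m (spiralSheet μ b g) := by
  intro t ht Γ hΓ
  have hB : 0 < b ^ 2 * t ^ (2 * μ - 1) :=
    mul_pos (pow_pos hb 2) (Real.rpow_pos_of_pos ht _)
  have hx := circ_circInv (a := 2 * μ - 1) (by linarith) hB hΓ
  exact ⟨_, hasPV_sum_branchKernel hμ hg he hb hm hκ ht (hfix _) hx,
    hasDerivAt_conj_spiralSheet hμ hg he hb hm ht hx⟩

/-- Only the branch k = 0 is singular; its principal value is that of the sum minus the absolutely
convergent integrals of the others. -/
theorem solvesBirkhoffRottBranchwise_of_integrableOn {m : ℕ} (hm : 0 < m) {Z : ℝ → ℝ → ℂ}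
    (hZ : SolvesBirkhoffRott m Z) (hi : ∀ t, 0 < t → ∀ Γ, Γ < 0 → ∀ k, k ≠ 0 → k < m →
      IntegrableOn (branchKernel m k (Z t) Γ) (Iio 0)) : SolvesBirkhoffRottBranchwise m Z := by
  intro t ht Γ hΓ
  obtain ⟨v, hpv, hd⟩ := hZ t ht Γ hΓ
  set w : ℕ → ℂ := fun k => ∫ Γ' in Iio 0, branchKernel m k (Z t) Γ Γ' with hw
  obtain ⟨n, rfl⟩ : ∃ n, m = n + 1 := ⟨m - 1, by omega⟩
  have hother : ∀ j ∈ Finset.range n, HasPV (branchKernel (n + 1) (j + 1) (Z t) Γ) Γ (w (j + 1)) :=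
    fun j hj => HasPV.of_integrableOn
      (hi t ht Γ hΓ (j + 1) (by omega) (by have := Finset.mem_range.1 hj; omega)) Γ
  have hzero := hpv.sub (HasPV.sum hother)
  have hfun : (fun x => ∑ k ∈ Finset.range (n + 1), branchKernel (n + 1) k (Z t) Γ x -
      ∑ j ∈ Finset.range n, branchKernel (n + 1) (j + 1) (Z t) Γ x) =
      branchKernel (n + 1) 0 (Z t) Γ := by
    funext x
    rw [Finset.sum_range_succ', add_sub_cancel_left]
  rw [hfun] at hzero
  refine ⟨fun k => if k = 0 then v - ∑ j ∈ Finset.range n, w (j + 1) else w k, fun k hk => ?_, ?_⟩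
  · simp only
    split_ifs with h
    · rw [h]; exact hzero
    · obtain ⟨j, rfl⟩ : ∃ j, k = j + 1 := ⟨k - 1, by omega⟩
      exact hother j (by rw [Finset.mem_range] at hk ⊢; omega)
  · rw [Finset.sum_range_succ']
    simpa using hd

end Branch


/-! ### Continuity up to t = 0 and the initial data. -/

theorem contDiffOn_one_of_hasDerivAt {f f' : ℝ → ℝ} {s : Set ℝ} (hs : IsOpen s)
    (hd : ∀ x ∈ s, HasDerivAt f (f' x) x) (hc : ContinuousOn f' s) : ContDiffOn ℝ 1 f s := by
  rw [show (1 : WithTop ℕ∞) = 0 + 1 from rfl, contDiffOn_succ_iff_deriv_of_isOpen hs]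
  refine ⟨fun x hx => (hd x hx).differentiableAt.differentiableWithinAt, by simp, ?_⟩
  rw [contDiffOn_zero]
  exact hc.congr fun x hx => (hd x hx).deriv

section Polar

variable {μ b e : ℝ} {g : ℝ → ℂ}

/-- The spiral without its algebraic radial factor, as a function of `T`, extended by its limit
at the outer end. -/
noncomputable def unwoundSheet (g : ℝ → ℂ) (R T : ℝ) : ℂ :=
  if T ≤ 0 then (R : ℂ) else (√(realQ g (Real.log T + T) / (2 * Real.pi)) : ℂ) *
    Complex.exp (Complex.I * angleFn g (Real.log T + T))

theorem continuous_angleFn (hg : InBall e g) (he : e ≤ 1 / 1000) : Continuous (angleFn g) :=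
  continuous_iff_continuousAt.2 fun x => (hasDerivAt_angleFn hg he x).continuousAt

theorem continuous_unwoundSheet (hg : InBall e g) (he : e ≤ 1 / 1000) {q : ℝ}
    (hq : Tendsto (realQ g) atBot (𝓝 q)) :
    Continuous (unwoundSheet g √(q / (2 * Real.pi))) := by
  have hQ := continuous_realQ hg
  have hA := continuous_angleFn hg he
  set N : ℝ → ℂ := fun x => (√(realQ g x / (2 * Real.pi)) : ℂ) *
    Complex.exp (Complex.I * angleFn g x) with hN
  have hNc : Continuous N := by fun_prop
  have hNl : Tendsto N atBot (𝓝 (√(q / (2 * Real.pi)) : ℂ)) := by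
    have h1 : Tendsto (fun x => (√(realQ g x / (2 * Real.pi)) : ℂ)) atBot
        (𝓝 (√(q / (2 * Real.pi)) : ℂ)) :=
      (Complex.continuous_ofReal.tendsto _).comp
        ((Real.continuous_sqrt.tendsto _).comp (hq.div_const _))
    have h2 : Tendsto (fun x => Complex.exp (Complex.I * angleFn g x)) atBot (𝓝 1) := by
      have hc : Continuous fun s : ℝ => Complex.exp (Complex.I * s) := by fun_prop
      have := (hc.tendsto 0).comp (tendsto_angleFn_atBot hg he)
      simpa using! this
    simpa using h1.mul h2
  refine continuous_iff_continuousAt.2 fun T => ?_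
  rcases lt_trichotomy T 0 with h | rfl | h
  · refine continuousAt_const.congr (f := fun _ => (√(q / (2 * Real.pi)) : ℂ)) ?_
    filter_upwards [Iio_mem_nhds h] with s hs
    exact (if_pos (le_of_lt hs)).symm
  · have h0 : unwoundSheet g √(q / (2 * Real.pi)) 0 = (√(q / (2 * Real.pi)) : ℂ) := if_pos le_rfl
    refine continuousAt_iff_continuous_left'_right'.2 ⟨?_, ?_⟩
    · refine (tendsto_const_nhds (x := (√(q / (2 * Real.pi)) : ℂ))).congr' ?_ |>.trans_eq ?_
      · filter_upwards [self_mem_nhdsWithin] with s hs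
        exact (if_pos (le_of_lt hs)).symm
      · rw [h0]
    · unfold ContinuousWithinAt
      rw [h0]
      have hlog : Tendsto (fun T : ℝ => Real.log T + T) (𝓝[>] 0) atBot := by
        refine Real.tendsto_log_nhdsGT_zero.atBot_add (C := 0) ?_
        exact (tendsto_id (α := ℝ)).mono_left nhdsWithin_le_nhds
      refine (hNl.comp hlog).congr' ?_
      filter_upwards [self_mem_nhdsWithin] with s hs
      exact (if_neg (not_le.2 hs)).symm
  · have hc : ContinuousAt (fun T => N (Real.log T + T)) T :=
      hNc.continuousAt.comp ((Real.continuousAt_log h.ne').add continuousAt_id)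
    refine hc.congr ?_
    filter_upwards [Ioi_mem_nhds h] with s hs
    exact (if_neg (not_le.2 hs)).symm

/-- The factor t^μ cancels the t^{-μ} contained in T^{-μ}. What remains depends on t only through T,
a multiple of t, and extends continuously to T = 0. -/
theorem spiralSheet_eq_unwound (hμ : 1 / 2 < μ) (hb : 0 < b) {R : ℝ}
    (hR : b ^ (-1 / (2 * μ - 1)) * R = ((2 * μ - 1) / μ) ^ (μ / (2 * μ - 1))) {t Γ : ℝ}
    (ht : 0 ≤ t) (hΓ : Γ < 0) : spiralSheet μ b g t Γ =
      ((b * Real.exp (-(μ * -(Real.log (-Γ / b ^ 2) / (2 * μ - 1)))) : ℝ) : ℂ) *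
        unwoundSheet g R (t * Real.exp (-(Real.log (-Γ / b ^ 2) / (2 * μ - 1)))) := by
  have ha : 0 < 2 * μ - 1 := by linarith
  have hb2 : 0 < b ^ 2 := pow_pos hb 2
  set c : ℝ := -(Real.log (-Γ / b ^ 2) / (2 * μ - 1)) with hc
  rcases ht.eq_or_lt with rfl | ht
  · unfold spiralSheet unwoundSheet
    rw [if_pos le_rfl, zero_mul, if_pos le_rfl, ← Complex.ofReal_mul]
    congr 1
    have hΓ' : 0 < -Γ := by linarith
    have e1 : -((2 * μ - 1) / μ * Γ) = ((2 * μ - 1) / μ) * (-Γ) := by ring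
    rw [e1, Real.mul_rpow (div_nonneg ha.le (by linarith)) hΓ'.le, ← hR,
      Real.rpow_def_of_pos hb, Real.rpow_def_of_pos hΓ', hc, Real.log_div hΓ'.ne' hb2.ne',
      Real.log_pow]
    have e2 : b = Real.exp (Real.log b) := (Real.exp_log hb).symm
    conv_rhs => rw [e2]
    rw [← Real.exp_add, Real.log_exp]
    calc _ = Real.exp (Real.log b * (-1 / (2 * μ - 1)) +
          Real.log (-Γ) * (μ / (2 * μ - 1))) * R := by rw [Real.exp_add]; ring
      _ = _ := by
        congr 2
        push_cast
        field_simp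
        ring
  · have hT : 0 < t * Real.exp c := mul_pos ht (Real.exp_pos c)
    have hx : circInv (2 * μ - 1) (b ^ 2 * t ^ (2 * μ - 1)) Γ =
        Real.log (t * Real.exp c) + t * Real.exp c := by
      unfold circInv
      rw [log_div_mul_rpow ha hb2 ht hΓ, Real.log_mul ht.ne' (Real.exp_pos c).ne', Real.log_exp,
        Real.exp_add, Real.exp_log ht]
    have hℓ : spiralLog (Real.log (t * Real.exp c) + t * Real.exp c) = Real.log t + c := by
      rw [← hx]
      unfold circInv
      rw [spiralLog_of_add_exp, log_div_mul_rpow ha hb2 ht hΓ]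
    rw [spiralSheet_of_pos ht, hx, sheetProfile, radiusFn, hℓ, unwoundSheet, if_neg (not_le.2 hT)]
    have e1 : t ^ μ * Real.exp (-(μ * (Real.log t + c))) = Real.exp (-(μ * c)) := by
      rw [Real.rpow_def_of_pos ht, ← Real.exp_add]
      ring_nf
    rw [← e1]
    push_cast
    ring

theorem continuousOn_spiralSheet (hμ : 1 / 2 < μ) (hg : InBall e g) (he : e ≤ 1 / 1000)
    (hb : 0 < b) {q : ℝ} (hq : Tendsto (realQ g) atBot (𝓝 q))
    (hR : b ^ (-1 / (2 * μ - 1)) * √(q / (2 * Real.pi)) =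
      ((2 * μ - 1) / μ) ^ (μ / (2 * μ - 1))) :
    ContinuousOn (Function.uncurry (spiralSheet μ b g)) (Ici 0 ×ˢ Iio 0) := by
  have hG := continuous_unwoundSheet hg he hq
  have hlog : ContinuousOn (fun p : ℝ × ℝ => Real.log (-p.2 / b ^ 2)) (Ici 0 ×ˢ Iio 0) := by
    refine ContinuousOn.log (by fun_prop) fun p hp => ?_
    have h1 : p.2 < 0 := hp.2
    exact (div_pos (by linarith) (pow_pos hb 2)).ne'
  have hfun : ContinuousOn (fun p : ℝ × ℝ =>
      ((b * Real.exp (-(μ * -(Real.log (-p.2 / b ^ 2) / (2 * μ - 1)))) : ℝ) : ℂ) *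
        unwoundSheet g √(q / (2 * Real.pi))
          (p.1 * Real.exp (-(Real.log (-p.2 / b ^ 2) / (2 * μ - 1))))) (Ici 0 ×ˢ Iio 0) := by
    refine ContinuousOn.mul (by fun_prop) (hG.comp_continuousOn (by fun_prop))
  refine hfun.congr fun p hp => ?_
  exact spiralSheet_eq_unwound hμ hb hR hp.1 hp.2

/-- The amplitude at t = 0 scales as b · b^{-2μ/(2μ-1)} = b^{-1/(2μ-1)}, a nonzero power of b, so
every positive value is attained. -/
theorem exists_scale (hμ : 1 / 2 < μ) {R : ℝ} (hR : 0 < R) : ∃ b : ℝ, 0 < b ∧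
    b ^ (-1 / (2 * μ - 1)) * R = ((2 * μ - 1) / μ) ^ (μ / (2 * μ - 1)) := by
  have ha : 0 < 2 * μ - 1 := by linarith
  set C := ((2 * μ - 1) / μ) ^ (μ / (2 * μ - 1)) with hC
  have hC0 : 0 < C := Real.rpow_pos_of_pos (div_pos ha (by linarith)) _
  refine ⟨(R / C) ^ (2 * μ - 1), Real.rpow_pos_of_pos (div_pos hR hC0) _, ?_⟩
  rw [← Real.rpow_mul (div_pos hR hC0).le, mul_div_cancel₀ _ ha.ne', Real.rpow_neg_one, inv_div]
  field_simp

end Polar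


/-! ### The radius as a function of the angle, and the final assembly. -/

section Asymptotics

variable {μ b e : ℝ} {g : ℝ → ℂ}

/-- The logarithm of the angle is an increasing bijection of the line, so its inverse is continuous
and the inverse function rule applies. -/
theorem exists_angleInv (hg : InBall e g) (he : e ≤ 1 / 1000) : ∃ Θ : ℝ → ℝ,
    (∀ x, Θ (angleFn g x) = x) ∧ (∀ s, 0 < s → angleFn g (Θ s) = s) ∧
    (∀ s, 0 < s → HasDerivAt Θ (angleDens g (Θ s))⁻¹ s) ∧ Tendsto Θ atTop atTop := by
  have hpos := angleFn_pos hg he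
  have hc := continuous_angleFn hg he
  have hmono : StrictMono fun x => Real.log (angleFn g x) := fun x y hxy =>
    Real.log_lt_log (hpos x) (strictMono_angleFn hg he hxy)
  have hsurj : Function.Surjective fun x => Real.log (angleFn g x) := by
    refine Continuous.surjective (hc.log fun x => (hpos x).ne') ?_ ?_
    · exact Real.tendsto_log_atTop.comp (tendsto_angleFn_atTop hg he)
    · exact Real.tendsto_log_nhdsGT_zero.comp
        (tendsto_nhdsWithin_iff.2 ⟨tendsto_angleFn_atBot hg he, Eventually.of_forall hpos⟩)
  set L : ℝ ≃o ℝ := hmono.orderIsoOfSurjective _ hsurj with hL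
  have hLx : ∀ x, L x = Real.log (angleFn g x) := fun x => rfl
  have hinv : ∀ s, 0 < s → angleFn g (L.symm (Real.log s)) = s := by
    intro s hs
    have h := L.apply_symm_apply (Real.log s)
    rw [hLx] at h
    exact Real.log_injOn_pos (hpos _) hs h
  refine ⟨fun s => L.symm (Real.log s), fun x => by simp only [← hLx, L.symm_apply_apply], hinv,
    fun s hs => ?_, L.symm.tendsto_atTop.comp Real.tendsto_log_atTop⟩
  refine HasDerivAt.of_local_left_inverse (f := angleFn g) ?_
    (hasDerivAt_angleFn hg he _) (angleDens_pos hg he _).ne' ?_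
  · exact L.symm.continuous.continuousAt.comp (Real.continuousAt_log hs.ne')
  · filter_upwards [Ioi_mem_nhds hs] with y hy
    exact hinv y hy

/-- Everything reduces to the ratio θ/T and to Q, which both tend to 1 at the centre. -/
theorem angle_rpow_mul_radius (hg : InBall e g) (he : e ≤ 1 / 1000) (x : ℝ) :
    angleFn g x ^ μ * radiusFn μ g x = √(realQ g x / (2 * Real.pi)) *
      (angleFn g x / Real.exp (spiralLog x)) ^ μ := by
  have h0 := Real.exp_pos (spiralLog x)
  rw [Real.div_rpow (angleFn_pos hg he x).le h0.le, radiusFn, ← Real.exp_mul, Real.exp_neg,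
    mul_comm (spiralLog x)]
  field_simp

/-- The left side is θ ρ'(θ)/ρ(θ) along the curve. Since 1 - σ = Tσ, the weight cancels and only
θ/T, Q and g remain. -/
theorem angle_mul_rate_div (hg : InBall e g) (he : e ≤ 1 / 1000) (x : ℝ) :
    angleFn g x * (((1 - spiralWeight x) * (g x).im / realQ g x - μ * spiralWeight x) *
      (angleDens g x)⁻¹) = angleFn g x * (g x).im / (1 + (g x).re) -
        μ * (angleFn g x / Real.exp (spiralLog x)) * realQ g x / (1 + (g x).re) := by
  have hq : realQ g x ≠ 0 := by linarith [(realQ_bounds hg he x).1]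
  have h0 := Real.exp_pos (spiralLog x)
  have h1 := spiralWeight_pos x
  have h2 : 1 + (g x).re ≠ 0 := by
    have h3 := (abs_le.1 (abs_re_le hg x)).1
    have h4 : spiralWeight x ^ 2 ≤ 1 := pow_le_one₀ h1.le (spiralWeight_le_one x)
    nlinarith [hg.nonneg]
  unfold angleDens
  rw [one_sub_spiralWeight]
  field_simp

theorem one_add_re_bounds (hg : InBall e g) (he : e ≤ 1 / 1000) (x : ℝ) : 1 / 2 ≤ 1 + (g x).re := by
  have h3 := (abs_le.1 (abs_re_le hg x)).1
  have h4 : spiralWeight x ^ 2 ≤ 1 :=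
    pow_le_one₀ (spiralWeight_pos x).le (spiralWeight_le_one x)
  nlinarith [hg.nonneg]

theorem abs_angle_mul_im_le (hg : InBall e g) (he : e ≤ 1 / 1000) (x : ℝ) :
    |angleFn g x * (g x).im| ≤ 2 * e * spiralWeight x := by
  have h0 := spiralWeight_pos x
  have h1 := one_sub_spiralWeight x
  have he0 := hg.nonneg
  rw [abs_mul, abs_of_pos (angleFn_pos hg he x)]
  calc _ ≤ 2 * Real.exp (spiralLog x) * (e * spiralWeight x ^ 2) := by
        gcongr
        · exact (angleFn_bounds hg he x).2
        · exact abs_im_le hg x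
    _ = 2 * e * spiralWeight x * (Real.exp (spiralLog x) * spiralWeight x) := by ring
    _ ≤ 2 * e * spiralWeight x * 1 := by
        gcongr
        linarith
    _ = _ := mul_one _

theorem angle_div_bounds (hg : InBall e g) (he : e ≤ 1 / 1000) (x : ℝ) :
    0 ≤ angleFn g x / Real.exp (spiralLog x) ∧ angleFn g x / Real.exp (spiralLog x) ≤ 2 := by
  have h0 := Real.exp_pos (spiralLog x)
  exact ⟨div_nonneg (angleFn_pos hg he x).le h0.le,
    (div_le_iff₀ h0).2 (angleFn_bounds hg he x).2⟩

theorem abs_angle_rpow_mul_radius_le (hμ : 1 / 2 < μ) (hg : InBall e g) (he : e ≤ 1 / 1000)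
    (x : ℝ) : |angleFn g x ^ μ * radiusFn μ g x| ≤ 2 ^ μ := by
  obtain ⟨h1, h2⟩ := angle_div_bounds hg he x
  rw [angle_rpow_mul_radius hg he, abs_of_nonneg (by positivity)]
  have h3 : √(realQ g x / (2 * Real.pi)) ≤ 1 := by
    refine Real.sqrt_le_one.2 ?_
    rw [div_le_one (by positivity)]
    linarith [(realQ_bounds hg he x).2, Real.pi_gt_three]
  calc _ ≤ 1 * (angleFn g x / Real.exp (spiralLog x)) ^ μ := by gcongr
    _ ≤ 1 * 2 ^ μ := by gcongr
    _ = _ := one_mul _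

theorem abs_angle_mul_rate_le (hμ : 1 / 2 < μ) (hg : InBall e g) (he : e ≤ 1 / 1000) (x : ℝ) :
    |angleFn g x * (((1 - spiralWeight x) * (g x).im / realQ g x - μ * spiralWeight x) *
      (angleDens g x)⁻¹)| ≤ 1 + 8 * μ := by
  have hr := one_add_re_bounds hg he x
  obtain ⟨h1, h2⟩ := angle_div_bounds hg he x
  obtain ⟨q1, q2⟩ := realQ_bounds hg he x
  have hμ0 : 0 ≤ μ := by linarith
  have e1 := abs_angle_mul_im_le hg he x
  have h3 := spiralWeight_le_one x
  rw [angle_mul_rate_div hg he]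
  refine (abs_sub _ _).trans (add_le_add ?_ ?_)
  · rw [abs_div, abs_of_pos (by linarith : 0 < 1 + (g x).re), div_le_iff₀ (by linarith)]
    nlinarith [hg.nonneg]
  · rw [abs_of_nonneg (div_nonneg (mul_nonneg (mul_nonneg hμ0 h1) (by linarith)) (by linarith)),
      div_le_iff₀ (by linarith)]
    calc _ ≤ μ * 2 * 2 := by gcongr
      _ = 8 * μ * (1 / 2) := by ring
      _ ≤ _ := by gcongr

theorem tendsto_angle_rpow_mul_radius (hg : InBall e g) (he : e ≤ 1 / 1000) :
    Tendsto (fun x => angleFn g x ^ μ * radiusFn μ g x) atTop (𝓝 √(1 / (2 * Real.pi))) := by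
  have h1 := (Real.continuous_sqrt.tendsto _).comp
    ((tendsto_realQ_atTop hg).div_const (2 * Real.pi))
  have h2 := (tendsto_angleFn_div hg he).rpow_const (p := μ) (Or.inl one_ne_zero)
  have h3 := h1.mul h2
  rw [Real.one_rpow, mul_one] at h3
  exact h3.congr fun x => (angle_rpow_mul_radius hg he x).symm

theorem tendsto_angle_mul_rate (hg : InBall e g) (he : e ≤ 1 / 1000) :
    Tendsto (fun x => angleFn g x * (((1 - spiralWeight x) * (g x).im / realQ g x -
      μ * spiralWeight x) * (angleDens g x)⁻¹)) atTop (𝓝 (-μ)) := by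
  have hσ : Tendsto (fun x => 2 * e * spiralWeight x) atTop (𝓝 0) := by
    simpa using tendsto_spiralWeight.const_mul (2 * e)
  have hσ2 : Tendsto (fun x => e * spiralWeight x ^ 2) atTop (𝓝 0) := by
    simpa using (tendsto_spiralWeight.pow 2).const_mul e
  have h1 : Tendsto (fun x => angleFn g x * (g x).im) atTop (𝓝 0) :=
    squeeze_zero_norm (abs_angle_mul_im_le hg he) hσ
  have h2 : Tendsto (fun x => (g x).re) atTop (𝓝 0) := squeeze_zero_norm (abs_re_le hg) hσ2
  have h3 := h2.const_add 1
  have h4 := (h1.div h3 (by norm_num)).sub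
    ((((tendsto_angleFn_div hg he).const_mul μ).mul (tendsto_realQ_atTop hg)).div h3 (by norm_num))
  have e1 : (0 : ℝ) / (1 + 0) - μ * 1 * 1 / (1 + 0) = -μ := by ring
  rw [e1] at h4
  exact h4.congr fun x => (angle_mul_rate_div hg he x).symm

theorem circInv_self_similar {a B t Γ : ℝ} (ht : 0 < t) :
    circInv a (B * t ^ a) Γ = circInv a B (t ^ (-a) * Γ) := by
  have h0 : 0 < t ^ a := Real.rpow_pos_of_pos ht a
  have : -Γ / (B * t ^ a) = -(t ^ (-a) * Γ) / B := by
    rw [Real.rpow_neg ht.le]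
    field_simp
  unfold circInv
  rw [this]

theorem continuousOn_circInv_deriv {a B : ℝ} (ha : 0 < a) (hB : 0 < B) :
    ContinuousOn (fun Γ => (1 + Real.exp (-(Real.log (-Γ / B) / a))) / (a * -Γ)) (Iio 0) := by
  have hlog : ContinuousOn (fun Γ => Real.log (-Γ / B)) (Iio 0) := by
    refine ContinuousOn.log (by fun_prop) fun Γ hΓ => ?_
    exact (div_pos (neg_pos.2 hΓ) hB).ne'
  refine ContinuousOn.div (by fun_prop) (by fun_prop) fun Γ hΓ => ?_
  exact (mul_pos ha (neg_pos.2 hΓ)).ne'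

theorem contDiffOn_comp_circInv {a B : ℝ} (ha : 0 < a) (hB : 0 < B) {f f' : ℝ → ℝ}
    (hf : ∀ x, HasDerivAt f (f' x) x) (hf' : Continuous f') :
    ContDiffOn ℝ 1 (fun γ => f (circInv a B γ)) (Iio 0) := by
  refine contDiffOn_one_of_hasDerivAt isOpen_Iio
    (fun γ hγ => (hf _).comp γ (hasDerivAt_circInv hγ hB)) ?_
  refine ContinuousOn.mul (hf'.comp_continuousOn fun γ hγ => ?_) (continuousOn_circInv_deriv ha hB)
  exact (hasDerivAt_circInv hγ hB).continuousAt.continuousWithinAt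

theorem strictMonoOn_circInv {a B : ℝ} (ha : 0 < a) (hB : 0 < B) :
    StrictMonoOn (circInv a B) (Iio 0) := by
  intro γ hγ γ' hγ' h
  rw [← (strictMono_circ ha hB).lt_iff_lt, circ_circInv ha hB hγ, circ_circInv ha hB hγ']
  exact h

theorem continuous_radiusFn_deriv (hg : InBall e g) (he : e ≤ 1 / 1000) :
    Continuous fun x => radiusFn μ g x *
      ((1 - spiralWeight x) * (g x).im / realQ g x - μ * spiralWeight x) := by
  have h1 : Continuous (radiusFn μ g) :=
    continuous_iff_continuousAt.2 fun x => (hasDerivAt_radiusFn hg he x).continuousAt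
  have h2 := continuous_spiralWeight
  have h3 : Continuous fun x => (g x).im := Complex.continuous_im.comp hg.continuous
  have h4 := continuous_realQ hg
  have h5 : ∀ x, realQ g x ≠ 0 := fun x => by linarith [(realQ_bounds hg he x).1]
  fun_prop (disch := exact h5 _)

theorem surjOn_radiusFn (hμ : 1 / 2 < μ) (hg : InBall e g) (he : e ≤ 1 / 1000) {s : ℝ}
    (hs : 0 < s) : ∃ x, radiusFn μ g x = s := by
  have h1 : Continuous (radiusFn μ g) :=
    continuous_iff_continuousAt.2 fun x => (hasDerivAt_radiusFn hg he x).continuousAt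
  refine mem_range_of_exists_le_of_exists_ge h1 ?_ ?_
  · exact ((tendsto_radiusFn_atTop hμ hg he).eventually_le_const hs).exists
  · exact ((tendsto_radiusFn_atBot hμ hg he).eventually_ge_atTop s).exists

end Asymptotics

theorem theorem1p1 (μ : ℝ) (hμ : 1 / 2 < μ) :
    ∃ mstar : ℕ, ∀ m : ℕ, mstar < m →
      ∃ (Z : ℝ → ℝ → ℂ) (z : ℝ → ℂ) (r θ : ℝ → ℝ),
        -- `Z` solves the Birkhoff–Rott equation
        SolvesBirkhoffRott m Z ∧
        (μ < 1 → SolvesBirkhoffRottBranchwise m Z) ∧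
        -- the initial data, attained continuously
        (∀ Γ : ℝ, Γ < 0 →
          Z 0 Γ = (((-((2 * μ - 1) / μ * Γ)) ^ (μ / (2 * μ - 1)) : ℝ) : ℂ)) ∧
        ContinuousOn (Function.uncurry Z) (Ici 0 ×ˢ Iio 0) ∧
        -- self-similarity
        (∀ t : ℝ, 0 < t → ∀ Γ : ℝ, Γ < 0 →
          Z t Γ = ((t ^ μ : ℝ) : ℂ) * z (t ^ (1 - 2 * μ) * Γ)) ∧
        -- polar form of the profile
        (∀ γ : ℝ, γ < 0 → z γ = (r γ : ℂ) * Complex.exp (Complex.I * (θ γ : ℂ))) ∧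
        ContDiffOn ℝ 1 r (Iio 0) ∧ StrictAntiOn r (Iio 0) ∧ BijOn r (Iio 0) (Ioi 0) ∧
        ContDiffOn ℝ 1 θ (Iio 0) ∧ StrictMonoOn θ (Iio 0) ∧ BijOn θ (Iio 0) (Ioi 0) ∧
        -- behaviour of the radius as a function of the angle
        ContDiffOn ℝ 1 (radiusOfAngle r θ) (Ioi 0) ∧
        (∃ C : ℝ, ∀ x : ℝ, 0 < x → |x ^ μ * radiusOfAngle r θ x| ≤ C) ∧
        (∃ C : ℝ, ∀ x : ℝ, 0 < x → |x ^ (μ + 1) * deriv (radiusOfAngle r θ) x| ≤ C) ∧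
        ∃ β : ℝ, 0 < β ∧
          Tendsto (fun x : ℝ => x ^ μ * radiusOfAngle r θ x) atTop (𝓝 β) ∧
          Tendsto (fun x : ℝ => x ^ (μ + 1) * deriv (radiusOfAngle r θ) x) atTop
            (𝓝 (-μ * β)) := by
  -- The exponent a = 2μ - 1 is that of the circulation law -Γ ∝ T^{-a}.
  obtain ⟨M, hM⟩ := exists_profile hμ (2 * μ - 1)
  refine ⟨⌈M⌉₊, fun m hm => ?_⟩
  have hm0 : 0 < m := by omega
  obtain ⟨hκ, g, hg, hfix⟩ := hM m ((Nat.le_ceil M).trans (by exact_mod_cast hm.le))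
  have he : (1 / 2000 : ℝ) ≤ 1 / 1000 := by norm_num
  have ha : 0 < 2 * μ - 1 := by linarith
  obtain ⟨q, hq0, hq⟩ := exists_tendsto_realQ_atBot hg he
  obtain ⟨b, hb, hR⟩ := exists_scale hμ
    (Real.sqrt_pos.2 (div_pos hq0 (by positivity : 0 < 2 * Real.pi)))
  have hb2 : 0 < b ^ 2 := pow_pos hb 2
  obtain ⟨Θ, hΘ1, hΘ2, hΘ3, hΘ4⟩ := exists_angleInv hg he
  have hBR := solvesBirkhoffRott_spiralSheet hμ hg he hb hm0 hκ hfix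
  set X := circInv (2 * μ - 1) (b ^ 2) with hX
  have hXc : ∀ y, X (circ (2 * μ - 1) (b ^ 2) y) = y := circInv_circ ha hb2
  have hXm : StrictMonoOn X (Iio 0) := strictMonoOn_circInv ha hb2
  set r : ℝ → ℝ := fun γ => b * radiusFn μ g (X γ) with hr
  set θ : ℝ → ℝ := fun γ => angleFn g (X γ) with hθ
  have hranti : StrictAntiOn r (Iio 0) := fun γ hγ γ' hγ' h =>
    mul_lt_mul_of_pos_left (strictAnti_radiusFn hμ hg he (hXm hγ hγ' h)) hb
  have hθmono : StrictMonoOn θ (Iio 0) := fun γ hγ γ' hγ' h =>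
    strictMono_angleFn hg he (hXm hγ hγ' h)
  have hθsurj : ∀ s, 0 < s → ∃ γ ∈ Iio (0 : ℝ), θ γ = s := fun s hs =>
    ⟨circ (2 * μ - 1) (b ^ 2) (Θ s), circ_neg hb2 _, by
      simp only [hθ]
      rw [hXc, hΘ2 s hs]⟩
  have hrad : ∀ s, 0 < s → radiusOfAngle r θ s = b * radiusFn μ g (Θ s) := by
    intro s hs
    have h1 : θ (Function.invFunOn θ (Iio 0) s) = s := Function.invFunOn_eq (hθsurj s hs)
    -- The chosen inverse of θ may differ from the explicit one as a function, but injectivity of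
    -- the angle makes both give the same logarithmic coordinate.
    have h2 : X (Function.invFunOn θ (Iio 0) s) = Θ s := by
      rw [← hΘ1 (X (Function.invFunOn θ (Iio 0) s))]
      exact congrArg Θ h1
    simp only [radiusOfAngle, Function.comp_apply, hr]
    rw [h2]
  set ρ' : ℝ → ℝ := fun s => b * (radiusFn μ g (Θ s) * ((1 - spiralWeight (Θ s)) *
    (g (Θ s)).im / realQ g (Θ s) - μ * spiralWeight (Θ s)) * (angleDens g (Θ s))⁻¹) with hρ'
  have hderiv : ∀ s ∈ Ioi (0 : ℝ), HasDerivAt (radiusOfAngle r θ) (ρ' s) s := by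
    intro s hs
    have h1 := ((hasDerivAt_radiusFn (μ := μ) hg he (Θ s)).comp s (hΘ3 s hs)).const_mul b
    refine h1.congr_of_eventuallyEq ?_
    filter_upwards [Ioi_mem_nhds hs] with y hy
    exact hrad y hy
  have hΘc : ContinuousOn Θ (Ioi 0) := fun s hs => (hΘ3 s hs).continuousAt.continuousWithinAt
  have hval1 : ∀ s, 0 < s → s ^ μ * radiusOfAngle r θ s =
      b * (angleFn g (Θ s) ^ μ * radiusFn μ g (Θ s)) := by
    intro s hs
    rw [hrad s hs, hΘ2 s hs]
    ring
  have hval2 : ∀ s, 0 < s → s ^ (μ + 1) * deriv (radiusOfAngle r θ) s =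
      b * ((angleFn g (Θ s) ^ μ * radiusFn μ g (Θ s)) * (angleFn g (Θ s) *
        (((1 - spiralWeight (Θ s)) * (g (Θ s)).im / realQ g (Θ s) - μ * spiralWeight (Θ s)) *
          (angleDens g (Θ s))⁻¹))) := by
    intro s hs
    rw [(hderiv s hs).deriv, hΘ2 s hs, Real.rpow_add_one hs.ne']
    simp only [hρ']
    ring
  refine ⟨spiralSheet μ b g, fun γ => b * sheetProfile μ g (X γ), r, θ, hBR, fun hμ1 => ?_,
    fun Γ _ => if_pos le_rfl, continuousOn_spiralSheet hμ hg he hb hq hR, fun t ht Γ _ => ?_,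
    fun γ _ => ?_, ?_, hranti, ⟨fun γ _ => mul_pos hb (radiusFn_pos hg he _), hranti.injOn, ?_⟩, ?_,
    hθmono, ⟨fun γ _ => angleFn_pos hg he _, hθmono.injOn, fun s hs => hθsurj s hs⟩,
    contDiffOn_one_of_hasDerivAt isOpen_Ioi hderiv ?_, ⟨b * 2 ^ μ, fun s hs => ?_⟩,
    ⟨b * (2 ^ μ * (1 + 8 * μ)), fun s hs => ?_⟩, b * √(1 / (2 * Real.pi)), by positivity, ?_, ?_⟩
  · exact solvesBirkhoffRottBranchwise_of_integrableOn hm0 hBR fun t ht Γ hΓ k hk hkm =>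
      integrableOn_branchKernel hμ hμ1 hg he hb hk hkm ht hΓ
  · rw [spiralSheet_of_pos ht, circInv_self_similar ht, neg_sub]
    push_cast
    ring
  · simp only [hr, hθ, sheetProfile]
    push_cast
    ring
  · exact contDiffOn_comp_circInv ha hb2 (fun x => (hasDerivAt_radiusFn hg he x).const_mul b)
      ((continuous_radiusFn_deriv hg he).const_mul b)
  · intro s hs
    obtain ⟨x, hx⟩ := surjOn_radiusFn hμ hg he (div_pos hs hb)
    refine ⟨circ (2 * μ - 1) (b ^ 2) x, circ_neg hb2 x, ?_⟩
    simp only [hr]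
    rw [hXc, hx, mul_div_cancel₀ _ hb.ne']
  · exact contDiffOn_comp_circInv ha hb2 (hasDerivAt_angleFn hg he) (continuous_angleDens hg he)
  · have h1 := (continuous_radiusFn_deriv (μ := μ) hg he).comp_continuousOn hΘc
    have h2 := ((continuous_angleDens hg he).inv₀ fun x => (angleDens_pos hg he x).ne'
      ).comp_continuousOn hΘc
    exact continuousOn_const.mul (h1.mul h2)
  · rw [hval1 s hs, abs_mul, abs_of_pos hb]
    exact mul_le_mul_of_nonneg_left (abs_angle_rpow_mul_radius_le hμ hg he _) hb.le
  · rw [hval2 s hs, abs_mul, abs_of_pos hb, abs_mul]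
    refine mul_le_mul_of_nonneg_left (mul_le_mul (abs_angle_rpow_mul_radius_le hμ hg he _)
      (abs_angle_mul_rate_le hμ hg he _) (abs_nonneg _) (by positivity)) hb.le
  · refine (((tendsto_angle_rpow_mul_radius (μ := μ) hg he).comp hΘ4).const_mul b).congr' ?_
    filter_upwards [eventually_gt_atTop 0] with s hs
    exact (hval1 s hs).symm
  · have h1 := ((((tendsto_angle_rpow_mul_radius (μ := μ) hg he).mul
      (tendsto_angle_mul_rate (μ := μ) hg he)).comp hΘ4).const_mul b)
    have e1 : b * (√(1 / (2 * Real.pi)) * -μ) = -μ * (b * √(1 / (2 * Real.pi))) := by ring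
    rw [e1] at h1
    refine h1.congr' ?_
    filter_upwards [eventually_gt_atTop 0] with s hs
    exact (hval2 s hs).symm
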